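/- Let $V$ be a real vector space of dimension $n\ge 2$, let $\mathrm{vol}$ be the Lebesgue measure on $V$ induced by a nonzero volume form $\Omega\in\Lambda^nV^*$, and let $V^*$ carry the dual volume form $\Omega^*$ and the dual Lebesgue measure, also denoted $\mathrm{vol}$. A convex body is a non-empty compact convex set. For a convex body $K\subset V$, the projection body $\Pi K\subset V^*$ is the convex body whose support function is $h(\Pi K,v)=\mathrm{vol}(\pi_vK,\,i_v\Omega)$ for $0\ne v\in V$, where $\pi_v:V\to V/\mathbb{R}v$ is the quotient map and the volume on $V/\mathbb{R}v$ is the one induced by the form $i_v\Omega=\Omega(v,\cdot,\dots,\cdot)$. Projection bodies of convex bodies in $V^*$ are defined in the same way from $\Omega^*$; they are convex bodies in $V^{**}=V$. Let $\omega_k$ be the volume of the $k$-dimensional Euclidean unit ball. For an origin-symmetric convex body $B$ with non-empty interior in $W=V$ or $W=V^*$ put $$\mathcal V(B):=\frac{\omega_n^{n-1}}{\omega_{n-1}^n}\,\sup\bigl\{\mathrm{svol}(B\times\Pi L)\;:\;L\subset W\text{ a convex body},\ V_1(L,B)=1\bigr\},$$ where $\mathrm{svol}$ is the product of the Lebesgue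 measure on $W$ with its dual on $W^*$ (the symplectic volume on $W\times W^*$) and $V_1(L,B)=V(L,\dots,L,B)$ is the mixed volume with $n-1$ entries $L$ and one entry $B$. Then for every convex body $A\subset V$ with non-empty interior, $$\mathcal V(\Pi A)\;\le\;\frac{\omega_n^{n-1}}{\omega_{n-1}^n}\,\mathrm{vol}(\Pi A)\,\mathrm{vol}(A)^{1-n}$$ (in particular the left side is finite), with equality if and only if $A$ is homothetic to a projection body, that is, $A=t\,\Pi M+x$ for some convex body $M\subset V^*$, some $t>0$ and some $x\in V$. -/

import Mathlib

open MeasureTheory Module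
open scoped ENNReal Pointwise

noncomputable section

namespace ZonoidIneq

/-- `ω_n`: the volume of the Euclidean unit ball in dimension `n`. -/
def unitBallVolume (n : ℕ) : ℝ :=
  (volume : Measure (EuclideanSpace ℝ (Fin n))).real (Metric.ball 0 1)

section Duality

variable {V : Type*} [NormedAddCommGroup V] [NormedSpace ℝ V] [FiniteDimensional ℝ V]

instance finrank_strongDual {n : ℕ} [h : Fact (finrank ℝ V = n)] :
    Fact (finrank ℝ (StrongDual ℝ V) = n) :=
  ⟨by
    rw [← (LinearMap.toContinuousLinearMap (𝕜 := ℝ) (E := V) (F' := ℝ)).finrank_eq]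
    exact (Subspace.dual_finrank_eq (K := ℝ) (V := V)).trans h.out⟩

/-- The volume form on `V*` dual to the volume form `Ω` on `V`: the form `Ω*` with
`Ω*(ξ₁, …, ξₙ) · Ω(v₁, …, vₙ) = det (ξᵢ(vⱼ))`; see `dualForm_mul`, which determines it. It induces
the Lebesgue measure on `V*` dual to the one induced by `Ω`. -/
def dualForm {n : ℕ} [h : Fact (finrank ℝ V = n)] (Ω : V [⋀^Fin n]→ₗ[ℝ] ℝ) :
    StrongDual ℝ V [⋀^Fin n]→ₗ[ℝ] ℝ :=
  (Ω (finBasisOfFinrankEq ℝ V h.out))⁻¹ •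
    (Matrix.detRowAlternating (n := Fin n) (R := ℝ)).compLinearMap
      (LinearMap.pi fun j =>
        (ContinuousLinearMap.apply ℝ ℝ (finBasisOfFinrankEq ℝ V h.out j)).toLinearMap)

theorem dualForm_mul {n : ℕ} [h : Fact (finrank ℝ V = n)] (Ω : V [⋀^Fin n]→ₗ[ℝ] ℝ)
    (hΩ : Ω ≠ 0) (ξ : Fin n → StrongDual ℝ V) (v : Fin n → V) :
    dualForm Ω ξ * Ω v = Matrix.det (Matrix.of fun i j => ξ i (v j)) := by
  set b := finBasisOfFinrankEq ℝ V h.out with hb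
  have hb0 : Ω b ≠ 0 := (AlternatingMap.map_basis_ne_zero_iff b Ω).2 hΩ
  have h1 : Ω v = Ω b * b.det v := by
    conv_lhs => rw [AlternatingMap.eq_smul_basis_det b Ω]
    simp
  have h2 : dualForm Ω ξ = (Ω b)⁻¹ * Matrix.det (Matrix.of fun i j => ξ i (b j)) := by
    rw [dualForm, AlternatingMap.smul_apply, smul_eq_mul, ← hb]
    rfl
  have h3 : (Matrix.of fun i j => ξ i (v j)) =
      (Matrix.of fun i j => ξ i (b j)) * b.toMatrix v := by
    ext i j
    simp only [Matrix.of_apply, Matrix.mul_apply, Basis.toMatrix_apply]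
    conv_lhs => rw [← b.sum_repr (v j)]
    rw [map_sum]
    exact Finset.sum_congr rfl fun k _ => by rw [map_smul, smul_eq_mul, mul_comm]
  rw [h1, h2, h3, Matrix.det_mul, Basis.det_apply]
  field_simp

end Duality

section Contraction

variable {V : Type*} [AddCommGroup V] [Module ℝ V]

/-- The form `i_v Ω = Ω(v, ·, …, ·)` on the quotient `V ⧸ ℝ v`, computed on representatives
(chosen linearly; see `contraction_mk` for the independence of the choice). -/
def contraction {d : ℕ} (Ω : V [⋀^Fin (d + 1)]→ₗ[ℝ] ℝ) (v : V) :
    (V ⧸ Submodule.span ℝ {v}) [⋀^Fin d]→ₗ[ℝ] ℝ :=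
  (Ω.curryLeft v).compLinearMap (
    ((Submodule.mkQ (Submodule.span ℝ {v})).exists_rightInverse_of_surjective
      (Submodule.range_mkQ _)).choose)

theorem contraction_mk {d : ℕ} (Ω : V [⋀^Fin (d + 1)]→ₗ[ℝ] ℝ) (v : V) (x : Fin d → V) :
    contraction Ω v (fun i => Submodule.Quotient.mk (x i)) = Ω (Matrix.vecCons v x) := by
  have key : ∀ (s : Finset (Fin d)) (y z : Fin d → V), (∀ i, y i - z i ∈ Submodule.span ℝ {v}) →
      Ω.curryLeft v (s.piecewise y z) = Ω.curryLeft v z := by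
    intro s y z hyz
    induction s using Finset.induction_on with
    | empty => simp
    | insert i s his ih =>
      obtain ⟨c, hc⟩ := Submodule.mem_span_singleton.1 (hyz i)
      have hy : y i = (s.piecewise y z) i + c • v := by
        rw [Finset.piecewise_eq_of_notMem _ _ _ his, hc]; abel
      have hv : Ω.curryLeft v (Function.update (s.piecewise y z) i v) = 0 := by
        rw [AlternatingMap.curryLeft_apply_apply]
        exact Ω.map_eq_zero_of_eq _ (i := 0) (j := i.succ) (by simp) (Fin.succ_ne_zero i).symm
      rw [Finset.piecewise_insert, hy, AlternatingMap.map_update_add,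
        AlternatingMap.map_update_smul, hv, Function.update_eq_self, ih]
      simp
  have hs := ((Submodule.mkQ (Submodule.span ℝ {v})).exists_rightInverse_of_surjective
      (Submodule.range_mkQ _)).choose_spec
  rw [← AlternatingMap.curryLeft_apply_apply]
  have := key Finset.univ (fun i => ((Submodule.mkQ (Submodule.span ℝ
    {v})).exists_rightInverse_of_surjective (Submodule.range_mkQ _)).choose
      (Submodule.Quotient.mk (x i))) x (fun i => by
        rw [← Submodule.Quotient.eq]
        exact LinearMap.congr_fun hs _)
  rw [Finset.piecewise_univ] at this
  exact this

end Contraction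

section Bodies

variable {V : Type*} [NormedAddCommGroup V] [NormedSpace ℝ V] [FiniteDimensional ℝ V]

/-- `vol(π_v K, i_v Ω)`: the volume, for the Lebesgue measure induced by `i_v Ω`, of the image of
`K` under the quotient map `π_v : V → V ⧸ ℝ v`. -/
def shadowVolume {d : ℕ} [h : Fact (finrank ℝ V = d + 1)] (Ω : V [⋀^Fin (d + 1)]→ₗ[ℝ] ℝ)
    (K : ConvexBody V) (v : V) (hv : v ≠ 0) : ℝ :=
  haveI : IsClosed (Submodule.span ℝ {v} : Set V) := Submodule.closed_of_finiteDimensional _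
  letI : MeasurableSpace (V ⧸ Submodule.span ℝ {v}) := borel _
  haveI : BorelSpace (V ⧸ Submodule.span ℝ {v}) := ⟨rfl⟩
  haveI : Fact (finrank ℝ (V ⧸ Submodule.span ℝ {v}) = d) := ⟨by
    have h1 := Submodule.finrank_quotient_add_finrank (Submodule.span ℝ {v})
    rw [finrank_span_singleton hv, h.out] at h1
    omega⟩
  (contraction Ω v).measure.real (Submodule.mkQ (Submodule.span ℝ {v}) '' (K : Set V))

theorem shadowVolume_nonneg {d : ℕ} [Fact (finrank ℝ V = d + 1)] (Ω : V [⋀^Fin (d + 1)]→ₗ[ℝ] ℝ)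
    (K : ConvexBody V) (v : V) (hv : v ≠ 0) : 0 ≤ shadowVolume Ω K v hv :=
  measureReal_nonneg

/-- The projection body `Π K ⊆ V*`, the convex body whose support function at `v ≠ 0` is
`vol(π_v K, i_v Ω)`, that is, the intersection of the half-spaces `{ξ | ξ(v) ≤ vol(π_v K, i_v Ω)}`
(a convex body is the intersection of the half-spaces given by its support function). -/
def projectionBody {d : ℕ} [Fact (finrank ℝ V = d + 1)] (Ω : V [⋀^Fin (d + 1)]→ₗ[ℝ] ℝ)
    (K : ConvexBody V) : ConvexBody (StrongDual ℝ V) where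
  carrier := {ξ | ∀ (v : V) (hv : v ≠ 0), ξ v ≤ shadowVolume Ω K v hv}
  convex' := by
    intro ξ hξ η hη a b ha hb hab v hv
    have h1 := mul_le_mul_of_nonneg_left (hξ v hv) ha
    have h2 := mul_le_mul_of_nonneg_left (hη v hv) hb
    have h3 : a * shadowVolume Ω K v hv + b * shadowVolume Ω K v hv = shadowVolume Ω K v hv := by
      rw [← add_mul, hab, one_mul]
    have h4 : (a • ξ + b • η) v = a * ξ v + b * η v := rfl
    linarith
  isCompact' := by
    refine Metric.isCompact_of_isClosed_isBounded ?_ ?_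
    · simp only [Set.ofPred_forall]
      refine isClosed_iInter fun v => isClosed_iInter fun hv => ?_
      exact isClosed_le (ContinuousLinearMap.apply ℝ ℝ v).continuous continuous_const
    · have : CompleteSpace V := FiniteDimensional.complete ℝ V
      obtain ⟨C, hC⟩ := banach_steinhaus
        (g := fun ξ : {ξ : StrongDual ℝ V | ∀ (v : V) (hv : v ≠ 0), ξ v ≤ shadowVolume Ω K v hv} =>
          (ξ : StrongDual ℝ V)) (fun v => by
          by_cases hv : v = 0
          · exact ⟨0, fun ξ => by simp [hv]⟩
          · refine ⟨max (shadowVolume Ω K v hv) (shadowVolume Ω K (-v) (neg_ne_zero.2 hv)),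
              fun ξ => ?_⟩
            have h1 := ξ.2 v hv
            have h2 := ξ.2 (-v) (neg_ne_zero.2 hv)
            rw [map_neg] at h2
            rw [Real.norm_eq_abs]
            exact abs_le'.2 ⟨h1.trans (le_max_left _ _), h2.trans (le_max_right _ _)⟩)
      exact isBounded_iff_forall_norm_le.2 ⟨C, fun ξ hξ => hC ⟨ξ, hξ⟩⟩
  nonempty' := ⟨0, fun v hv => shadowVolume_nonneg Ω K v hv⟩

variable [MeasurableSpace V] [BorelSpace V]

/-- The mixed volume `V(K₁, …, Kₙ)` for the Lebesgue measure induced by `Ω`, by the polarization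
formula `(1/n!) ∑_{I ⊆ {1, …, n}} (-1)^{n + |I|} vol(∑_{i ∈ I} Kᵢ)`. -/
def mixedVolume {n : ℕ} [Fact (finrank ℝ V = n)] (Ω : V [⋀^Fin n]→ₗ[ℝ] ℝ)
    (K : Fin n → ConvexBody V) : ℝ :=
  (n.factorial : ℝ)⁻¹ * ∑ I : Finset (Fin n),
    (-1) ^ (n + I.card) * Ω.measure.real ((∑ i ∈ I, K i : ConvexBody V) : Set V)

/-- `V_i(K, L) = V(K, …, K, L, …, L)` with `n - i` copies of `K` and `i` copies of `L`. -/
def mixedVolumePair {n : ℕ} [Fact (finrank ℝ V = n)] (Ω : V [⋀^Fin n]→ₗ[ℝ] ℝ) (i : ℕ)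
    (K L : ConvexBody V) : ℝ :=
  mixedVolume Ω fun j : Fin n => if (j : ℕ) < n - i then K else L

/-- The symplectic volume on `V × V*`, the product of the Lebesgue measure induced by `Ω` and its
dual Lebesgue measure. -/
def symplecticVolume {n : ℕ} [Fact (finrank ℝ V = n)] (Ω : V [⋀^Fin n]→ₗ[ℝ] ℝ) :
    Measure (V × StrongDual ℝ V) :=
  Ω.measure.prod (dualForm Ω).measure

/-- The affine invariant
`𝒱(B) = ω_n^{n-1} / ω_{n-1}^n · sup {svol(B × Π L) | L a convex body in V, V₁(L, B) = 1}`, where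
`n = d + 1`. The supremum is taken in `[0, ∞]`. -/
def affineInvariant {d : ℕ} [Fact (finrank ℝ V = d + 1)] (Ω : V [⋀^Fin (d + 1)]→ₗ[ℝ] ℝ)
    (B : ConvexBody V) : ℝ≥0∞ :=
  ENNReal.ofReal (unitBallVolume (d + 1) ^ d / unitBallVolume d ^ (d + 1)) *
    ⨆ (L : ConvexBody V) (_ : mixedVolumePair Ω 1 L B = 1),
      symplecticVolume Ω ((B : Set V) ×ˢ (projectionBody Ω L : Set (StrongDual ℝ V)))

/-- `K` is homothetic to `L`: `K = t L + x` for some `t > 0` and some vector `x`. -/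
def IsHomothetic {W : Type*} [AddCommGroup W] [Module ℝ W] (K L : Set W) : Prop :=
  ∃ t : ℝ, 0 < t ∧ ∃ x : W, K = x +ᵥ t • L

/-- `P ⊆ V` is a projection body: under the canonical isomorphism `V ≅ V**`, it is the projection
body of a convex body `M` in `V*`. -/
def IsProjectionBody {d : ℕ} [Fact (finrank ℝ V = d + 1)] (Ω : V [⋀^Fin (d + 1)]→ₗ[ℝ] ℝ)
    (P : ConvexBody V) : Prop :=
  ∃ M : ConvexBody (StrongDual ℝ V),
    NormedSpace.inclusionInDoubleDual ℝ V '' (P : Set V) = (projectionBody (dualForm Ω) M : Set _)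

end Bodies

end ZonoidIneq

end

noncomputable section

namespace ZonoidIneq

set_option linter.unusedSectionVars false

/-! ### Brunn–Minkowski and Prékopa–Leindler on the real line. -/

section PrekopaLeindler

/-! Write n = d + 1. Two facts carry the theorem. The first is the symmetry V₁(L, ΠA) = V₁(A, ΠL)
for bodies A in V and L in V* with interior points (`mixedVolumePair_projectionBody_comm`). The
second is Minkowski's first inequality V₁(A, Z)ⁿ ≥ vol(A)ⁿ⁻¹ vol(Z), with its equality case. Under
the constraint V₁(L, ΠA) = 1 they give vol(ΠL) ≤ vol(A)¹⁻ⁿ, and svol(ΠA × ΠL) = vol(ΠA) vol(ΠL). A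
body L with empty interior has a null projection body and does not matter. If the supremum equals
the bound, a compactness argument produces a maximizing L (`exists_maximizer`), and the equality
case of Minkowski's inequality makes A homothetic to ΠL. Conversely, if A is homothetic to ΠM, a
suitable multiple of M attains the bound.

Surface area measures are replaced by a vector field. With the cone function f = max(0, 1 - gauge),
integration along lines parallel to v gives h(ΠA, v) = ½ ∫ |n ∂ᵥf|, so ΠA is a zonoid generated by
the integrable field n ∇f (`exists_shadow_eq_integral`). For a zonoid Z = ½ ∫ [-F, F], approximation
by zonotopes yields n V₁(A, Z) = ∫ h(ΠA, F); the volume of a body plus a zonotope is expanded by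
adding one segment at a time. The symmetry is then Fubini's theorem for ∬ |F(x)(G(y))|.

Minkowski's inequality is needed only when the second body is a zonoid. It follows from the
Brunn–Minkowski inequality by expanding vol((1 - s)A + sZ) to first order at s = 0
(`IsZonoidOf.log_mean_le`). Brunn–Minkowski comes from Prékopa–Leindler. Its equality case, for two
bodies of equal volume, is obtained by showing that the quantile functions of each linear functional
on the two bodies differ by a constant; comparing centroids shows that all these constants come from
a single translation (`exists_eq_vadd_of_measure_mean_le`). -/

theorem volume_add_le_of_isCompact {K L : Set ℝ} (hK : IsCompact K) (hL : IsCompact L)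
    (hK0 : K.Nonempty) (hL0 : L.Nonempty) : volume K + volume L ≤ volume (K + L) := by
  obtain ⟨a, ha, ha'⟩ := hK.exists_isGreatest hK0
  obtain ⟨b, hb, hb'⟩ := hL.exists_isLeast hL0
  have h1 : volume ((fun x => x + b) '' K) = volume K := by
    rw [Set.image_add_right, measure_preimage_add_right]
  have h2 : volume ((fun x => a + x) '' L) = volume L := by
    rw [Set.image_add_left, measure_preimage_add]
  -- With a the maximum of K and b the minimum of L, the translates K + b and a + L both lie in K +
  -- L and overlap at most in a + b.
  have hd : ((fun x => x + b) '' K) ∩ ((fun x => a + x) '' L) ⊆ {a + b} := by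
    rintro _ ⟨⟨x, hx, rfl⟩, y, hy, hxy⟩
    have := ha' hx
    have := hb' hy
    simp only [Set.mem_singleton_iff] at *
    linarith
  rw [← h1, ← h2, ← measure_union₀ ((hL.image (by fun_prop)).measurableSet.nullMeasurableSet)]
  · refine measure_mono (Set.union_subset ?_ ?_)
    · rintro _ ⟨x, hx, rfl⟩
      exact Set.add_mem_add hx hb
    · rintro _ ⟨x, hx, rfl⟩
      exact Set.add_mem_add ha hx
  · exact measure_mono_null hd (by simp)

theorem volume_add_le {A B C : Set ℝ} (hA : MeasurableSet A) (hB : MeasurableSet B)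
    (hA0 : A.Nonempty) (hB0 : B.Nonempty) (h : A + B ⊆ C) : volume A + volume B ≤ volume C := by
  have key : ∀ K ⊆ A, IsCompact K → ∀ L ⊆ B, IsCompact L → volume K + volume L ≤ volume C := by
    intro K hKA hK L hLB hL
    obtain ⟨a, ha⟩ := hA0
    obtain ⟨b, hb⟩ := hB0
    -- The inner compact sets may be empty; adjoining a point of A and a point of B makes them
    -- nonempty.
    have h1 := volume_add_le_of_isCompact (hK.insert a) (hL.insert b)
      (Set.insert_nonempty _ _) (Set.insert_nonempty _ _)
    refine (add_le_add (measure_mono (Set.subset_insert _ _))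
      (measure_mono (Set.subset_insert _ _))).trans (h1.trans (measure_mono ?_))
    exact (Set.add_subset_add (Set.insert_subset ha hKA) (Set.insert_subset hb hLB)).trans h
  rw [hA.measure_eq_iSup_isCompact, hB.measure_eq_iSup_isCompact]
  simp only [iSup_and']
  refine ENNReal.biSup_add_biSup_le' ⟨∅, by simp⟩ ⟨∅, by simp⟩ fun K hK L hL => ?_
  exact key K hK.1 hK.2 L hL.1 hL.2

theorem ennreal_geom_mean_le {t : ℝ} (h0 : 0 < t) (h1 : t < 1) (a b : ℝ≥0∞) :
    a ^ (1 - t) * b ^ t ≤ ENNReal.ofReal (1 - t) * a + ENNReal.ofReal t * b := by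
  have hs : 0 < 1 - t := by linarith
  induction a with
  | top => simp [ENNReal.mul_top (by simpa using hs : ENNReal.ofReal (1 - t) ≠ 0)]
  | coe a =>
    induction b with
    | top => simp [ENNReal.mul_top (by simpa using h0 : ENNReal.ofReal t ≠ 0)]
    | coe b =>
      rw [← ENNReal.coe_rpow_of_nonneg _ hs.le, ← ENNReal.coe_rpow_of_nonneg _ h0.le,
        ENNReal.ofReal, ENNReal.ofReal]
      have := NNReal.geom_mean_le_arith_mean2_weighted (1 - t).toNNReal t.toNNReal a b
        (by rw [← Real.toNNReal_add hs.le h0.le]; simp)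
      rw [Real.coe_toNNReal _ hs.le, Real.coe_toNNReal _ h0.le] at this
      exact_mod_cast this

/-- The one-dimensional Prékopa–Leindler inequality, for bounded functions. -/
theorem prekopa_leindler_real {t : ℝ} (h0 : 0 < t) (h1 : t < 1) {f g h : ℝ → ℝ≥0∞}
    (hf : Measurable f) (hg : Measurable g) (hh : Measurable h) {C : ℝ≥0∞} (hC : C ≠ ∞)
    (hfC : ∀ x, f x ≤ C) (hgC : ∀ x, g x ≤ C)
    (hfgh : ∀ x y, f x ^ (1 - t) * g y ^ t ≤ h ((1 - t) * x + t * y)) :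
    (∫⁻ x, f x) ^ (1 - t) * (∫⁻ x, g x) ^ t ≤ ∫⁻ x, h x := by
  have hs : 0 < 1 - t := by linarith
  set a := ⨆ x, f x with ha
  set b := ⨆ x, g x with hb
  have ha1 : a ≠ ∞ := ((iSup_le hfC).trans_lt hC.lt_top).ne
  have hb1 : b ≠ ∞ := ((iSup_le hgC).trans_lt hC.lt_top).ne
  by_cases ha0 : a = 0
  · have : ∀ x, f x = 0 := fun x => le_antisymm (ha0 ▸ le_iSup f x) bot_le
    simp [this, ENNReal.zero_rpow_of_pos hs]
  by_cases hb0 : b = 0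
  · have : ∀ x, g x = 0 := fun x => le_antisymm (hb0 ▸ le_iSup g x) bot_le
    simp [this, ENNReal.zero_rpow_of_pos h0]
  set M := a ^ (1 - t) * b ^ t with hM
  have hM0 : M ≠ 0 := by
    simp [hM, ENNReal.rpow_eq_zero_iff, ha0, hb0, ha1, hb1]
  have hM1 : M ≠ ∞ := ENNReal.mul_ne_top (ENNReal.rpow_ne_top_of_nonneg hs.le ha1)
    (ENNReal.rpow_ne_top_of_nonneg h0.le hb1)
  -- Layer-cake formula for functions bounded by 1, so that only the levels in (0, 1) occur.
  have layer : ∀ F : ℝ → ℝ≥0∞, Measurable F → (∀ x, F x ≤ 1) →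
      ∫⁻ x, F x = ∫⁻ s in Set.Ioo (0 : ℝ) 1, volume {x | ENNReal.ofReal s < F x} := by
    intro F hF hF1
    have hFt : ∀ x, F x ≠ ∞ := fun x => ((hF1 x).trans_lt ENNReal.one_lt_top).ne
    have e1 : ∫⁻ x, F x = ∫⁻ x, ENNReal.ofReal (F x).toReal :=
      lintegral_congr fun x => (ENNReal.ofReal_toReal (hFt x)).symm
    rw [e1, lintegral_eq_lintegral_meas_lt _ (Filter.Eventually.of_forall fun x => by positivity)
      hF.ennreal_toReal.aemeasurable]
    have e2 : ∀ s ∈ Set.Ioi (0 : ℝ), volume {x | s < (F x).toReal} =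
        (Set.Ioo (0 : ℝ) 1).indicator (fun s => volume {x | ENNReal.ofReal s < F x}) s := by
      intro s hs
      by_cases h1 : s < 1
      · rw [Set.indicator_of_mem (show s ∈ Set.Ioo (0 : ℝ) 1 from ⟨hs, h1⟩)]
        congr 1
        ext x
        exact (ENNReal.ofReal_lt_iff_lt_toReal (le_of_lt hs) (hFt x)).symm
      · rw [Set.indicator_of_notMem (fun h : s ∈ Set.Ioo (0 : ℝ) 1 => h1 h.2)]
        have : {x | s < (F x).toReal} = ∅ := by
          ext x
          have : (F x).toReal ≤ 1 := ENNReal.toReal_le_of_le_ofReal zero_le_one (by simpa using hF1 x)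
          simp only [Set.mem_ofPred_eq, Set.mem_empty_iff_false, iff_false, not_lt]
          linarith
        rw [this, measure_empty]
    rw [setLIntegral_congr_fun measurableSet_Ioi e2, lintegral_indicator measurableSet_Ioo,
      Measure.restrict_restrict measurableSet_Ioo,
      Set.inter_eq_left.2 (fun x hx => hx.1)]
  have hF : ∀ x, f x / a ≤ 1 := fun x => ENNReal.div_le_of_le_mul (by simpa using le_iSup f x)
  have hG : ∀ x, g x / b ≤ 1 := fun x => ENNReal.div_le_of_le_mul (by simpa using le_iSup g x)
  have lf := layer (fun x => f x / a) (hf.div_const _) hF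
  have lg := layer (fun x => g x / b) (hg.div_const _) hG
  -- Truncating h / M at 1 only lowers its integral and does not affect the levels below 1.
  have lh := layer (fun x => min (h x / M) 1) ((hh.div_const _).min measurable_const)
    (fun x => min_le_right _ _)
  -- After normalization by the suprema a and b, the superlevel sets of f / a and g / b are nonempty
  -- at every level s < 1, and their weighted sum lies in that of h / M. One-dimensional
  -- Brunn–Minkowski therefore applies at each level.
  have step : ∀ s ∈ Set.Ioo (0 : ℝ) 1,
      ENNReal.ofReal (1 - t) * volume {x | ENNReal.ofReal s < f x / a} +
        ENNReal.ofReal t * volume {x | ENNReal.ofReal s < g x / b} ≤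
      volume {x | ENNReal.ofReal s < min (h x / M) 1} := by
    intro s hs1
    have v1 : ∀ (r : ℝ) (_ : 0 < r) (A : Set ℝ), ENNReal.ofReal r * volume A =
        volume (r • A) := by
      intro r hr A
      rw [Measure.addHaar_smul]
      simp [abs_of_pos hr]
    rw [v1 _ hs, v1 _ h0]
    have mA : MeasurableSet {x | ENNReal.ofReal s < f x / a} :=
      measurableSet_lt measurable_const (hf.div_const _)
    have mB : MeasurableSet {x | ENNReal.ofReal s < g x / b} :=
      measurableSet_lt measurable_const (hg.div_const _)
    have hs1' : ENNReal.ofReal s < 1 := by simpa using hs1.2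
    refine volume_add_le (mA.const_smul₀ _) (mB.const_smul₀ _) ?_ ?_ ?_
    · refine Set.Nonempty.smul_set ?_
      have : ENNReal.ofReal s * a < a := by
        simpa using ENNReal.mul_lt_mul_left ha0 ha1 hs1'
      obtain ⟨x, hx⟩ := lt_iSup_iff.1 this
      exact ⟨x, (ENNReal.lt_div_iff_mul_lt (Or.inl ha0) (Or.inl ha1)).2 hx⟩
    · refine Set.Nonempty.smul_set ?_
      have : ENNReal.ofReal s * b < b := by
        simpa using ENNReal.mul_lt_mul_left hb0 hb1 hs1'
      obtain ⟨x, hx⟩ := lt_iSup_iff.1 this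
      exact ⟨x, (ENNReal.lt_div_iff_mul_lt (Or.inl hb0) (Or.inl hb1)).2 hx⟩
    · rintro _ ⟨_, ⟨x, hx, rfl⟩, _, ⟨y, hy, rfl⟩, rfl⟩
      simp only [Set.mem_ofPred_eq, lt_min_iff, smul_eq_mul] at *
      refine ⟨?_, hs1'⟩
      rw [ENNReal.lt_div_iff_mul_lt (Or.inl ha0) (Or.inl ha1)] at hx
      rw [ENNReal.lt_div_iff_mul_lt (Or.inl hb0) (Or.inl hb1)] at hy
      rw [ENNReal.lt_div_iff_mul_lt (Or.inl hM0) (Or.inl hM1)]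
      refine lt_of_lt_of_le ?_ (hfgh x y)
      have e3 : ENNReal.ofReal s * M = (ENNReal.ofReal s * a) ^ (1 - t) *
          (ENNReal.ofReal s * b) ^ t := by
        rw [ENNReal.mul_rpow_of_nonneg _ _ hs.le, ENNReal.mul_rpow_of_nonneg _ _ h0.le, hM]
        have : ENNReal.ofReal s = ENNReal.ofReal s ^ (1 - t) * ENNReal.ofReal s ^ t := by
          rw [← ENNReal.rpow_add _ _ (by simpa using hs1.1) ENNReal.ofReal_ne_top]
          simp
        conv_lhs => rw [this]
        ring
      rw [e3]
      exact ENNReal.mul_lt_mul (ENNReal.rpow_lt_rpow hx hs) (ENNReal.rpow_lt_rpow hy h0)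
  have meas : ∀ F : ℝ → ℝ≥0∞, Measurable F →
      Measurable fun s : ℝ => volume {x | ENNReal.ofReal s < F x} := by
    intro F hF
    refine Antitone.measurable fun s s' hss => measure_mono fun x hx => ?_
    exact lt_of_le_of_lt (ENNReal.ofReal_le_ofReal hss) hx
  have main : ENNReal.ofReal (1 - t) * (∫⁻ x, f x / a) + ENNReal.ofReal t * (∫⁻ x, g x / b) ≤
      ∫⁻ x, h x / M := by
    refine le_trans ?_ (lintegral_mono fun x => min_le_left (h x / M) 1)
    rw [lf, lg, lh, ← lintegral_const_mul _ (meas _ (hf.div_const _)),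
      ← lintegral_const_mul _ (meas _ (hg.div_const _)),
      ← lintegral_add_left ((meas _ (hf.div_const _)).const_mul _)]
    exact setLIntegral_mono' measurableSet_Ioo step
  have := (ennreal_geom_mean_le h0 h1 _ _).trans main
  simp only [div_eq_mul_inv] at this
  rw [lintegral_mul_const _ hf, lintegral_mul_const _ hg, lintegral_mul_const _ hh,
    ENNReal.mul_rpow_of_nonneg _ _ hs.le, ENNReal.mul_rpow_of_nonneg _ _ h0.le,
    ENNReal.inv_rpow, ENNReal.inv_rpow] at this
  have e4 : M⁻¹ = (a ^ (1 - t))⁻¹ * (b ^ t)⁻¹ :=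
    ENNReal.mul_inv (Or.inr (ENNReal.rpow_ne_top_of_nonneg h0.le hb1))
      (Or.inl (ENNReal.rpow_ne_top_of_nonneg hs.le ha1))
  rw [mul_mul_mul_comm, ← e4] at this
  exact (ENNReal.mul_le_mul_iff_left (ENNReal.inv_ne_zero.2 hM1) (ENNReal.inv_ne_top.2 hM0)).1 this

end PrekopaLeindler
-- Splittings V ≅ ℝ × E, and Prékopa–Leindler in all dimensions.
section ProductDecomposition

/-- The image of μ is a Haar measure on ℝ × E, hence a multiple of any product of Haar measures; the
constant is absorbed into ν. -/
theorem exists_measurePreserving_prod {V E : Type*} [NormedAddCommGroup V] [NormedSpace ℝ V]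
    [FiniteDimensional ℝ V] [MeasurableSpace V] [BorelSpace V] [NormedAddCommGroup E]
    [NormedSpace ℝ E] [MeasurableSpace E] [BorelSpace E] (μ : Measure V) [μ.IsAddHaarMeasure]
    (e : V ≃L[ℝ] ℝ × E) :
    ∃ ν : Measure E, ν.IsAddHaarMeasure ∧ MeasurePreserving e μ ((volume : Measure ℝ).prod ν) := by
  have : FiniteDimensional ℝ (ℝ × E) := e.toLinearEquiv.finiteDimensional
  have : FiniteDimensional ℝ E := FiniteDimensional.of_surjective (LinearMap.snd ℝ ℝ E)
    Prod.snd_surjective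
  let ν₀ : Measure E := Measure.addHaar
  have hm : (μ.map e).IsAddHaarMeasure := e.isAddHaarMeasure_map μ
  set c := Measure.addHaarScalarFactor (μ.map e) ((volume : Measure ℝ).prod ν₀) with hc
  have h1 : μ.map e = c • (volume : Measure ℝ).prod ν₀ :=
    Measure.isAddLeftInvariant_eq_smul _ _
  have hc0 : c ≠ 0 := (Measure.addHaarScalarFactor_pos_of_isAddHaarMeasure _ _).ne'
  refine ⟨c • ν₀, Measure.IsAddHaarMeasure.nnreal_smul _ hc0, e.continuous.measurable, ?_⟩
  rw [h1, Measure.prod_smul_right]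

variable {V : Type*} [NormedAddCommGroup V] [NormedSpace ℝ V]

/-- A linear functional `u` and a vector `v` with `u v = 1` split `V` as `ℝ × ker u`. -/
theorem exists_split (u : StrongDual ℝ V) (v : V) (h : u v = 1) :
    ∃ e : V ≃L[ℝ] ℝ × LinearMap.ker (u : V →ₗ[ℝ] ℝ), (∀ x, (e x).1 = u x) ∧ e v = (1, 0) := by
  have hr : Function.RightInverse (ContinuousLinearMap.toSpanSingleton ℝ v) u := fun x => by
    simp [h]
  refine ⟨ContinuousLinearEquiv.equivOfRightInverse u (ContinuousLinearMap.toSpanSingleton ℝ v) hr,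
    fun x => rfl, ?_⟩
  apply (ContinuousLinearEquiv.equivOfRightInverse u
    (ContinuousLinearMap.toSpanSingleton ℝ v) hr).symm.injective
  simp

variable [FiniteDimensional ℝ V]

theorem finrank_of_equiv_prod {E : Type*} [NormedAddCommGroup E]
    [NormedSpace ℝ E] (e : V ≃L[ℝ] ℝ × E) : finrank ℝ V = finrank ℝ E + 1 := by
  have : FiniteDimensional ℝ (ℝ × E) := e.toLinearEquiv.finiteDimensional
  have : FiniteDimensional ℝ E := FiniteDimensional.of_surjective (LinearMap.snd ℝ ℝ E)
    Prod.snd_surjective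
  rw [e.toLinearEquiv.finrank_eq, finrank_prod]
  simp [add_comm]

variable [MeasurableSpace V] [BorelSpace V]

/-- Induction on the dimension: by the inductive hypothesis on E, the fibre integrals over ℝ satisfy
the hypothesis of the one-dimensional inequality, and Tonelli concludes. The domination by C on a
ball makes the fibre integrals bounded, as the one-dimensional case requires. -/
theorem prekopa_leindler (n : ℕ) : ∀ {V : Type*} [NormedAddCommGroup V] [NormedSpace ℝ V]
    [FiniteDimensional ℝ V] [MeasurableSpace V] [BorelSpace V] (_ : finrank ℝ V = n)
    (μ : Measure V) [μ.IsAddHaarMeasure] {t : ℝ} (_ : 0 < t) (_ : t < 1) {f g h : V → ℝ≥0∞}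
    (_ : Measurable f) (_ : Measurable g) (_ : Measurable h) {C : ℝ≥0∞} (_ : C ≠ ∞) {R : ℝ}
    (_ : ∀ x, f x ≤ (Metric.closedBall 0 R).indicator (fun _ => C) x)
    (_ : ∀ x, g x ≤ (Metric.closedBall 0 R).indicator (fun _ => C) x)
    (_ : ∀ x y, f x ^ (1 - t) * g y ^ t ≤ h ((1 - t) • x + t • y)),
    (∫⁻ x, f x ∂μ) ^ (1 - t) * (∫⁻ x, g x ∂μ) ^ t ≤ ∫⁻ x, h x ∂μ := by
  induction n with
  | zero =>
    intro V _ _ _ _ _ hV μ _ t h0 h1 f g h hf hg hh C hC R hfC hgC hfgh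
    have hs : 0 < 1 - t := by linarith
    have : Subsingleton V := finrank_zero_iff.1 hV
    have key : ∀ F : V → ℝ≥0∞, ∫⁻ x, F x ∂μ = F 0 * μ Set.univ := fun F => by
      rw [← lintegral_const]
      exact lintegral_congr fun x => by rw [Subsingleton.elim x 0]
    rw [key, key, key, ENNReal.mul_rpow_of_nonneg _ _ hs.le, ENNReal.mul_rpow_of_nonneg _ _ h0.le,
      mul_mul_mul_comm]
    have h2 : μ Set.univ ^ (1 - t) * μ Set.univ ^ t = μ Set.univ := by
      rw [← ENNReal.rpow_add _ _ (NeZero.ne _)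
        (Set.finite_univ.isCompact.measure_lt_top).ne]
      simp
    rw [h2]
    gcongr
    simpa using hfgh 0 0
  | succ n ih =>
    intro V _ _ _ _ _ hV μ _ t h0 h1 f g h hf hg hh C hC R hfC hgC hfgh
    have hs : 0 < 1 - t := by linarith
    have : Nontrivial V := nontrivial_of_finrank_pos (R := ℝ) (by omega)
    obtain ⟨v, hv⟩ := exists_ne (0 : V)
    obtain ⟨u, hu⟩ := SeparatingDual.exists_eq_one (R := ℝ) hv
    obtain ⟨e, -, -⟩ := exists_split u v hu
    have hE := finrank_of_equiv_prod e
    set E := LinearMap.ker (u : V →ₗ[ℝ] ℝ) with hEdef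
    obtain ⟨ν, hν, he⟩ := exists_measurePreserving_prod μ e
    obtain ⟨R', hR'⟩ : ∃ R' : ℝ, ∀ x : V, ‖x‖ ≤ R → ‖e x‖ ≤ R' :=
      ⟨‖(e : V →L[ℝ] ℝ × E)‖ * R, fun x hx => ((e : V →L[ℝ] ℝ × E).le_opNorm x).trans
        (by gcongr)⟩
    have hbound : ∀ F : V → ℝ≥0∞,
        (∀ x, F x ≤ (Metric.closedBall 0 R).indicator (fun _ => C) x) →
        ∀ s y, F (e.symm (s, y)) ≤ (Metric.closedBall (0 : ℝ) R').indicator (fun _ =>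
          (Metric.closedBall (0 : E) R').indicator (fun _ => C) y) s := by
      intro F hF s y
      refine (hF _).trans ?_
      by_cases hx : ‖e.symm (s, y)‖ ≤ R
      · have := hR' _ hx
        rw [e.apply_symm_apply, Prod.norm_def, max_le_iff] at this
        rw [Set.indicator_of_mem (by simpa using hx), Set.indicator_of_mem (by simpa using this.1),
          Set.indicator_of_mem (by simpa using this.2)]
      · rw [Set.indicator_of_notMem (by simpa using hx)]
        exact bot_le
    have fub : ∀ F : V → ℝ≥0∞, Measurable F →
        ∫⁻ x, F x ∂μ = ∫⁻ s, ∫⁻ y, F (e.symm (s, y)) ∂ν := by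
      intro F hF
      have hF' : Measurable fun p : ℝ × E => F (e.symm p) := hF.comp e.symm.continuous.measurable
      rw [← lintegral_prod _ hF'.aemeasurable, ← he.lintegral_comp hF']
      simp
    have msl : ∀ F : V → ℝ≥0∞, Measurable F → ∀ s, Measurable fun y : E => F (e.symm (s, y)) :=
      fun F hF s => hF.comp (e.symm.continuous.measurable.comp measurable_prodMk_left)
    have msl' : ∀ F : V → ℝ≥0∞, Measurable F →
        Measurable fun s : ℝ => ∫⁻ y, F (e.symm (s, y)) ∂ν := fun F hF =>
      Measurable.lintegral_prod_right' (f := fun p : ℝ × E => F (e.symm p))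
        (hF.comp e.symm.continuous.measurable)
    rw [fub f hf, fub g hg, fub h hh]
    have hb2 : ∀ F : V → ℝ≥0∞,
        (∀ x, F x ≤ (Metric.closedBall 0 R).indicator (fun _ => C) x) →
        ∀ s, ∫⁻ y, F (e.symm (s, y)) ∂ν ≤ C * ν (Metric.closedBall (0 : E) R') := by
      intro F hF s
      rw [← lintegral_indicator_const Metric.isClosed_closedBall.measurableSet]
      exact lintegral_mono fun y => (hbound F hF s y).trans (Set.indicator_le_self' (by simp) _)
    refine prekopa_leindler_real h0 h1 (msl' f hf) (msl' g hg) (msl' h hh)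
      (C := C * ν (Metric.closedBall (0 : E) R'))
      (ENNReal.mul_ne_top hC (ProperSpace.isCompact_closedBall _ _).measure_lt_top.ne)
      (hb2 f hfC) (hb2 g hgC) fun x y => ?_
    refine ih (by omega) ν h0 h1 (msl f hf x) (msl g hg y) (msl h hh _) hC (R := R')
      (fun z => (hbound f hfC x z).trans (Set.indicator_le_self' (by simp) _))
      (fun z => (hbound g hgC y z).trans (Set.indicator_le_self' (by simp) _)) fun z w => ?_
    refine (hfgh _ _).trans_eq ?_
    rw [← map_smul, ← map_smul, ← map_add]
    simp

/-- The multiplicative Brunn–Minkowski inequality for compact sets. -/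
theorem measure_rpow_mul_le (μ : Measure V) [μ.IsAddHaarMeasure] {t : ℝ} (h0 : 0 ≤ t) (h1 : t ≤ 1)
    {K L M : Set V} (hK : IsCompact K) (hL : IsCompact L) (hM : IsCompact M)
    (hK0 : K.Nonempty) (hL0 : L.Nonempty)
    (h : (1 - t) • K + t • L ⊆ M) :
    μ.real K ^ (1 - t) * μ.real L ^ t ≤ μ.real M := by
  rcases h0.eq_or_lt with rfl | h0
  · simp only [sub_zero, Real.rpow_one, Real.rpow_zero, mul_one]
    refine measureReal_mono ?_ hM.measure_lt_top.ne
    simpa [Set.zero_smul_set hL0] using h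
  rcases h1.eq_or_lt with rfl | h1
  · simp only [sub_self, Real.rpow_one, Real.rpow_zero, one_mul]
    refine measureReal_mono ?_ hM.measure_lt_top.ne
    simpa [Set.zero_smul_set hK0] using h
  have hs : 0 < 1 - t := by linarith
  obtain ⟨R₁, hR₁⟩ := hK.isBounded.subset_closedBall 0
  obtain ⟨R₂, hR₂⟩ := hL.isBounded.subset_closedBall 0
  have hb : ∀ {A : Set V}, A ⊆ Metric.closedBall 0 (max R₁ R₂) → ∀ x,
      A.indicator (fun _ => (1 : ℝ≥0∞)) x ≤
        (Metric.closedBall 0 (max R₁ R₂)).indicator (fun _ => 1) x := fun hA x =>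
    Set.indicator_le_indicator_of_subset hA (by simp) x
  have := prekopa_leindler _ rfl μ h0 h1
    (f := K.indicator fun _ => 1) (g := L.indicator fun _ => 1) (h := M.indicator fun _ => 1)
    (measurable_const.indicator hK.measurableSet) (measurable_const.indicator hL.measurableSet)
    (measurable_const.indicator hM.measurableSet) (C := 1) (by simp) (R := max R₁ R₂)
    (hb (hR₁.trans (Metric.closedBall_subset_closedBall (le_max_left _ _))))
    (hb (hR₂.trans (Metric.closedBall_subset_closedBall (le_max_right _ _)))) (fun x y => by
      by_cases hx : x ∈ K
      · by_cases hy : y ∈ L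
        · rw [Set.indicator_of_mem (h (Set.add_mem_add (Set.smul_mem_smul_set hx)
            (Set.smul_mem_smul_set hy)))]
          simp [hx, hy]
        · simp [hy, h0]
      · simp [hx, hs])
  rw [lintegral_indicator_const hK.measurableSet, lintegral_indicator_const hL.measurableSet,
    lintegral_indicator_const hM.measurableSet, one_mul, one_mul, one_mul] at this
  have h3 := ENNReal.toReal_mono hM.measure_lt_top.ne this
  rwa [ENNReal.toReal_mul, ← ENNReal.toReal_rpow, ← ENNReal.toReal_rpow] at h3

end ProductDecomposition

/-! ### Slices and half-space parts of a body, and quantiles of a linear functional. -/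

section Sections

variable {V E : Type*} [NormedAddCommGroup V] [NormedSpace ℝ V] [FiniteDimensional ℝ V]
  [MeasurableSpace V] [BorelSpace V] [NormedAddCommGroup E] [NormedSpace ℝ E]
  [FiniteDimensional ℝ E] [MeasurableSpace E] [BorelSpace E]

/-- The volume of the slice of `A` over `s`, for a splitting `e : V ≃ ℝ × E`. -/
def sliceVolume (ν : Measure E) (e : V ≃L[ℝ] ℝ × E) (A : Set V) (s : ℝ) : ℝ :=
  ν.real {y | e.symm (s, y) ∈ A}

/-- The volume of the part of `A` where the functional `u` is at most `s`. -/
def lowerVolume (μ : Measure V) (u : StrongDual ℝ V) (A : Set V) (s : ℝ) : ℝ :=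
  μ.real (A ∩ {x | u x ≤ s})

theorem isCompact_slice (e : V ≃L[ℝ] ℝ × E) {A : Set V} (hA : IsCompact A) (s : ℝ) :
    IsCompact {y | e.symm (s, y) ∈ A} := by
  have : {y | e.symm (s, y) ∈ A} = Prod.snd '' (e '' A ∩ Prod.fst ⁻¹' {s}) := by
    ext y
    constructor
    · intro hy
      exact ⟨(s, y), ⟨⟨_, hy, by simp⟩, rfl⟩, rfl⟩
    · rintro ⟨⟨s', y'⟩, ⟨⟨x, hx, hxe⟩, hs⟩, rfl⟩
      obtain rfl : s' = s := hs
      simpa [← hxe] using hx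
  rw [this]
  exact ((hA.image e.continuous).inter_right (isClosed_singleton.preimage continuous_fst)).image
    continuous_snd

variable (u : StrongDual ℝ V) (e : V ≃L[ℝ] ℝ × E)

theorem slice_nonempty (hu : ∀ x, (e x).1 = u x) {A : Set V} {s : ℝ} (hs : s ∈ u '' A) :
    {y | e.symm (s, y) ∈ A}.Nonempty := by
  obtain ⟨x, hx, rfl⟩ := hs
  exact ⟨(e x).2, by simpa [← hu] using hx⟩

theorem sliceVolume_rpow_mul_le (ν : Measure E) [ν.IsAddHaarMeasure] (hu : ∀ x, (e x).1 = u x)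
    {A B M : Set V} (hA : IsCompact A) (hB : IsCompact B) (hM : IsCompact M) {t : ℝ} (h0 : 0 ≤ t)
    (h1 : t ≤ 1) (h : (1 - t) • A + t • B ⊆ M) {r r' : ℝ} (hr : r ∈ u '' A) (hr' : r' ∈ u '' B) :
    sliceVolume ν e A r ^ (1 - t) * sliceVolume ν e B r' ^ t ≤
      sliceVolume ν e M ((1 - t) * r + t * r') := by
  refine measure_rpow_mul_le ν h0 h1 (isCompact_slice e hA _) (isCompact_slice e hB _)
    (isCompact_slice e hM _) (slice_nonempty u e hu hr) (slice_nonempty u e hu hr') ?_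
  rintro _ ⟨_, ⟨y, hy, rfl⟩, _, ⟨z, hz, rfl⟩, rfl⟩
  refine h ⟨_, Set.smul_mem_smul_set hy, _, Set.smul_mem_smul_set hz, ?_⟩
  simp only [← map_smul, ← map_add]
  simp

theorem sliceVolume_pos (ν : Measure E) [ν.IsAddHaarMeasure] (hu : ∀ x, (e x).1 = u x)
    {A : Set V} (hA : IsCompact A) {s : ℝ} (hs : s ∈ u '' interior A) :
    0 < sliceVolume ν e A s := by
  have ho : IsOpen {y | e.symm (s, y) ∈ interior A} :=
    isOpen_interior.preimage (e.symm.continuous.comp (by fun_prop))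
  have h1 := ho.measure_pos ν (slice_nonempty u e hu hs)
  refine ENNReal.toReal_pos (h1.trans_le (measure_mono fun y hy => ?_)).ne'
    (isCompact_slice e hA s).measure_lt_top.ne
  exact interior_subset (s := A) hy

theorem isOpen_image_interior (hu : u ≠ 0) (A : Set V) : IsOpen (u '' interior A) :=
  u.isOpenMap_of_ne_zero hu _ isOpen_interior

/-- Brunn–Minkowski in E makes the slice volume log-concave, and a concave function on an open
interval is continuous. -/
theorem continuousOn_sliceVolume (ν : Measure E) [ν.IsAddHaarMeasure] (hu0 : u ≠ 0)
    (hu : ∀ x, (e x).1 = u x) {A : Set V} (hA : IsCompact A) (hAc : Convex ℝ A) :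
    ContinuousOn (sliceVolume ν e A) (u '' interior A) := by
  have hconc : ConcaveOn ℝ (u '' interior A) fun s => Real.log (sliceVolume ν e A s) := by
    refine ⟨hAc.interior.linear_image (u : V →ₗ[ℝ] ℝ), fun x hx y hy a b ha hb hab => ?_⟩
    obtain rfl : a = 1 - b := by linarith
    have px := sliceVolume_pos u e ν hu hA hx
    have py := sliceVolume_pos u e ν hu hA hy
    have := sliceVolume_rpow_mul_le u e ν hu hA hA hA hb (by linarith)
      (hAc.set_combo_subset ha hb hab) (Set.image_mono interior_subset hx)
      (Set.image_mono interior_subset hy)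
    simp only [smul_eq_mul]
    rw [← Real.log_rpow px, ← Real.log_rpow py, ← Real.log_mul (by positivity) (by positivity)]
    exact Real.log_le_log (by positivity) this
  refine ((hconc.continuousOn (isOpen_image_interior u hu0 A)).rexp).congr fun s hs => ?_
  exact (Real.exp_log (sliceVolume_pos u e ν hu hA hs)).symm

variable {u e} {μ : Measure V} [μ.IsAddHaarMeasure] {ν : Measure E} [ν.IsAddHaarMeasure]

theorem measure_level (hu : ∀ x, (e x).1 = u x)
    (he : MeasurePreserving e μ ((volume : Measure ℝ).prod ν)) (s : ℝ) :
    μ {x | u x = s} = 0 := by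
  have : {x | u x = s} = e ⁻¹' ({s} ×ˢ Set.univ) := by
    ext x; simp [hu]
  rw [this, he.measure_preimage ((measurableSet_singleton s).prod
    MeasurableSet.univ).nullMeasurableSet, Measure.prod_prod]
  simp

theorem integrable_sliceVolume (he : MeasurePreserving e μ ((volume : Measure ℝ).prod ν))
    {A : Set V} (hA : IsCompact A) : Integrable (sliceVolume ν e A) := by
  have hm : MeasurableSet (e.symm ⁻¹' A) := e.symm.continuous.measurable hA.measurableSet
  refine Measure.integrable_measure_prodMk_left hm ?_
  rw [← he.measure_preimage hm.nullMeasurableSet, ← Set.preimage_comp]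
  simpa using hA.measure_lt_top.ne

theorem lowerVolume_eq (hu : ∀ x, (e x).1 = u x)
    (he : MeasurePreserving e μ ((volume : Measure ℝ).prod ν)) {A : Set V} (hA : IsCompact A)
    (s : ℝ) : lowerVolume μ u A s = ∫ r in Set.Iic s, sliceVolume ν e A r := by
  have hm : MeasurableSet (A ∩ {x | u x ≤ s}) :=
    hA.measurableSet.inter (measurableSet_le u.continuous.measurable measurable_const)
  have hm' := e.symm.continuous.measurable hm
  have h1 : μ (A ∩ {x | u x ≤ s}) = ∫⁻ r, ν (Prod.mk r ⁻¹' (e.symm ⁻¹' (A ∩ {x | u x ≤ s}))) := by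
    rw [← Measure.prod_apply hm', ← he.measure_preimage hm'.nullMeasurableSet,
      ← Set.preimage_comp]
    simp
  have h2 : ∀ r, ν (Prod.mk r ⁻¹' (e.symm ⁻¹' (A ∩ {x | u x ≤ s}))) =
      (Set.Iic s).indicator (fun r => ENNReal.ofReal (sliceVolume ν e A r)) r := by
    intro r
    by_cases hr : r ≤ s
    · rw [Set.indicator_of_mem (show r ∈ Set.Iic s from hr), sliceVolume,
        ofReal_measureReal (isCompact_slice e hA r).measure_lt_top.ne]
      congr 1
      ext y
      simp [← hu, hr]
    · rw [Set.indicator_of_notMem (show r ∉ Set.Iic s from hr)]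
      convert measure_empty (μ := ν)
      ext y
      simp [← hu, hr]
  rw [lowerVolume, measureReal_def, h1, lintegral_congr h2, lintegral_indicator measurableSet_Iic,
    integral_eq_lintegral_of_nonneg_ae (f := sliceVolume ν e A) (Filter.Eventually.of_forall fun _ => measureReal_nonneg)
      (integrable_sliceVolume he hA).aestronglyMeasurable.restrict]

theorem lowerVolume_eq_add (hu : ∀ x, (e x).1 = u x)
    (he : MeasurePreserving e μ ((volume : Measure ℝ).prod ν)) {A : Set V} (hA : IsCompact A)
    (s r : ℝ) : lowerVolume μ u A r = lowerVolume μ u A s + ∫ x in s..r, sliceVolume ν e A x := by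
  rw [lowerVolume_eq hu he hA, lowerVolume_eq hu he hA,
    ← intervalIntegral.integral_Iic_sub_Iic (integrable_sliceVolume he hA).integrableOn
      (integrable_sliceVolume he hA).integrableOn]
  ring

theorem continuous_lowerVolume (hu : ∀ x, (e x).1 = u x)
    (he : MeasurePreserving e μ ((volume : Measure ℝ).prod ν)) {A : Set V} (hA : IsCompact A) :
    Continuous (lowerVolume μ u A) := by
  rw [funext (lowerVolume_eq_add hu he hA 0)]
  exact continuous_const.add (intervalIntegral.continuous_primitive
    (fun a b => (integrable_sliceVolume he hA).intervalIntegrable) 0)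

theorem hasDerivAt_lowerVolume (hu0 : u ≠ 0) (hu : ∀ x, (e x).1 = u x)
    (he : MeasurePreserving e μ ((volume : Measure ℝ).prod ν)) {A : Set V} (hA : IsCompact A)
    (hAc : Convex ℝ A) {s : ℝ} (hs : s ∈ u '' interior A) :
    HasDerivAt (lowerVolume μ u A) (sliceVolume ν e A s) s := by
  rw [funext (lowerVolume_eq_add hu he hA s)]
  refine HasDerivAt.const_add _ (intervalIntegral.integral_hasDerivAt_right
    (integrable_sliceVolume he hA).intervalIntegrable
    (integrable_sliceVolume he hA).aestronglyMeasurable.stronglyMeasurableAtFilter ?_)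
  exact (continuousOn_sliceVolume u e ν hu0 hu hA hAc).continuousAt
    ((isOpen_image_interior u hu0 A).mem_nhds hs)

theorem monotone_lowerVolume {A : Set V} (hA : IsCompact A) : Monotone (lowerVolume μ u A) :=
  fun _ _ h => measureReal_mono (Set.inter_subset_inter_right _ fun _ hx => le_trans hx h)
    ((measure_mono Set.inter_subset_left).trans_lt hA.measure_lt_top).ne

theorem strictMonoOn_lowerVolume (hu0 : u ≠ 0) (hu : ∀ x, (e x).1 = u x)
    (he : MeasurePreserving e μ ((volume : Measure ℝ).prod ν)) {A : Set V} (hA : IsCompact A)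
    (hAc : Convex ℝ A) : StrictMonoOn (lowerVolume μ u A) (u '' interior A) := by
  refine strictMonoOn_of_deriv_pos (hAc.interior.linear_image (u : V →ₗ[ℝ] ℝ))
    (continuous_lowerVolume hu he hA).continuousOn fun s hs => ?_
  have hs := interior_subset hs
  rw [(hasDerivAt_lowerVolume hu0 hu he hA hAc hs).deriv]
  exact sliceVolume_pos u e ν hu hA hs

theorem lowerVolume_eq_zero (hu : ∀ x, (e x).1 = u x)
    (he : MeasurePreserving e μ ((volume : Measure ℝ).prod ν)) {A : Set V} {s : ℝ}
    (h : ∀ x ∈ A, s ≤ u x) : lowerVolume μ u A s = 0 := by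
  rw [lowerVolume, measureReal_def, measure_mono_null _ (measure_level hu he s)]
  · rfl
  · rintro x ⟨hx, hx'⟩
    exact le_antisymm hx' (h x hx)

theorem lowerVolume_eq_measure {A : Set V} {s : ℝ} (h : ∀ x ∈ A, u x ≤ s) :
    lowerVolume μ u A s = μ.real A := by
  rw [lowerVolume, Set.inter_eq_left.2 (show A ⊆ {x | u x ≤ s} from h)]

theorem lowerVolume_add (hu : ∀ x, (e x).1 = u x)
    (he : MeasurePreserving e μ ((volume : Measure ℝ).prod ν)) {A : Set V} (hA : IsCompact A)
    (s : ℝ) : lowerVolume μ u A s + μ.real (A ∩ {x | s ≤ u x}) = μ.real A := by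
  rw [lowerVolume, ← measureReal_union_add_inter
    (hA.measurableSet.inter (measurableSet_le measurable_const u.continuous.measurable))
    ((measure_mono Set.inter_subset_left).trans_lt hA.measure_lt_top).ne
    ((measure_mono Set.inter_subset_left).trans_lt hA.measure_lt_top).ne]
  have h1 : μ.real (A ∩ {x | u x ≤ s} ∩ (A ∩ {x | s ≤ u x})) = 0 := by
    rw [measureReal_def, measure_mono_null _ (measure_level hu he s)]
    · rfl
    · rintro x ⟨⟨_, h1⟩, _, h2⟩
      exact le_antisymm h1 h2
  rw [h1, add_zero, ← Set.inter_union_distrib_left]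
  congr 1
  exact Set.inter_eq_left.2 fun x _ => le_total (u x) s

theorem lowerVolume_mem_Ioo (hu0 : u ≠ 0) (hu : ∀ x, (e x).1 = u x)
    (he : MeasurePreserving e μ ((volume : Measure ℝ).prod ν)) {A : Set V} (hA : IsCompact A)
    (hAc : Convex ℝ A) {s : ℝ} (hs : s ∈ u '' interior A) :
    lowerVolume μ u A s ∈ Set.Ioo 0 (μ.real A) := by
  have hm := strictMonoOn_lowerVolume hu0 hu he hA hAc
  obtain ⟨δ, hδ, hball⟩ := Metric.isOpen_iff.1 (isOpen_image_interior u hu0 A) s hs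
  have hl : s - δ / 2 ∈ u '' interior A := hball (by
    rw [Metric.mem_ball, Real.dist_eq, sub_sub_cancel_left, abs_neg, abs_of_pos] <;> linarith)
  have hr : s + δ / 2 ∈ u '' interior A := hball (by
    rw [Metric.mem_ball, Real.dist_eq, add_sub_cancel_left, abs_of_pos] <;> linarith)
  exact ⟨lt_of_le_of_lt measureReal_nonneg (hm hl hs (by linarith)),
    lt_of_lt_of_le (hm hs hr (by linarith)) (measureReal_mono Set.inter_subset_left
      hA.measure_lt_top.ne)⟩

/-- The intermediate value theorem gives s. If s were outside the interval u(int A), all of A would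
lie on one side of the level s, and the lower volume would be 0 or the full volume. -/
theorem exists_lowerVolume_eq (hu : ∀ x, (e x).1 = u x)
    (he : MeasurePreserving e μ ((volume : Measure ℝ).prod ν)) {A : Set V} (hA : IsCompact A)
    (hAc : Convex ℝ A) (hA0 : (interior A).Nonempty) {τ : ℝ} (hτ : τ ∈ Set.Ioo 0 (μ.real A)) :
    ∃ s ∈ u '' interior A, lowerVolume μ u A s = τ := by
  obtain ⟨R, hR⟩ := (hA.image u.continuous).isBounded.subset_closedBall 0
  have hR' : ∀ x ∈ A, |u x| ≤ R := fun x hx => by simpa using hR ⟨x, hx, rfl⟩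
  have h0 : lowerVolume μ u A (-R) = 0 :=
    lowerVolume_eq_zero hu he fun x hx => (abs_le.1 (hR' x hx)).1
  have h1 : lowerVolume μ u A R = μ.real A :=
    lowerVolume_eq_measure fun x hx => (abs_le.1 (hR' x hx)).2
  obtain ⟨s, hs⟩ := mem_range_of_exists_le_of_exists_ge (continuous_lowerVolume hu he hA)
    ⟨-R, h0.le.trans hτ.1.le⟩ ⟨R, hτ.2.le.trans h1.ge⟩
  refine ⟨s, ?_, hs⟩
  have hcl : A ⊆ closure (interior A) := by
    rw [hAc.closure_interior_eq_closure_of_nonempty_interior hA0]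
    exact subset_closure
  by_contra hsI
  have hconv := (hAc.interior.linear_image (u : V →ₗ[ℝ] ℝ)).ordConnected
  by_cases hex : ∃ x ∈ interior A, u x ≤ s
  · obtain ⟨x, hx, hxs⟩ := hex
    have : ∀ y ∈ A, u y ≤ s := by
      refine fun y hy => closure_minimal (t := {y | u y ≤ s}) (fun y hy => ?_)
        (isClosed_le u.continuous continuous_const) (hcl hy)
      by_contra hys
      exact hsI (hconv.out ⟨x, hx, rfl⟩ ⟨y, hy, rfl⟩ ⟨hxs, (not_le.1 hys).le⟩)
    rw [lowerVolume_eq_measure this] at hs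
    exact hτ.2.ne hs.symm
  · push Not at hex
    have : ∀ y ∈ A, s ≤ u y := fun y hy => closure_minimal (t := {y | s ≤ u y})
      (fun y hy => (hex y hy).le) (isClosed_le continuous_const u.continuous) (hcl hy)
    rw [lowerVolume_eq_zero hu he this] at hs
    exact hτ.1.ne hs

/-- The quantile function of the functional `u` on `A`, and its derivative. -/
theorem exists_quantile (hu0 : u ≠ 0) (hu : ∀ x, (e x).1 = u x)
    (he : MeasurePreserving e μ ((volume : Measure ℝ).prod ν)) {A : Set V} (hA : IsCompact A)
    (hAc : Convex ℝ A) (hA0 : (interior A).Nonempty) :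
    ∃ z : ℝ → ℝ, (∀ τ ∈ Set.Ioo 0 (μ.real A), z τ ∈ u '' interior A ∧
      lowerVolume μ u A (z τ) = τ ∧ HasDerivAt z (sliceVolume ν e A (z τ))⁻¹ τ) ∧
      ∀ s ∈ u '' interior A, z (lowerVolume μ u A s) = s := by
  choose! z hz hFz using fun τ (hτ : τ ∈ Set.Ioo 0 (μ.real A)) =>
    exists_lowerVolume_eq hu he hA hAc hA0 hτ
  have hm := strictMonoOn_lowerVolume hu0 hu he hA hAc
  refine ⟨z, fun τ hτ => ⟨hz τ hτ, hFz τ hτ, ?_⟩, fun s hs => ?_⟩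
  · have hev : ∀ᶠ y in nhds τ, y ∈ Set.Ioo 0 (μ.real A) := isOpen_Ioo.mem_nhds hτ
    refine HasDerivAt.of_local_left_inverse ?_ (hasDerivAt_lowerVolume hu0 hu he hA hAc (hz τ hτ))
      (sliceVolume_pos u e ν hu hA (hz τ hτ)).ne' (hev.mono hFz)
    obtain ⟨δ, hδ, hball⟩ := Metric.isOpen_iff.1 (isOpen_image_interior u hu0 A) _ (hz τ hτ)
    -- The quantile is continuous because the lower volumes at z τ ± η lie strictly on either side
    -- of τ, which traps z y for y near τ.
    refine Metric.continuousAt_iff'.2 fun ε hε => ?_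
    set η := min (δ / 2) (ε / 2) with hη
    have hη0 : 0 < η := by positivity
    have hη1 : η < δ := (min_le_left _ _).trans_lt (by linarith)
    have hη2 : η < ε := (min_le_right _ _).trans_lt (by linarith)
    have hl : z τ - η ∈ u '' interior A := hball (by
      rw [Metric.mem_ball, Real.dist_eq, sub_sub_cancel_left, abs_neg, abs_of_pos] <;> linarith)
    have hr : z τ + η ∈ u '' interior A := hball (by
      rw [Metric.mem_ball, Real.dist_eq, add_sub_cancel_left, abs_of_pos] <;> linarith)
    have h1 : lowerVolume μ u A (z τ - η) < τ :=
      (hm hl (hz τ hτ) (by linarith)).trans_eq (hFz τ hτ)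
    have h2 : τ < lowerVolume μ u A (z τ + η) :=
      (hFz τ hτ).symm.trans_lt (hm (hz τ hτ) hr (by linarith))
    filter_upwards [hev, lt_mem_nhds h1, gt_mem_nhds h2] with y hy hy1 hy2
    rw [← hFz y hy] at hy1 hy2
    have := (monotone_lowerVolume (u := u) (μ := μ) hA).reflect_lt hy1
    have := (monotone_lowerVolume (u := u) (μ := μ) hA).reflect_lt hy2
    rw [Real.dist_eq, abs_lt]
    constructor <;> linarith
  · have := lowerVolume_mem_Ioo hu0 hu he hA hAc hs
    exact hm.injOn (hz _ this) hs (hFz _ this)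


/-- The Brunn–Minkowski inequality for the parts of `A` and `B` cut off by level sets of `u`: the
quantile function of `u` on the mean of `A` and `B` is the mean of the quantile functions. -/
theorem lowerVolume_mean (hu : ∀ x, (e x).1 = u x)
    (he : MeasurePreserving e μ ((volume : Measure ℝ).prod ν)) {A B M : Set V} (hA : IsCompact A)
    (hB : IsCompact B) (hM : IsCompact M) (hAB : μ.real A = μ.real B)
    (hMA : μ.real M ≤ μ.real A) (h : (1 - (1 / 2 : ℝ)) • A + (1 / 2 : ℝ) • B ⊆ M) {s r τ : ℝ}
    (hτ : τ ∈ Set.Ioo 0 (μ.real A)) (hs : lowerVolume μ u A s = τ)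
    (hr : lowerVolume μ u B r = τ) :
    lowerVolume μ u M ((1 - 1 / 2) * s + 1 / 2 * r) = τ := by
  have hne : ∀ {S : Set V}, μ.real S ≠ 0 → S.Nonempty := fun {S} hS => by
    by_contra hSe
    rw [Set.not_nonempty_iff_eq_empty] at hSe
    simp [hSe] at hS
  have hsq : ∀ {x : ℝ}, 0 < x → x ^ (1 - 1 / 2 : ℝ) * x ^ (1 / 2 : ℝ) = x := fun {x} hx => by
    rw [← Real.rpow_add hx]; norm_num
  have hlow : ∀ {S : Set V} {a : ℝ}, IsCompact S → IsCompact (S ∩ {x | u x ≤ a}) := fun hS =>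
    hS.inter_right (isClosed_le u.continuous continuous_const)
  have hupp : ∀ {S : Set V} {a : ℝ}, IsCompact S → IsCompact (S ∩ {x | a ≤ u x}) := fun hS =>
    hS.inter_right (isClosed_le continuous_const u.continuous)
  have uA := lowerVolume_add hu he hA s
  have uB := lowerVolume_add hu he hB r
  have uM := lowerVolume_add hu he hM ((1 - 1 / 2) * s + 1 / 2 * r)
  have hA' : μ.real (A ∩ {x | s ≤ u x}) = μ.real A - τ := by linarith
  have hB' : μ.real (B ∩ {x | r ≤ u x}) = μ.real A - τ := by linarith
  -- Brunn–Minkowski for the lower parts gives at least τ, and for the upper parts at least vol A -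
  -- τ. Since M has volume at most vol A, both are equalities.
  have h1 : τ ≤ lowerVolume μ u M ((1 - 1 / 2) * s + 1 / 2 * r) := by
    have := measure_rpow_mul_le μ (t := 1 / 2) (by norm_num) (by norm_num) (hlow (a := s) hA)
      (hlow (a := r) hB) (hlow (a := (1 - 1 / 2) * s + 1 / 2 * r) hM)
      (hne (by rw [← lowerVolume, hs]; exact hτ.1.ne'))
      (hne (by rw [← lowerVolume, hr]; exact hτ.1.ne')) (by
        rintro _ ⟨_, ⟨x, hx, rfl⟩, _, ⟨y, hy, rfl⟩, rfl⟩
        refine ⟨h (Set.add_mem_add (Set.smul_mem_smul_set hx.1) (Set.smul_mem_smul_set hy.1)), ?_⟩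
        have h1 : u x ≤ s := hx.2
        have h2 : u y ≤ r := hy.2
        simp only [Set.mem_ofPred_eq, map_add, map_smul, smul_eq_mul]
        linarith)
    rw [← lowerVolume, ← lowerVolume, ← lowerVolume, hs, hr, hsq hτ.1] at this
    exact this
  have h2 : μ.real A - τ ≤ μ.real (M ∩ {x | (1 - 1 / 2) * s + 1 / 2 * r ≤ u x}) := by
    have hpos : 0 < μ.real A - τ := by linarith [hτ.2]
    have := measure_rpow_mul_le μ (t := 1 / 2) (by norm_num) (by norm_num) (hupp (a := s) hA)
      (hupp (a := r) hB) (hupp (a := (1 - 1 / 2) * s + 1 / 2 * r) hM)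
      (hne (by rw [hA']; exact hpos.ne')) (hne (by rw [hB']; exact hpos.ne')) (by
        rintro _ ⟨_, ⟨x, hx, rfl⟩, _, ⟨y, hy, rfl⟩, rfl⟩
        refine ⟨h (Set.add_mem_add (Set.smul_mem_smul_set hx.1) (Set.smul_mem_smul_set hy.1)), ?_⟩
        have h1 : s ≤ u x := hx.2
        have h2 : r ≤ u y := hy.2
        simp only [Set.mem_ofPred_eq, map_add, map_smul, smul_eq_mul]
        linarith)
    rw [hA', hB', hsq hpos] at this
    exact this
  linarith

/-- With a = x² and b = y² the left side is (x² + y²) / (2xy), so this is the equality case of the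
arithmetic–geometric mean inequality. -/
theorem eq_of_mean_mul_sqrt_le {a b : ℝ} (ha : 0 < a) (hb : 0 < b)
    (h : a ^ (1 - 1 / 2 : ℝ) * b ^ (1 / 2 : ℝ) * ((1 - 1 / 2) * a⁻¹ + 1 / 2 * b⁻¹) ≤ 1) :
    a = b := by
  have h1 : (1 - 1 / 2 : ℝ) = 1 / 2 := by norm_num
  rw [h1, ← Real.sqrt_eq_rpow, ← Real.sqrt_eq_rpow] at h
  obtain ⟨x, hx, rfl⟩ : ∃ x, 0 < x ∧ a = x ^ 2 := ⟨√a, Real.sqrt_pos.2 ha, (Real.sq_sqrt ha.le).symm⟩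
  obtain ⟨y, hy, rfl⟩ : ∃ y, 0 < y ∧ b = y ^ 2 := ⟨√b, Real.sqrt_pos.2 hb, (Real.sq_sqrt hb.le).symm⟩
  rw [Real.sqrt_sq hx.le, Real.sqrt_sq hy.le] at h
  have h2 : x * y * (1 / 2 * (x ^ 2)⁻¹ + 1 / 2 * (y ^ 2)⁻¹) = (x ^ 2 + y ^ 2) / (2 * (x * y)) := by
    field_simp
    ring
  rw [h2, div_le_one (by positivity)] at h
  have : x - y = 0 := by nlinarith [sq_nonneg (x - y)]
  rw [sub_eq_zero.1 this]

/-- If equality holds in the Brunn–Minkowski inequality for two bodies of the same volume, then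
each functional has the same distribution on both, up to a translation. -/
theorem exists_lowerVolume_translate (hu0 : u ≠ 0) (hu : ∀ x, (e x).1 = u x)
    (he : MeasurePreserving e μ ((volume : Measure ℝ).prod ν)) {A B M : Set V} (hA : IsCompact A)
    (hAc : Convex ℝ A) (hA0 : (interior A).Nonempty) (hB : IsCompact B)
    (hBc : Convex ℝ B) (hB0 : (interior B).Nonempty) (hM : IsCompact M) (hMc : Convex ℝ M)
    (hAB : μ.real A = μ.real B)
    (hMA : μ.real M ≤ μ.real A) (h : (1 - (1 / 2 : ℝ)) • A + (1 / 2 : ℝ) • B ⊆ M) :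
    ∃ κ : ℝ, (∀ s, s ∈ u '' interior A ↔ s - κ ∈ u '' interior B) ∧
      ∀ s ∈ u '' interior A, lowerVolume μ u A s = lowerVolume μ u B (s - κ) := by
  obtain ⟨z, hz, hzF⟩ := exists_quantile hu0 hu he hA hAc hA0
  obtain ⟨w, hw, hwF⟩ := exists_quantile hu0 hu he hB hBc hB0
  rw [← hAB] at hw
  -- The lower volume of M at (z + w) / 2 is τ. Differentiating gives (slice of M) · ½(1/a + 1/b) =
  -- 1, with a and b the slices of A and B. The slice of M is at least √(ab), which forces a = b,
  -- that is, z' = w'.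
  have hder : ∀ τ ∈ Set.Ioo 0 (μ.real A), HasDerivAt (fun τ => z τ - w τ) 0 τ := by
    intro τ hτ
    obtain ⟨hz1, hz2, hz3⟩ := hz τ hτ
    obtain ⟨hw1, hw2, hw3⟩ := hw τ hτ
    set c := (1 - 1 / 2) * z τ + 1 / 2 * w τ with hc
    have hcM : c ∈ u '' interior M := by
      obtain ⟨x, hx, hxz⟩ := hz1
      obtain ⟨y, hy, hyw⟩ := hw1
      refine ⟨(1 - (1 / 2 : ℝ)) • x + (1 / 2 : ℝ) • y, ?_, by simp [hc, ← hxz, ← hyw]⟩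
      refine interior_mono h (subset_interior_add_left
        (Set.add_mem_add (?_ : _ ∈ interior _) (Set.smul_mem_smul_set (interior_subset hy))))
      rw [interior_smul₀ (by norm_num)]
      exact Set.smul_mem_smul_set hx
    have hev : (fun τ => lowerVolume μ u M ((1 - 1 / 2) * z τ + 1 / 2 * w τ)) =ᶠ[nhds τ] id := by
      filter_upwards [isOpen_Ioo.mem_nhds hτ] with y hy
      exact lowerVolume_mean hu he hA hB hM hAB hMA h hy (hz y hy).2.1 (hw y hy).2.1
    have hd1 := ((hasDerivAt_lowerVolume hu0 hu he hM hMc hcM).comp τ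
      ((hz3.const_mul (1 - 1 / 2)).add (hw3.const_mul (1 / 2)))).congr_of_eventuallyEq hev.symm
    have hone := hd1.unique (hasDerivAt_id τ)
    have pz := sliceVolume_pos u e ν hu hA hz1
    have pw := sliceVolume_pos u e ν hu hB hw1
    have hsec := sliceVolume_rpow_mul_le u e ν hu hA hB hM (t := 1 / 2) (by norm_num) (by norm_num)
      h (Set.image_mono interior_subset hz1) (Set.image_mono interior_subset hw1)
    have heq := eq_of_mean_mul_sqrt_le pz pw (by
      refine le_trans ?_ hone.le
      refine mul_le_mul_of_nonneg_right hsec ?_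
      have := inv_pos.2 pz
      have := inv_pos.2 pw
      positivity)
    have := hz3.sub hw3
    rw [heq, sub_self] at this
    exact this
  have hAm : 0 < μ.real A := ENNReal.toReal_pos
    ((isOpen_interior.measure_pos μ hA0).trans_le (measure_mono interior_subset)).ne'
    hA.measure_lt_top.ne
  obtain ⟨κ, hκ⟩ : ∃ κ, ∀ τ ∈ Set.Ioo 0 (μ.real A), z τ - w τ = κ := by
    refine ⟨z (μ.real A / 2) - w (μ.real A / 2), fun τ hτ => ?_⟩
    exact isOpen_Ioo.is_const_of_deriv_eq_zero isPreconnected_Ioo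
      (fun x hx => (hder x hx).differentiableAt.differentiableWithinAt)
      (fun x hx => (hder x hx).deriv) hτ ⟨by linarith, by linarith⟩
  have key : ∀ s ∈ u '' interior A, s - κ ∈ u '' interior B ∧
      lowerVolume μ u A s = lowerVolume μ u B (s - κ) := by
    intro s hs
    have hτ := lowerVolume_mem_Ioo hu0 hu he hA hAc hs
    have h1 := hκ _ hτ
    rw [hzF s hs] at h1
    have h2 : w (lowerVolume μ u A s) = s - κ := by linarith
    rw [← h2]
    exact ⟨(hw _ hτ).1, (hw _ hτ).2.1.symm⟩
  refine ⟨κ, fun s => ⟨fun hs => (key s hs).1, fun hs => ?_⟩, fun s hs => (key s hs).2⟩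
  have hτ := lowerVolume_mem_Ioo hu0 hu he hB hBc hs
  rw [← hAB] at hτ
  have h1 := hκ _ hτ
  rw [hwF _ hs] at h1
  have h2 : z (lowerVolume μ u B (s - κ)) = s := by linarith
  rw [← h2]
  exact (hz _ hτ).1

/-- For s outside the open interval u(int A), both lower volumes are 0 or both are the full volume,
so the identity extends to the whole line. -/
theorem lowerVolume_translate {A B : Set V} (hu : ∀ x, (e x).1 = u x)
    (he : MeasurePreserving e μ ((volume : Measure ℝ).prod ν)) (hAc : Convex ℝ A)
    (hA0 : (interior A).Nonempty) (hBc : Convex ℝ B) (hB0 : (interior B).Nonempty)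
    (hAB : μ.real A = μ.real B) {κ : ℝ}
    (h1 : ∀ s, s ∈ u '' interior A ↔ s - κ ∈ u '' interior B)
    (h2 : ∀ s ∈ u '' interior A, lowerVolume μ u A s = lowerVolume μ u B (s - κ)) (s : ℝ) :
    lowerVolume μ u A s = lowerVolume μ u B (s - κ) := by
  by_cases hs : s ∈ u '' interior A
  · exact h2 s hs
  have hcl : ∀ {S : Set V}, Convex ℝ S → (interior S).Nonempty → S ⊆ closure (interior S) :=
    fun hc h0 => by
      rw [hc.closure_interior_eq_closure_of_nonempty_interior h0]
      exact subset_closure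
  have hconv := (hAc.interior.linear_image (u : V →ₗ[ℝ] ℝ)).ordConnected
  by_cases hex : ∃ x ∈ interior A, u x ≤ s
  · obtain ⟨x, hx, hxs⟩ := hex
    have hall : ∀ y ∈ interior A, u y ≤ s := fun y hy => by
      by_contra hys
      exact hs (hconv.out ⟨x, hx, rfl⟩ ⟨y, hy, rfl⟩ ⟨hxs, (not_le.1 hys).le⟩)
    rw [lowerVolume_eq_measure (s := s), lowerVolume_eq_measure (s := s - κ), hAB]
    · refine fun y hy => closure_minimal (t := {y | u y ≤ s - κ}) (fun y hy => ?_)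
        (isClosed_le u.continuous continuous_const) (hcl hBc hB0 hy)
      obtain ⟨x, hx, hxy⟩ := (h1 (u y + κ)).2 (by rw [add_sub_cancel_right]; exact ⟨y, hy, rfl⟩)
      have := hall x hx
      rw [Set.mem_ofPred_eq]
      change u x = u y + κ at hxy
      linarith
    · exact fun y hy => closure_minimal (t := {y | u y ≤ s}) hall
        (isClosed_le u.continuous continuous_const) (hcl hAc hA0 hy)
  · push Not at hex
    rw [lowerVolume_eq_zero (s := s) hu he, lowerVolume_eq_zero (s := s - κ) hu he]
    · refine fun y hy => closure_minimal (t := {y | s - κ ≤ u y}) (fun y hy => ?_)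
        (isClosed_le continuous_const u.continuous) (hcl hBc hB0 hy)
      obtain ⟨x, hx, hxy⟩ := (h1 (u y + κ)).2 (by rw [add_sub_cancel_right]; exact ⟨y, hy, rfl⟩)
      have := hex x hx
      rw [Set.mem_ofPred_eq]
      change u x = u y + κ at hxy
      linarith
    · exact fun y hy => closure_minimal (t := {y | s ≤ u y}) (fun y hy => (hex y hy).le)
        (isClosed_le continuous_const u.continuous) (hcl hAc hA0 hy)

/-- Two bodies on which the functional `u` has the same distribution up to a translation by `κ`
have first moments that differ accordingly. -/
theorem setIntegral_eq_add {A B : Set V} (hA : IsCompact A) (hB : IsCompact B) {κ : ℝ}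
    (h : ∀ s, lowerVolume μ u A s = lowerVolume μ u B (s - κ)) :
    ∫ x in A, u x ∂μ = ∫ x in B, u x ∂μ + μ.real B * κ := by
  have : IsFiniteMeasure (μ.restrict A) := ⟨by simpa using hA.measure_lt_top⟩
  have : IsFiniteMeasure (μ.restrict B) := ⟨by simpa using hB.measure_lt_top⟩
  have hu := u.continuous.measurable
  -- The hypothesis equates the distribution functions of u on A and of u + κ on B, hence the two
  -- image measures.
  have hmap : (μ.restrict A).map u = (μ.restrict B).map (fun x => u x + κ) := by
    refine Measure.ext_of_Iic _ _ fun s => ?_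
    rw [Measure.map_apply hu measurableSet_Iic,
      Measure.map_apply (hu.add_const κ) measurableSet_Iic,
      Measure.restrict_apply (hu measurableSet_Iic),
      Measure.restrict_apply ((hu.add_const κ) measurableSet_Iic)]
    have := h s
    rw [lowerVolume, lowerVolume, measureReal_def, measureReal_def,
      ENNReal.toReal_eq_toReal_iff' ((measure_mono Set.inter_subset_left).trans_lt
        hA.measure_lt_top).ne ((measure_mono Set.inter_subset_left).trans_lt
        hB.measure_lt_top).ne] at this
    have hset : (fun x => u x + κ) ⁻¹' Set.Iic s = {x | u x ≤ s - κ} := by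
      ext x
      simp [le_sub_iff_add_le]
    rw [Set.inter_comm, Set.inter_comm _ B, hset]
    exact this
  have h1 := integral_map (μ := μ.restrict A) hu.aemeasurable
    (aestronglyMeasurable_id (μ := (μ.restrict A).map u))
  have h2 := integral_map (μ := μ.restrict B) (hu.add_const κ).aemeasurable
    (aestronglyMeasurable_id (μ := (μ.restrict B).map fun x => u x + κ))
  simp only [id] at h1 h2
  rw [← h1, hmap, h2, integral_add (u.continuous.continuousOn.integrableOn_compact hB)
    (integrable_const _)]
  simp

end Sections

/-! ### The equality case of Brunn–Minkowski for bodies of equal volume. -/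

section Equality

variable {V : Type*} [NormedAddCommGroup V] [NormedSpace ℝ V] [FiniteDimensional ℝ V]
  [MeasurableSpace V] [BorelSpace V]

/-- A point of A outside x + B would be strictly separated from it by some functional f, whereas f
maps int A into the translate by f x of f(int B). -/
theorem subset_vadd_of_forall_functional {A B : Set V} (hAc : Convex ℝ A)
    (hA0 : (interior A).Nonempty) (hBc : Convex ℝ B) (hB : IsCompact B) (hB0 : B.Nonempty) (x : V)
    (h : ∀ u : StrongDual ℝ V, u ≠ 0 → ∀ s ∈ u '' interior A, s - u x ∈ u '' interior B) :
    A ⊆ x +ᵥ B := by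
  intro y hy
  by_contra hyB
  obtain ⟨f, s, h1, h2⟩ := geometric_hahn_banach_closed_point (hBc.vadd x) (hB.vadd x).isClosed hyB
  have hf : f ≠ 0 := by
    rintro rfl
    obtain ⟨b, hb⟩ := hB0
    have := h1 _ (Set.vadd_mem_vadd_set hb)
    simp at this h2
    linarith
  have hcl : A ⊆ closure (interior A) := by
    rw [hAc.closure_interior_eq_closure_of_nonempty_interior hA0]
    exact subset_closure
  have : f y ≤ s := closure_minimal (t := {y | f y ≤ s}) (fun z hz => by
    obtain ⟨b, hb, hbz⟩ := h f hf _ ⟨z, hz, rfl⟩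
    have := h1 _ (Set.vadd_mem_vadd_set (a := x) (interior_subset hb))
    rw [vadd_eq_add, map_add] at this
    rw [Set.mem_ofPred_eq]
    linarith) (isClosed_le f.continuous continuous_const) (hcl hy)
  linarith

/-- The equality case of the Brunn–Minkowski inequality: two convex bodies of the same volume whose
mean has at most the same volume are translates of each other. -/
theorem exists_eq_vadd_of_measure_mean_le (μ : Measure V) [μ.IsAddHaarMeasure] {A B : Set V}
    (hA : IsCompact A) (hAc : Convex ℝ A) (hA0 : (interior A).Nonempty) (hB : IsCompact B)
    (hBc : Convex ℝ B) (hB0 : (interior B).Nonempty) (hAB : μ.real A = μ.real B)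
    (h : μ.real ((1 - (1 / 2 : ℝ)) • A + (1 / 2 : ℝ) • B) ≤ μ.real A) : ∃ x : V, A = x +ᵥ B := by
  -- The difference of the centroids. Comparing first moments identifies the shift κ attached to
  -- each functional u as u x, so that the shifts all come from one vector.
  set x := (μ.real A)⁻¹ • (∫ y in A, y ∂μ - ∫ y in B, y ∂μ) with hx
  have hAm : 0 < μ.real A := ENNReal.toReal_pos
    ((isOpen_interior.measure_pos μ hA0).trans_le (measure_mono interior_subset)).ne'
    hA.measure_lt_top.ne
  have key : ∀ u : StrongDual ℝ V, u ≠ 0 → ∀ s, s ∈ u '' interior A ↔ s - u x ∈ u '' interior B := by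
    intro u hu0
    obtain ⟨v, hv⟩ : ∃ v, u v ≠ 0 := by
      by_contra! hv
      exact hu0 (ContinuousLinearMap.ext hv)
    obtain ⟨e, hu, -⟩ := exists_split u ((u v)⁻¹ • v) (by simp [hv])
    obtain ⟨ν, hν, he⟩ := exists_measurePreserving_prod μ e
    obtain ⟨κ, h1, h2⟩ := exists_lowerVolume_translate hu0 hu he hA hAc hA0 hB hBc hB0
      ((hA.smul _).add (hB.smul _)) ((hAc.smul _).add (hBc.smul _)) hAB h subset_rfl
    have h3 := setIntegral_eq_add hA hB
      (lowerVolume_translate hu he hAc hA0 hBc hB0 hAB h1 h2)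
    rw [u.integral_comp_comm (φ := fun y => y) (continuousOn_id.integrableOn_compact hA),
      u.integral_comp_comm (φ := fun y => y) (continuousOn_id.integrableOn_compact hB), ← hAB] at h3
    have h4 : u x = κ := by
      simp only [hx, map_smul, map_sub, smul_eq_mul] at h3 ⊢
      rw [h3]
      field_simp
      ring
    rwa [h4]
  refine ⟨x, (subset_vadd_of_forall_functional hAc hA0 hBc hB (hB0.mono interior_subset) x
    fun u hu s => (key u hu s).1).antisymm ?_⟩
  rw [Set.vadd_set_subset_iff_subset_neg_vadd_set]
  refine subset_vadd_of_forall_functional hBc hB0 hAc hA (hA0.mono interior_subset) (-x)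
    fun u hu s hs => (key u hu _).2 ?_
  rwa [map_neg, sub_neg_eq_add, add_sub_cancel_right]

end Equality

/-! ### Support functions and continuity of the volume. -/

section SupportFunction

variable {V : Type*} [NormedAddCommGroup V] [NormedSpace ℝ V]

/-- The support function of a convex body. -/
def supportFn (K : ConvexBody V) (u : StrongDual ℝ V) : ℝ := sSup (u '' (K : Set V))

theorem le_supportFn (K : ConvexBody V) (u : StrongDual ℝ V) {x : V} (hx : x ∈ K) :
    u x ≤ supportFn K u :=
  le_csSup (K.isCompact.image u.continuous).bddAbove ⟨x, hx, rfl⟩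

theorem exists_eq_supportFn (K : ConvexBody V) (u : StrongDual ℝ V) :
    ∃ x ∈ K, u x = supportFn K u :=
  (K.isCompact.image u.continuous).sSup_mem (K.nonempty.image u)

theorem supportFn_le {K : ConvexBody V} {u : StrongDual ℝ V} {c : ℝ} (h : ∀ x ∈ K, u x ≤ c) :
    supportFn K u ≤ c := by
  obtain ⟨x, hx, hxu⟩ := exists_eq_supportFn K u
  exact hxu ▸ h x hx

theorem supportFn_add (K L : ConvexBody V) (u : StrongDual ℝ V) :
    supportFn (K + L) u = supportFn K u + supportFn L u := by
  apply le_antisymm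
  · refine supportFn_le fun z hz => ?_
    obtain ⟨x, hx, y, hy, rfl⟩ := hz
    rw [map_add]
    exact add_le_add (le_supportFn K u hx) (le_supportFn L u hy)
  · obtain ⟨x, hx, hxu⟩ := exists_eq_supportFn K u
    obtain ⟨y, hy, hyu⟩ := exists_eq_supportFn L u
    rw [← hxu, ← hyu, ← map_add]
    exact le_supportFn _ _ (Set.add_mem_add hx hy)

theorem supportFn_smul {c : ℝ} (hc : 0 ≤ c) (K : ConvexBody V) (u : StrongDual ℝ V) :
    supportFn (c • K) u = c * supportFn K u := by
  apply le_antisymm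
  · refine supportFn_le fun z hz => ?_
    obtain ⟨x, hx, rfl⟩ := hz
    simp only [map_smul, smul_eq_mul]
    exact mul_le_mul_of_nonneg_left (le_supportFn K u hx) hc
  · obtain ⟨x, hx, hxu⟩ := exists_eq_supportFn K u
    rw [← hxu, ← smul_eq_mul, ← map_smul]
    exact le_supportFn _ _ (Set.smul_mem_smul_set hx)

theorem mem_of_forall_le_supportFn {K : ConvexBody V} {x : V}
    (h : ∀ u, u x ≤ supportFn K u) : x ∈ K := by
  by_contra hx
  obtain ⟨f, s, h1, h2⟩ := geometric_hahn_banach_closed_point K.convex K.isClosed hx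
  have : supportFn K f ≤ s := supportFn_le fun y hy => (h1 y hy).le
  linarith [h f]

theorem eq_of_supportFn_eq {K L : ConvexBody V} (h : ∀ u, supportFn K u = supportFn L u) :
    K = L := by
  refine ConvexBody.ext (Set.Subset.antisymm (fun x hx => ?_) fun x hx => ?_)
  · exact mem_of_forall_le_supportFn fun u => (le_supportFn K u hx).trans (h u).le
  · exact mem_of_forall_le_supportFn fun u => (le_supportFn L u hx).trans (h u).ge

variable [FiniteDimensional ℝ V]

/-- The closed ball, as a convex body. -/
def closedBallBody (x : V) {r : ℝ} (hr : 0 ≤ r) : ConvexBody V where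
  carrier := Metric.closedBall x r
  convex' := convex_closedBall x r
  isCompact' := ProperSpace.isCompact_closedBall x r
  nonempty' := Metric.nonempty_closedBall.2 hr

theorem le_supportFn_closedBallBody (x : V) {r : ℝ} (hr : 0 ≤ r) (u : StrongDual ℝ V) :
    u x + r * ‖u‖ ≤ supportFn (closedBallBody x hr) u := by
  rcases hr.eq_or_lt with rfl | hr0
  · simpa using le_supportFn (closedBallBody x hr) u (x := x) (by simp [closedBallBody, ← SetLike.mem_coe])
  have h1 : ∀ y : V, ‖y‖ ≤ r → u y ≤ supportFn (closedBallBody x hr) u - u x := by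
    intro y hy
    have := le_supportFn (closedBallBody x hr) u (x := x + y)
      (show x + y ∈ Metric.closedBall x r by simpa using hy)
    rw [map_add] at this
    linarith
  have h0 : 0 ≤ supportFn (closedBallBody x hr) u - u x := by simpa using h1 0 (by simpa using hr)
  have h2 : ‖u‖ ≤ (supportFn (closedBallBody x hr) u - u x) / r := by
    refine u.opNorm_le_bound (by positivity) fun y => ?_
    rcases eq_or_ne y 0 with rfl | hy
    · simp
    have hy' : 0 < ‖y‖ := norm_pos_iff.2 hy
    have hn : ‖(r / ‖y‖) • y‖ = r := by
      rw [norm_smul, norm_div, norm_norm, Real.norm_of_nonneg hr]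
      field_simp
    have e1 := h1 ((r / ‖y‖) • y) hn.le
    have e2 := h1 (-((r / ‖y‖) • y)) (by rw [norm_neg]; exact hn.le)
    rw [map_neg] at e2
    rw [map_smul, smul_eq_mul] at e1 e2
    have : r / ‖y‖ * |u y| ≤ supportFn (closedBallBody x hr) u - u x := by
      rcases abs_cases (u y) with ⟨h, -⟩ | ⟨h, -⟩ <;> rw [h] <;> linarith
    rw [Real.norm_eq_abs, div_mul_eq_mul_div, le_div_iff₀ hr0]
    rw [div_mul_eq_mul_div, div_le_iff₀ hy'] at this
    linarith
  rw [le_div_iff₀ hr0] at h2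
  linarith

/-- Convergence of convex bodies, expressed by uniform convergence of support functions on the
unit ball. -/
def SupportTendsto {ι : Type*} (l : Filter ι) (K : ι → ConvexBody V) (L : ConvexBody V) : Prop :=
  ∀ ε > 0, ∀ᶠ i in l, ∀ u, |supportFn (K i) u - supportFn L u| ≤ ε * ‖u‖

variable {ι : Type*} {l : Filter ι} {K : ι → ConvexBody V} {L : ConvexBody V}

theorem SupportTendsto.const_add (h : SupportTendsto l K L) (M : ConvexBody V) :
    SupportTendsto l (fun i => M + K i) (M + L) := by
  intro ε hε
  filter_upwards [h ε hε] with i hi u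
  rw [supportFn_add, supportFn_add, add_sub_add_left_eq_sub]
  exact hi u

theorem SupportTendsto.add_const (h : SupportTendsto l K L) (M : ConvexBody V) :
    SupportTendsto l (fun i => K i + M) (L + M) := by
  simpa only [add_comm] using h.const_add M

variable [MeasurableSpace V] [BorelSpace V] (μ : Measure V) [μ.IsAddHaarMeasure]

theorem measure_convexBody_lt_top (K : ConvexBody V) : μ (K : Set V) < ∞ := K.isCompact.measure_lt_top

theorem measureReal_pos_of_interior {K : ConvexBody V} (h : (interior (K : Set V)).Nonempty) :
    0 < μ.real (K : Set V) :=
  ENNReal.toReal_pos ((isOpen_interior.measure_pos μ h).trans_le (measure_mono interior_subset)).ne'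
    (measure_convexBody_lt_top μ K).ne

theorem interior_nonempty_of_measureReal_ne_zero {K : ConvexBody V}
    (h : μ.real (K : Set V) ≠ 0) : (interior (K : Set V)).Nonempty := by
  by_contra hK
  have h2 : affineSpan ℝ (K : Set V) ≠ ⊤ := fun h => hK (K.convex.interior_nonempty_iff_affineSpan_eq_top.2 h)
  apply h
  rw [measureReal_def, measure_mono_null (subset_affineSpan ℝ (K : Set V))
    (Measure.addHaar_affineSubspace μ _ h2)]
  rfl

/-- The volume is continuous on convex bodies. -/
theorem SupportTendsto.tendsto_measureReal (h : SupportTendsto l K L) :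
    Filter.Tendsto (fun i => μ.real (K i : Set V)) l (nhds (μ.real (L : Set V))) := by
  -- Upper semicontinuity: K i is eventually inside a small thickening of L, whose volume is close
  -- to that of L.
  have hup : ∀ a, μ.real (L : Set V) < a → ∀ᶠ i in l, μ.real (K i : Set V) < a := by
    intro a ha
    have h1 := tendsto_measure_cthickening_of_isCompact (μ := μ) L.isCompact
    have h2 : ∀ᶠ r in nhds (0 : ℝ), μ (Metric.cthickening r (L : Set V)) < ENNReal.ofReal a :=
      h1 (gt_mem_nhds (by
        rwa [ENNReal.lt_ofReal_iff_toReal_lt (measure_convexBody_lt_top μ L).ne]))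
    obtain ⟨ε, hε, hball⟩ := Metric.eventually_nhds_iff.1 h2
    have hlt := hball (y := ε / 2) (by
      rw [Real.dist_eq, sub_zero, abs_of_pos] <;> linarith)
    filter_upwards [h (ε / 2) (by positivity)] with i hi
    rw [measureReal_def, ← ENNReal.lt_ofReal_iff_toReal_lt (measure_convexBody_lt_top μ _).ne]
    refine (measure_mono fun x hx => ?_).trans_lt hlt
    have hε2 : 0 ≤ ε / 2 := by positivity
    suffices hx' : x ∈ L + closedBallBody 0 hε2 by
      obtain ⟨y, hy, z, hz, rfl⟩ := hx'
      refine Metric.mem_cthickening_of_dist_le _ y _ _ hy ?_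
      have hz : z ∈ Metric.closedBall 0 (ε / 2) := hz
      simpa using hz
    refine mem_of_forall_le_supportFn fun u => ?_
    rw [supportFn_add]
    have e1 := le_supportFn (K i) u hx
    have e2 := le_supportFn_closedBallBody 0 hε2 u
    have e3 := (abs_le.1 (hi u)).2
    rw [map_zero] at e2
    linarith
  have hlo : ∀ a, a < μ.real (L : Set V) → ∀ᶠ i in l, a < μ.real (K i : Set V) := by
    intro a ha
    by_cases hL : μ.real (L : Set V) = 0
    · exact Filter.Eventually.of_forall fun i => (ha.trans_eq hL).trans_le measureReal_nonneg
    obtain ⟨x₀, hx₀⟩ := interior_nonempty_of_measureReal_ne_zero μ hL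
    obtain ⟨r, hr, hball⟩ := Metric.nhds_basis_closedBall.mem_iff.1 (mem_interior_iff_mem_nhds.1 hx₀)
    have hc : Filter.Tendsto (fun s : ℝ => (1 - s) ^ finrank ℝ V * μ.real (L : Set V))
        (nhds 0) (nhds ((1 - 0) ^ finrank ℝ V * μ.real (L : Set V))) :=
      (Continuous.tendsto (by fun_prop) 0)
    have h2 := hc (lt_mem_nhds (by simpa using ha))
    obtain ⟨δ, hδ, hδ'⟩ := Metric.eventually_nhds_iff.1 h2
    set s := min (δ / 2) (1 / 2) with hs
    have hs0 : 0 < s := by positivity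
    have hs1 : s < 1 := (min_le_right _ _).trans_lt (by norm_num)
    have hlt := hδ' (y := s) (by
      rw [Real.dist_eq, sub_zero, abs_of_pos hs0]
      exact (min_le_left _ _).trans_lt (by linarith))
    filter_upwards [h (s * r) (by positivity)] with i hi
    refine lt_of_lt_of_le hlt ?_
    -- L contains the ball of radius r about x₀, so shrinking L towards x₀ by the factor 1 - s
    -- lowers its support function by at least s r ‖u‖, which is the permitted error.
    have hsub : AffineMap.homothety x₀ (1 - s) '' (L : Set V) ⊆ K i := by
      rintro _ ⟨x, hx, rfl⟩
      refine mem_of_forall_le_supportFn fun u => ?_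
      have e1 := (abs_le.1 (hi u)).1
      have e2 := le_supportFn L u hx
      have e3 : u x₀ + r * ‖u‖ ≤ supportFn L u :=
        (le_supportFn_closedBallBody x₀ hr.le u).trans
          (supportFn_le fun y hy => le_supportFn L u (hball hy))
      rw [AffineMap.homothety_apply, vsub_eq_sub, vadd_eq_add, map_add, map_smul, map_sub,
        smul_eq_mul]
      nlinarith
    have h3 : μ.real (AffineMap.homothety x₀ (1 - s) '' (L : Set V)) =
        (1 - s) ^ finrank ℝ V * μ.real (L : Set V) := by
      rw [measureReal_def, Measure.addHaar_image_homothety, ENNReal.toReal_mul,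
        ENNReal.toReal_ofReal (abs_nonneg _), abs_of_nonneg (pow_nonneg (by linarith) _),
        measureReal_def]
    refine h3.symm.le.trans ?_
    exact measureReal_mono hsub (measure_convexBody_lt_top μ _).ne
  exact tendsto_order.2 ⟨hlo, hup⟩

end SupportFunction

/-! ### Projection volumes as swept volumes, and the volume of a body plus a zonotope. -/

section Shadow

variable {V : Type*} [NormedAddCommGroup V] [NormedSpace ℝ V]

/-- The segment from `0` to `v`, as a convex body. -/
def segmentBody (v : V) : ConvexBody V where
  carrier := segment ℝ 0 v
  convex' := convex_segment 0 v
  isCompact' := by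
    rw [segment_eq_image']
    exact isCompact_Icc.image (by fun_prop)
  nonempty' := ⟨0, left_mem_segment ℝ 0 v⟩

theorem mem_segmentBody {v x : V} : x ∈ segmentBody v ↔ ∃ r ∈ Set.Icc (0 : ℝ) 1, r • v = x := by
  change x ∈ segment ℝ 0 v ↔ _
  rw [segment_eq_image']
  simp

theorem supportFn_segmentBody (v : V) (u : StrongDual ℝ V) :
    supportFn (segmentBody v) u = max (u v) 0 := by
  apply le_antisymm
  · refine supportFn_le fun x hx => ?_
    obtain ⟨r, hr, rfl⟩ := mem_segmentBody.1 hx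
    rw [map_smul, smul_eq_mul]
    rcases le_total 0 (u v) with h | h
    · exact (mul_le_of_le_one_left h hr.2).trans (le_max_left _ _)
    · exact (mul_nonpos_of_nonneg_of_nonpos hr.1 h).trans (le_max_right _ _)
  · refine max_le (le_supportFn _ u (right_mem_segment ℝ 0 v)) ?_
    simpa using le_supportFn (segmentBody v) u (left_mem_segment ℝ 0 v)

/-- The image of a convex body under a continuous linear map. -/
def mapBody {W : Type*} [NormedAddCommGroup W] [NormedSpace ℝ W] (f : V →L[ℝ] W)
    (K : ConvexBody V) : ConvexBody W where
  carrier := f '' K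
  convex' := K.convex.linear_image (f : V →ₗ[ℝ] W)
  isCompact' := K.isCompact.image f.continuous
  nonempty' := K.nonempty.image f

theorem mapBody_add {W : Type*} [NormedAddCommGroup W] [NormedSpace ℝ W] (f : V →L[ℝ] W)
    (K L : ConvexBody V) : mapBody f (K + L) = mapBody f K + mapBody f L :=
  ConvexBody.ext (Set.image_add f)

theorem mapBody_smul {W : Type*} [NormedAddCommGroup W] [NormedSpace ℝ W] (f : V →L[ℝ] W)
    (c : ℝ) (K : ConvexBody V) : mapBody f (c • K) = c • mapBody f K :=
  ConvexBody.ext (image_smul_set f c (K : Set V))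

theorem mapBody_segmentBody {W : Type*} [NormedAddCommGroup W] [NormedSpace ℝ W] (f : V →L[ℝ] W)
    (v : V) : mapBody f (segmentBody v) = segmentBody (f v) := by
  refine ConvexBody.ext ?_
  change f '' segment ℝ 0 v = segment ℝ 0 (f v)
  have := image_segment ℝ (f : V →ₗ[ℝ] W).toAffineMap 0 v
  simpa using this

theorem segmentBody_zero : segmentBody (0 : V) = 0 :=
  ConvexBody.ext (segment_same ℝ (0 : V))

variable [FiniteDimensional ℝ V] [MeasurableSpace V] [BorelSpace V]

/-- The volume swept out when `K` is translated by `v`; this is the volume of the projection of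
`K` along `v`. -/
def shadow (μ : Measure V) (K : ConvexBody V) (v : V) : ℝ :=
  μ.real ((K + segmentBody v : ConvexBody V) : Set V) - μ.real (K : Set V)

theorem shadow_zero (μ : Measure V) (K : ConvexBody V) : shadow μ K 0 = 0 := by
  rw [shadow, segmentBody_zero, add_zero, sub_self]

variable {E : Type*} [NormedAddCommGroup E] [NormedSpace ℝ E] [FiniteDimensional ℝ E]
  [MeasurableSpace E] [BorelSpace E]

theorem volume_add_uIcc {F : Set ℝ} (hF : IsCompact F) (hc : Convex ℝ F) (h0 : F.Nonempty)
    (t : ℝ) : volume (F + Set.uIcc 0 t) = volume F + ENNReal.ofReal |t| := by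
  obtain ⟨a, b, hab, rfl⟩ : ∃ a b : ℝ, a ≤ b ∧ F = Set.Icc a b := by
    have := eq_Icc_of_connected_compact ⟨h0, hc.isPreconnected⟩ hF
    exact ⟨_, _, Real.sInf_le_sSup _ hF.bddBelow hF.bddAbove, this⟩
  rw [Set.uIcc, Set.Icc_add_Icc hab (min_le_max), Real.volume_Icc, Real.volume_Icc,
    ← ENNReal.ofReal_add (by linarith) (abs_nonneg _)]
  congr 1
  have := max_sub_min_eq_abs (0 : ℝ) t
  rw [sub_zero] at this
  linarith

theorem segmentBody_smul (v : V) (t : ℝ) :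
    ((segmentBody (t • v) : ConvexBody V) : Set V) = (fun r : ℝ => r • v) '' Set.uIcc 0 t := by
  change segment ℝ 0 (t • v) = _
  rw [← segment_eq_uIcc]
  have := image_segment ℝ (LinearMap.toSpanSingleton ℝ V v).toAffineMap 0 t
  simpa using this.symm

variable {μ : Measure V} [μ.IsAddHaarMeasure] {ν : Measure E} [ν.IsAddHaarMeasure]
  {e : V ≃L[ℝ] ℝ × E}

/-- The projection of `V` along the vector `v` with `e v = (1, 0)`. -/
def projMap (e : V ≃L[ℝ] ℝ × E) : V →L[ℝ] E :=
  (ContinuousLinearMap.snd ℝ ℝ E).comp (e : V →L[ℝ] ℝ × E)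

/-- Adding the segment from 0 to t v lengthens each nonempty fibre in the direction v by |t|, and
the nonempty fibres are those over the projection of K; integrate over E. -/
theorem shadow_smul_eq (he : MeasurePreserving e μ ((volume : Measure ℝ).prod ν)) {v : V}
    (hv : e v = (1, 0)) (K : ConvexBody V) (t : ℝ) :
    shadow μ K (t • v) = |t| * ν.real (mapBody (projMap e) K : Set E) := by
  have fib : ∀ L : ConvexBody V, μ (L : Set V) = ∫⁻ y, volume {s : ℝ | e.symm (s, y) ∈ L} ∂ν := by
    intro L
    have hm : MeasurableSet (e.symm ⁻¹' (L : Set V)) :=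
      e.symm.continuous.measurable L.isCompact.measurableSet
    have := he.measure_preimage hm.nullMeasurableSet
    rw [← Set.preimage_comp] at this
    rw [show (L : Set V) = e.symm ∘ e ⁻¹' L by simp, this, Measure.prod_apply_symm hm]
    rfl
  have hmap : MeasurableSet (mapBody (projMap e) K : Set E) :=
    (mapBody (projMap e) K).isCompact.measurableSet
  have key : μ ((K + segmentBody (t • v) : ConvexBody V) : Set V) =
      μ (K : Set V) + ENNReal.ofReal |t| * ν (mapBody (projMap e) K : Set E) := by
    rw [fib, fib K, ← lintegral_indicator_const hmap, ← lintegral_add_right _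
      (measurable_const.indicator hmap)]
    refine lintegral_congr fun y => ?_
    have hset : {s : ℝ | e.symm (s, y) ∈ K + segmentBody (t • v)} =
        {s : ℝ | e.symm (s, y) ∈ K} + Set.uIcc 0 t := by
      have hsub : ∀ s r : ℝ, e.symm (s, y) - r • v = e.symm (s - r, y) := fun s r => by
        apply e.injective
        simp [hv]
      ext s
      constructor
      · rintro ⟨k, hk, w, hw, hkw⟩
        obtain ⟨r, hr, rfl⟩ := (segmentBody_smul v t).subset hw
        refine ⟨s - r, ?_, r, hr, by simp⟩
        rw [Set.mem_ofPred_eq, ← hsub, ← hkw]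
        simpa using hk
      · rintro ⟨s', hs', r, hr, rfl⟩
        refine ⟨_, hs', r • v, (segmentBody_smul v t).superset ⟨r, hr, rfl⟩, ?_⟩
        rw [← add_sub_cancel_right s' r, ← hsub]
        simp
    rw [hset]
    by_cases hy : y ∈ (mapBody (projMap e) K : Set E)
    · rw [Set.indicator_of_mem hy]
      have hcpt : IsCompact {s : ℝ | e.symm (s, y) ∈ K} := by
        refine Metric.isCompact_of_isClosed_isBounded
          (K.isClosed.preimage (e.symm.continuous.comp (by fun_prop))) ?_
        refine ((K.isCompact.image (continuous_fst.comp e.continuous)).isBounded).subset fun s hs =>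
          ⟨_, hs, by simp⟩
      refine volume_add_uIcc hcpt ?_ ?_ t
      · intro s hs r hr a b ha hb hab
        have := K.convex hs hr ha hb hab
        rw [← map_smul, ← map_smul, ← map_add] at this
        change e.symm (a • s + b • r, y) ∈ K
        have hy' : a • (s, y) + b • (r, y) = (a • s + b • r, y) := by
          simp [← add_smul, hab]
        rwa [hy'] at this
      · obtain ⟨x, hx, rfl⟩ := hy
        refine ⟨(e x).1, ?_⟩
        change e.symm ((e x).1, (e x).2) ∈ K
        simpa using hx
    · rw [Set.indicator_of_notMem hy]
      have : {s : ℝ | e.symm (s, y) ∈ K} = ∅ := by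
        ext s
        simp only [Set.mem_ofPred_eq, Set.mem_empty_iff_false, iff_false]
        exact fun hs => hy ⟨_, hs, by simp [projMap]⟩
      rw [this]
      simp
  rw [shadow, measureReal_def, key, ENNReal.toReal_add (measure_convexBody_lt_top μ K).ne
    (ENNReal.mul_ne_top ENNReal.ofReal_ne_top (measure_convexBody_lt_top ν _).ne),
    ENNReal.toReal_mul, ENNReal.toReal_ofReal (abs_nonneg _)]
  simp [measureReal_def]

theorem shadow_eq (he : MeasurePreserving e μ ((volume : Measure ℝ).prod ν)) {v : V}
    (hv : e v = (1, 0)) (K : ConvexBody V) :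
    shadow μ K v = ν.real (mapBody (projMap e) K : Set E) := by
  simpa using shadow_smul_eq he hv K 1

/-- Every nonzero vector `v` is the first basis vector of a splitting of `V`. -/
theorem exists_split_measurePreserving (μ : Measure V) [μ.IsAddHaarMeasure] {v : V} (hv : v ≠ 0) :
    ∃ (u : StrongDual ℝ V) (e : V ≃L[ℝ] ℝ × LinearMap.ker (u : V →ₗ[ℝ] ℝ))
      (ν : Measure (LinearMap.ker (u : V →ₗ[ℝ] ℝ))), ν.IsAddHaarMeasure ∧
      e v = (1, 0) ∧ MeasurePreserving e μ ((volume : Measure ℝ).prod ν) := by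
  obtain ⟨u, hu⟩ := SeparatingDual.exists_eq_one (R := ℝ) hv
  obtain ⟨e, -, he⟩ := exists_split u v hu
  obtain ⟨ν, hν, hm⟩ := exists_measurePreserving_prod μ e
  exact ⟨u, e, ν, hν, he, hm⟩

variable (μ)

theorem shadow_smul (K : ConvexBody V) (t : ℝ) (v : V) :
    shadow μ K (t • v) = |t| * shadow μ K v := by
  rcases eq_or_ne v 0 with rfl | hv
  · simp [shadow_zero]
  obtain ⟨u, e, ν, hν, hev, he⟩ := exists_split_measurePreserving μ hv
  rw [shadow_smul_eq he hev, shadow_eq he hev]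

theorem shadow_nonneg (K : ConvexBody V) (v : V) : 0 ≤ shadow μ K v := by
  rcases eq_or_ne v 0 with rfl | hv
  · simp [shadow_zero]
  obtain ⟨u, e, ν, hν, hev, he⟩ := exists_split_measurePreserving μ hv
  rw [shadow_eq he hev]
  exact measureReal_nonneg

theorem measureReal_smul {c : ℝ} (hc : 0 ≤ c) (K : ConvexBody V) :
    μ.real ((c • K : ConvexBody V) : Set V) = c ^ finrank ℝ V * μ.real (K : Set V) := by
  rw [ConvexBody.coe_smul, measureReal_def, Measure.addHaar_smul, ENNReal.toReal_mul,
    ENNReal.toReal_ofReal (abs_nonneg _), abs_of_nonneg (pow_nonneg hc _), measureReal_def]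

theorem shadow_smul_body {c : ℝ} (hc : 0 ≤ c) (K : ConvexBody V) (v : V) :
    shadow μ (c • K) v = c ^ (finrank ℝ V - 1) * shadow μ K v := by
  rcases eq_or_ne v 0 with rfl | hv
  · simp [shadow_zero]
  obtain ⟨u, e, ν, hν, hev, he⟩ := exists_split_measurePreserving μ hv
  rw [shadow_eq he hev, shadow_eq he hev, mapBody_smul, measureReal_smul ν hc,
    finrank_of_equiv_prod e, Nat.add_sub_cancel]

/-- The sum of the segments from `0` to the vectors of a list. -/
def zonotope (l : List V) : ConvexBody V := (l.map segmentBody).sum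

theorem mapBody_zonotope {W : Type*} [NormedAddCommGroup W] [NormedSpace ℝ W] (f : V →L[ℝ] W)
    (l : List V) : mapBody f (zonotope l) = zonotope (l.map f) := by
  induction l with
  | nil =>
    refine ConvexBody.ext ?_
    change f '' {0} = {0}
    simp
  | cons v l ih =>
    simp only [zonotope, List.map_cons, List.sum_cons] at ih ⊢
    rw [mapBody_add, ih, mapBody_segmentBody]

/-- The volume of `a L + Z` for a zonotope `Z` is a polynomial in `a` with nonnegative coefficients,
the first two of which are identified. -/
theorem exists_measureReal_smul_add_zonotope (k : ℕ) : ∀ {V : Type*} [NormedAddCommGroup V]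
    [NormedSpace ℝ V] [FiniteDimensional ℝ V] [MeasurableSpace V] [BorelSpace V] (μ : Measure V)
    [μ.IsAddHaarMeasure] {d : ℕ} (_ : finrank ℝ V = d + 1) (L : ConvexBody V) (l : List V)
    (_ : l.length = k),
    ∃ p : ℕ → ℝ, (∀ j, 0 ≤ p j) ∧ ∀ a : ℝ, 0 ≤ a →
      μ.real ((a • L + zonotope l : ConvexBody V) : Set V) = a ^ (d + 1) * μ.real (L : Set V) +
        a ^ d * (l.map (shadow μ L)).sum + ∑ j ∈ Finset.range d, p j * a ^ j := by
  induction k with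
  | zero =>
    intro V _ _ _ _ _ μ _ d hd L l hl
    obtain rfl := List.length_eq_zero_iff.1 hl
    refine ⟨0, fun _ => le_rfl, fun a ha => ?_⟩
    rw [zonotope, List.map_nil, List.sum_nil, add_zero, measureReal_smul μ ha, hd]
    simp
  | succ k ih =>
    intro V _ _ _ _ _ μ _ d hd L l hl
    obtain ⟨v, l, rfl⟩ := List.exists_cons_of_length_eq_add_one hl
    obtain ⟨p, hp, hpa⟩ := ih μ hd L l (by simpa using hl)
    have hz : zonotope (v :: l) = segmentBody v + zonotope l := by
      simp [zonotope]
    rcases eq_or_ne v 0 with rfl | hv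
    · refine ⟨p, hp, fun a ha => ?_⟩
      rw [hz, segmentBody_zero, zero_add, hpa a ha, List.map_cons, List.sum_cons, shadow_zero,
        zero_add]
    obtain ⟨u, e, ν, hν, hev, he⟩ := exists_split_measurePreserving μ hv
    -- Adding the segment of v increases the volume by the volume of the projection along v. That
    -- projection is again a multiple of a body plus a zonotope, in one dimension less and with one
    -- segment fewer, so the induction applies to it.
    have hstep : ∀ a : ℝ, μ.real ((a • L + zonotope (v :: l) : ConvexBody V) : Set V) =
        μ.real ((a • L + zonotope l : ConvexBody V) : Set V) +
        ν.real ((a • mapBody (projMap e) L + zonotope (l.map (projMap e)) : ConvexBody _) :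
          Set (LinearMap.ker (u : V →ₗ[ℝ] ℝ))) := by
      intro a
      have := shadow_eq he hev (a • L + zonotope l)
      rw [mapBody_add, mapBody_smul, mapBody_zonotope] at this
      rw [← this, shadow, hz, add_comm (segmentBody v), add_assoc]
      ring
    have hfin := finrank_of_equiv_prod e
    -- In dimension one the kernel is a point, so all its convex bodies coincide.
    rcases d with _ | d
    · have h0 : finrank ℝ (LinearMap.ker (u : V →ₗ[ℝ] ℝ)) = 0 := by omega
      have hsub : Subsingleton (LinearMap.ker (u : V →ₗ[ℝ] ℝ)) := finrank_zero_iff.1 h0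
      refine ⟨0, fun _ => le_rfl, fun a ha => ?_⟩
      have hall : ∀ K K' : ConvexBody (LinearMap.ker (u : V →ₗ[ℝ] ℝ)), (K : Set (LinearMap.ker (u : V →ₗ[ℝ] ℝ))) ⊆ K' :=
        fun K K' x _ => by
          obtain ⟨y, hy⟩ := K'.nonempty
          exact Subsingleton.elim y x ▸ hy
      rw [hstep, hpa a ha, (hall _ (mapBody (projMap e) L)).antisymm (hall _ _),
        ← shadow_eq he hev]
      simp
      ring
    · obtain ⟨q, hq, hqa⟩ := ih ν (d := d) (by omega) (mapBody (projMap e) L)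
        (l.map (projMap e)) (by simpa using hl)
      have hsum : 0 ≤ ((l.map (projMap e)).map (shadow ν (mapBody (projMap e) L))).sum :=
        List.sum_nonneg (by simpa using fun x _ => shadow_nonneg ν _ _)
      -- The leading coefficient of the increment is the shadow of v and joins the identified sum.
      -- Its second coefficient becomes the new top term of the unidentified part.
      refine ⟨fun j => p j + if j < d then q j else
        ((l.map (projMap e)).map (shadow ν (mapBody (projMap e) L))).sum, fun j => ?_,
        fun a ha => ?_⟩
      · have := hp j
        have := hq j
        dsimp only
        split_ifs <;> positivity
      · rw [hstep, hpa a ha, hqa a ha, ← shadow_eq he hev, List.map_cons, List.sum_cons]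
        set c := ((l.map (projMap e)).map (shadow ν (mapBody (projMap e) L))).sum
        have hs : ∑ j ∈ Finset.range (d + 1), (if j < d then q j else c) * a ^ j =
            ∑ j ∈ Finset.range d, q j * a ^ j + c * a ^ d := by
          rw [Finset.sum_range_succ, if_neg (lt_irrefl d)]
          congr 1
          exact Finset.sum_congr rfl fun j hj => by rw [if_pos (Finset.mem_range.1 hj)]
        simp only [add_mul, Finset.sum_add_distrib, hs]
        ring

end Shadow

/-! ### The first mixed volume as a finite difference. -/

section MixedVolume

variable {V : Type*} [NormedAddCommGroup V] [NormedSpace ℝ V] [FiniteDimensional ℝ V]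
  [MeasurableSpace V] [BorelSpace V] {d : ℕ} [Fact (finrank ℝ V = d + 1)]

/-- Only the last index carries C. Pairing each I that avoids it with I plus that index, and
grouping by cardinality, turns the polarization sum into the d-th difference at 0 of k ↦ vol(kL + C)
- vol(kL). -/
theorem mixedVolumePair_one_eq (Ω : V [⋀^Fin (d + 1)]→ₗ[ℝ] ℝ) (L C : ConvexBody V) :
    mixedVolumePair Ω 1 L C = ((d + 1).factorial : ℝ)⁻¹ * ∑ k ∈ Finset.range (d + 1),
      ((-1 : ℤ) ^ (d - k) * d.choose k) •
        (Ω.measure.real (((k : ℝ) • L + C : ConvexBody V) : Set V) -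
          Ω.measure.real (((k : ℝ) • L : ConvexBody V) : Set V)) := by
  have hnat : ∀ k : ℕ, k • L = (k : ℝ) • L := fun k => by
    have h := Nat.cast_smul_eq_nsmul NNReal k L
    rw [← h]
    exact ConvexBody.ext (by simp [NNReal.smul_def])
  set K : Fin (d + 1) → ConvexBody V := fun j => if (j : ℕ) < d + 1 - 1 then L else C with hK
  have hlast : K (Fin.last d) = C := by simp [hK]
  have huniv : (Finset.univ : Finset (Fin (d + 1))) =
      insert (Fin.last d) (Finset.univ.map Fin.castSuccEmb) := by
    ext i
    simp only [Finset.mem_univ, Finset.mem_insert, Finset.mem_map, true_and, true_iff]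
    rcases Fin.eq_castSucc_or_eq_last i with ⟨j, rfl⟩ | rfl
    · exact Or.inr ⟨j, rfl⟩
    · exact Or.inl rfl
  have hnot : Fin.last d ∉ (Finset.univ.map Fin.castSuccEmb : Finset (Fin (d + 1))) := by
    simp [Fin.castSucc_ne_last]
  have hsum : ∀ I ∈ (Finset.univ.map Fin.castSuccEmb : Finset (Fin (d + 1))).powerset,
      ∑ i ∈ I, K i = (I.card : ℝ) • L := by
    intro I hI
    rw [← hnat, ← Finset.sum_const]
    refine Finset.sum_congr rfl fun i hi => ?_
    obtain ⟨j, -, rfl⟩ := Finset.mem_map.1 (Finset.mem_powerset.1 hI hi)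
    simp [hK]
  rw [mixedVolumePair, mixedVolume]
  congr 1
  change ∑ I : Finset (Fin (d + 1)), (-1 : ℝ) ^ (d + 1 + I.card) *
    Ω.measure.real ((∑ i ∈ I, K i : ConvexBody V) : Set V) = _
  rw [← Finset.powerset_univ, huniv, Finset.sum_powerset_insert hnot, ← Finset.sum_add_distrib]
  have hterm : ∀ I ∈ (Finset.univ.map Fin.castSuccEmb : Finset (Fin (d + 1))).powerset,
      (-1 : ℝ) ^ (d + 1 + I.card) * Ω.measure.real ((∑ i ∈ I, K i : ConvexBody V) : Set V) +
        (-1 : ℝ) ^ (d + 1 + (insert (Fin.last d) I).card) *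
          Ω.measure.real ((∑ i ∈ insert (Fin.last d) I, K i : ConvexBody V) : Set V) =
      (-1 : ℝ) ^ (d + I.card) * (Ω.measure.real (((I.card : ℝ) • L + C : ConvexBody V) : Set V) -
        Ω.measure.real (((I.card : ℝ) • L : ConvexBody V) : Set V)) := by
    intro I hI
    have hI' : Fin.last d ∉ I := fun h => hnot (Finset.mem_powerset.1 hI h)
    rw [Finset.card_insert_of_notMem hI', Finset.sum_insert hI', hlast, hsum I hI, add_comm C]
    ring
  rw [Finset.sum_congr rfl hterm, Finset.sum_powerset_apply_card
    (fun k => (-1 : ℝ) ^ (d + k) * (Ω.measure.real (((k : ℝ) • L + C : ConvexBody V) : Set V) -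
        Ω.measure.real (((k : ℝ) • L : ConvexBody V) : Set V)))]
  rw [Finset.card_map, Finset.card_univ, Fintype.card_fin]
  refine Finset.sum_congr rfl fun k hk => ?_
  have hk' : k ≤ d := by simpa [Nat.lt_succ_iff] using hk
  have hpow : (-1 : ℝ) ^ (d + k) = (-1) ^ (d - k) := by
    obtain ⟨m, rfl⟩ := Nat.exists_eq_add_of_le hk'
    rw [Nat.add_sub_cancel_left, show k + m + k = m + 2 * k by ring, pow_add, pow_mul]
    simp
  rw [hpow, nsmul_eq_mul, zsmul_eq_mul]
  push_cast
  ring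

/-- The d-th difference of a polynomial of degree at most d is d! times its coefficient of degree d,
and dividing by (d + 1)! leaves c / (d + 1). -/
theorem mixedVolumePair_one_of_polynomial (Ω : V [⋀^Fin (d + 1)]→ₗ[ℝ] ℝ) {L C : ConvexBody V}
    {c : ℝ} {p : ℕ → ℝ} (h : ∀ k : ℕ, Ω.measure.real (((k : ℝ) • L + C : ConvexBody V) : Set V) -
      Ω.measure.real (((k : ℝ) • L : ConvexBody V) : Set V) =
        c * k ^ d + ∑ j ∈ Finset.range d, p j * k ^ j) :
    mixedVolumePair Ω 1 L C = c / (d + 1) := by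
  have h1 := fwdDiff_iter_eq_sum_shift (1 : ℝ) (fun r : ℝ => c * r ^ d + ∑ j ∈ Finset.range d,
    p j * r ^ j) d 0
  have h2 : (fwdDiff (1 : ℝ))^[d] (fun r : ℝ => c * r ^ d + ∑ j ∈ Finset.range d, p j * r ^ j) 0 =
      c * d.factorial := by
    have e1 : (fun r : ℝ => c * r ^ d + ∑ j ∈ Finset.range d, p j * r ^ j) =
        c • (fun r : ℝ => r ^ d) + fun r : ℝ => ∑ j ∈ Finset.range d, p j * r ^ j := by
      ext r; simp
    rw [e1, fwdDiff_iter_add, fwdDiff_iter_const_smul, fwdDiff_iter_eq_factorial,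
      fwdDiff_iter_sum_mul_pow_eq_zero]
    simp
  rw [mixedVolumePair_one_eq]
  simp only [h]
  simp only [nsmul_eq_mul, mul_one, zero_add] at h1
  rw [← h1, h2, Nat.factorial_succ]
  have : (d.factorial : ℝ) ≠ 0 := by positivity
  have : (d + 1 : ℝ) ≠ 0 := by positivity
  push_cast
  field_simp

theorem tendsto_mixedVolumePair_one {ι : Type*} {l : Filter ι} (Ω : V [⋀^Fin (d + 1)]→ₗ[ℝ] ℝ)
    [Ω.measure.IsAddHaarMeasure] (L : ConvexBody V) {C : ι → ConvexBody V} {D : ConvexBody V}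
    (h : SupportTendsto l C D) :
    Filter.Tendsto (fun i => mixedVolumePair Ω 1 L (C i)) l (nhds (mixedVolumePair Ω 1 L D)) := by
  simp only [mixedVolumePair_one_eq]
  refine (tendsto_finsetSum _ fun k _ => Filter.Tendsto.const_smul (Filter.Tendsto.sub_const
    ((h.const_add _).tendsto_measureReal Ω.measure) _) _).const_mul _

end MixedVolume

/-! ### Zonoids generated by an integrable vector field, as limits of zonotopes. -/

section Zonoid

variable {V : Type*} [NormedAddCommGroup V] [NormedSpace ℝ V] [FiniteDimensional ℝ V]

/-- The body consisting of a single point. -/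
def pointBody (x : V) : ConvexBody V :=
  ⟨{x}, convex_singleton x, isCompact_singleton, Set.singleton_nonempty x⟩

theorem supportFn_pointBody (x : V) (u : StrongDual ℝ V) : supportFn (pointBody x) u = u x := by
  obtain ⟨y, hy, h⟩ := exists_eq_supportFn (pointBody x) u
  obtain rfl : y = x := hy
  exact h.symm

theorem supportFn_zonotope (l : List V) (u : StrongDual ℝ V) :
    supportFn (zonotope l) u = (l.map fun v => max (u v) 0).sum := by
  induction l with
  | nil =>
    have : zonotope ([] : List V) = pointBody 0 := rfl
    rw [this, supportFn_pointBody]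
    simp
  | cons v l ih =>
    have hz : zonotope (v :: l) = segmentBody v + zonotope l := by simp [zonotope]
    rw [hz, supportFn_add, ih, supportFn_segmentBody]
    simp

/-- The translate of a zonotope that is symmetric about the origin. -/
def centeredZonotope (l : List V) : ConvexBody V := zonotope l + pointBody (-(1 / 2 : ℝ) • l.sum)

theorem supportFn_centeredZonotope (l : List V) (u : StrongDual ℝ V) :
    supportFn (centeredZonotope l) u = 1 / 2 * (l.map fun v => |u v|).sum := by
  rw [centeredZonotope, supportFn_add, supportFn_pointBody, supportFn_zonotope]
  induction l with
  | nil => simp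
  | cons v l ih =>
    simp only [List.map_cons, List.sum_cons, smul_add, map_add, map_smul, smul_eq_mul] at ih ⊢
    have : max (u v) 0 = 1 / 2 * (|u v| + u v) := by
      rcases abs_cases (u v) with ⟨h, h'⟩ | ⟨h, h'⟩
      · rw [max_eq_left h', h]; ring
      · rw [max_eq_right h'.le, h]; ring
    rw [this]
    linarith

variable [MeasurableSpace V] [BorelSpace V]

theorem measureReal_add_pointBody (μ : Measure V) [μ.IsAddHaarMeasure] (K : ConvexBody V) (x : V) :
    μ.real ((K + pointBody x : ConvexBody V) : Set V) = μ.real (K : Set V) := by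
  have : ((K + pointBody x : ConvexBody V) : Set V) = (fun y => y + x) '' K := by
    change (K : Set V) + {x} = _
    rw [Set.add_singleton]
  rw [this, Set.image_add_right, measureReal_def, measure_preimage_add_right, measureReal_def]

variable {X : Type*} [MeasurableSpace X]

/-- `Z` is the zonoid `½ ∫ [-F x, F x] dρ(x)`. -/
def IsZonoidOf (ρ : Measure X) (F : X → V) (Z : ConvexBody V) : Prop :=
  Integrable F ρ ∧ ∀ u, supportFn Z u = 1 / 2 * ∫ x, |u (F x)| ∂ρ

/-- `h` is an even positively homogeneous Lipschitz function. -/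
structure IsLipschitzGauge (h : V → ℝ) (C : ℝ) : Prop where
  nonneg : 0 ≤ C
  smul : ∀ (t : ℝ) v, h (t • v) = |t| * h v
  lip : ∀ v w, |h v - h w| ≤ C * ‖v - w‖

theorem IsLipschitzGauge.zero {h : V → ℝ} {C : ℝ} (hh : IsLipschitzGauge h C) : h 0 = 0 := by
  simpa using hh.smul 0 0

theorem IsLipschitzGauge.abs_le {h : V → ℝ} {C : ℝ} (hh : IsLipschitzGauge h C) (v : V) :
    |h v| ≤ C * ‖v‖ := by
  simpa [hh.zero] using hh.lip v 0

theorem IsLipschitzGauge.continuous {h : V → ℝ} {C : ℝ} (hh : IsLipschitzGauge h C) :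
    Continuous h := by
  refine (LipschitzWith.of_dist_le_mul (K := C.toNNReal) fun v w => ?_).continuous
  rw [Real.dist_eq, dist_eq_norm]
  exact (hh.lip v w).trans (mul_le_mul_of_nonneg_right (Real.le_coe_toNNReal C) (norm_nonneg _))

theorem IsLipschitzGauge.integrable {h : V → ℝ} {C : ℝ} (hh : IsLipschitzGauge h C)
    {ρ : Measure X} {F : X → V} (hF : Integrable F ρ) : Integrable (fun x => h (F x)) ρ := by
  refine Integrable.mono' (hF.norm.const_mul C)
    (hh.continuous.comp_aestronglyMeasurable hF.aestronglyMeasurable)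
    (Filter.Eventually.of_forall fun x => ?_)
  rw [Real.norm_eq_abs]
  exact hh.abs_le _

theorem isLipschitzGauge_abs (u : StrongDual ℝ V) : IsLipschitzGauge (fun v => |u v|) ‖u‖ :=
  ⟨norm_nonneg u, fun t v => by simp [abs_mul], fun v w => by
    refine (abs_abs_sub_abs_le _ _).trans ?_
    rw [← map_sub]
    exact u.le_opNorm _⟩

/-- Integrals of homogeneous functions of an integrable vector field are approximated by sums. -/
theorem exists_list_approx {ρ : Measure X} {F : X → V} (hF : Integrable F ρ) {ε : ℝ} (hε : 0 < ε) :
    ∃ l : List V, ∀ (h : V → ℝ) (C : ℝ), IsLipschitzGauge h C →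
      |(l.map h).sum - ∫ x, h (F x) ∂ρ| ≤ C * ε := by
  obtain ⟨G, hG, hGm⟩ := (memLp_one_iff_integrable.2 hF).exists_simpleFunc_eLpNorm_sub_lt
    ENNReal.one_ne_top (ε := ENNReal.ofReal ε) (by simpa using hε)
  have hGi : Integrable G ρ := memLp_one_iff_integrable.1 hGm
  -- Homogeneity turns the sum of h over the vectors ρ(G = w) w into ∫ h(G). The list is chosen
  -- before h, so the same zonotopes serve both the support functions and the integrals of shadows.
  refine ⟨G.range.toList.map fun w => ρ.real (G ⁻¹' {w}) • w, fun h C hh => ?_⟩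
  have h1 : ((G.range.toList.map fun w => ρ.real (G ⁻¹' {w}) • w).map h).sum =
      ∫ x, h (G x) ∂ρ := by
    have e1 : ∫ x, h (G x) ∂ρ = (G.map h).integral ρ :=
      (SimpleFunc.integral_eq_integral (G.map h) (hh.integrable hGi)).symm
    rw [e1, SimpleFunc.map_integral G h hGi hh.zero, List.map_map, Finset.sum_map_toList]
    refine Finset.sum_congr rfl fun w _ => ?_
    simp [hh.smul, abs_of_nonneg measureReal_nonneg]
  rw [h1, ← integral_sub (hh.integrable hGi) (hh.integrable hF)]
  have h2 : ∫ x, ‖F x - G x‖ ∂ρ ≤ ε := by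
    rw [integral_norm_eq_lintegral_enorm (f := fun x => F x - G x) (hF.sub hGi).aestronglyMeasurable]
    refine ENNReal.toReal_le_of_le_ofReal hε.le ?_
    rw [eLpNorm_one_eq_lintegral_enorm] at hG
    exact hG.le
  have h3 : |∫ x, (h (G x) - h (F x)) ∂ρ| ≤ ∫ x, C * ‖F x - G x‖ ∂ρ := by
    refine (abs_integral_le_integral_abs).trans (integral_mono_of_nonneg
      (Filter.Eventually.of_forall fun x => abs_nonneg _) ((hF.sub hGi).norm.const_mul C)
      (Filter.Eventually.of_forall fun x => ?_))
    simpa [norm_sub_rev] using hh.lip (G x) (F x)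
  refine h3.trans ?_
  rw [integral_const_mul]
  exact mul_le_mul_of_nonneg_left h2 hh.nonneg

/-- A zonoid is a limit of zonotopes, together with the integrals of homogeneous functions. -/
theorem IsZonoidOf.exists_tendsto {ρ : Measure X} {F : X → V} {Z : ConvexBody V}
    (hZ : IsZonoidOf ρ F Z) : ∃ l : ℕ → List V,
      SupportTendsto Filter.atTop (fun k => centeredZonotope (l k)) Z ∧
      ∀ (h : V → ℝ) (C : ℝ), IsLipschitzGauge h C →
        Filter.Tendsto (fun k => ((l k).map h).sum) Filter.atTop (nhds (∫ x, h (F x) ∂ρ)) := by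
  choose l hl using fun k : ℕ => exists_list_approx hZ.1 (ε := 1 / (k + 1 : ℝ)) (by positivity)
  have hlim := tendsto_one_div_add_atTop_nhds_zero_nat (𝕜 := ℝ)
  refine ⟨l, fun ε hε => ?_, fun h C hh => ?_⟩
  · filter_upwards [hlim (gt_mem_nhds hε)] with k hk u
    have h1 := hl k _ _ (isLipschitzGauge_abs u)
    have hk : 1 / (k + 1 : ℝ) < ε := hk
    rw [supportFn_centeredZonotope, hZ.2, ← mul_sub, abs_mul, abs_of_pos (by norm_num)]
    have h2 : ‖u‖ * (1 / (k + 1 : ℝ)) ≤ ‖u‖ * ε := mul_le_mul_of_nonneg_left hk.le (norm_nonneg u)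
    have h3 : 0 ≤ ε * ‖u‖ := by positivity
    linarith
  · rw [tendsto_iff_dist_tendsto_zero]
    refine squeeze_zero (fun _ => dist_nonneg) (fun k => ?_) (by simpa using hlim.const_mul C)
    rw [Real.dist_eq]
    simpa using hl k h C hh

/-- The unidentified coefficients are nonnegative, and their sum is at most vol(L + Z) by the case a
= 1; for a ≥ 1 their contribution is at most a^(d-1) times this. Such bounds pass to limits of
zonotopes without control of the single coefficients. -/
theorem measureReal_smul_add_centeredZonotope_bounds (μ : Measure V) [μ.IsAddHaarMeasure] {d : ℕ}
    (hd : finrank ℝ V = d + 1) (L : ConvexBody V) (l : List V) {a : ℝ} (ha : 1 ≤ a) :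
    a ^ (d + 1) * μ.real (L : Set V) + a ^ d * (l.map (shadow μ L)).sum ≤
        μ.real ((a • L + centeredZonotope l : ConvexBody V) : Set V) ∧
      μ.real ((a • L + centeredZonotope l : ConvexBody V) : Set V) ≤
        a ^ (d + 1) * μ.real (L : Set V) + a ^ d * (l.map (shadow μ L)).sum +
          a ^ (d - 1) * μ.real ((L + centeredZonotope l : ConvexBody V) : Set V) := by
  obtain ⟨p, hp, hpa⟩ := exists_measureReal_smul_add_zonotope _ μ hd L l rfl
  have h0 : (0 : ℝ) ≤ a := by linarith
  have h1 := hpa 1 zero_le_one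
  rw [one_smul] at h1
  simp only [one_pow, one_mul, mul_one] at h1
  have h2 : 0 ≤ (l.map (shadow μ L)).sum :=
    List.sum_nonneg (by simpa using fun x _ => shadow_nonneg μ L x)
  have h3 : 0 ≤ μ.real (L : Set V) := measureReal_nonneg
  have h4 : 0 ≤ ∑ j ∈ Finset.range d, p j * a ^ j :=
    Finset.sum_nonneg fun j _ => mul_nonneg (hp j) (by positivity)
  have h5 : ∑ j ∈ Finset.range d, p j * a ^ j ≤ a ^ (d - 1) * ∑ j ∈ Finset.range d, p j := by
    rw [Finset.mul_sum]
    refine Finset.sum_le_sum fun j hj => ?_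
    rw [mul_comm]
    refine mul_le_mul_of_nonneg_right (pow_le_pow_right₀ ha ?_) (hp j)
    have := Finset.mem_range.1 hj
    omega
  have h6 : a ^ (d - 1) * ∑ j ∈ Finset.range d, p j ≤
      a ^ (d - 1) * μ.real ((L + zonotope l : ConvexBody V) : Set V) :=
    mul_le_mul_of_nonneg_left (by linarith) (by positivity)
  rw [centeredZonotope, ← add_assoc, ← add_assoc, measureReal_add_pointBody,
    measureReal_add_pointBody, hpa a h0]
  constructor <;> linarith

theorem IsZonoidOf.measureReal_smul_add_bounds {ρ : Measure X} {F : X → V} {Z : ConvexBody V}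
    (hZ : IsZonoidOf ρ F Z) (μ : Measure V) [μ.IsAddHaarMeasure] {d : ℕ}
    (hd : finrank ℝ V = d + 1) {L : ConvexBody V} {C : ℝ} (hL : IsLipschitzGauge (shadow μ L) C)
    {a : ℝ} (ha : 1 ≤ a) :
    a ^ (d + 1) * μ.real (L : Set V) + a ^ d * ∫ x, shadow μ L (F x) ∂ρ ≤
        μ.real ((a • L + Z : ConvexBody V) : Set V) ∧
      μ.real ((a • L + Z : ConvexBody V) : Set V) ≤
        a ^ (d + 1) * μ.real (L : Set V) + a ^ d * ∫ x, shadow μ L (F x) ∂ρ +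
          a ^ (d - 1) * μ.real ((L + Z : ConvexBody V) : Set V) := by
  obtain ⟨l, hl1, hl2⟩ := hZ.exists_tendsto
  have t1 := (hl1.const_add (a • L)).tendsto_measureReal μ
  have t2 := (hl1.const_add L).tendsto_measureReal μ
  have t3 := hl2 _ _ hL
  constructor
  · refine le_of_tendsto_of_tendsto' ((t3.const_mul (a ^ d)).const_add
      (a ^ (d + 1) * μ.real (L : Set V))) t1 fun k => ?_
    exact (measureReal_smul_add_centeredZonotope_bounds μ hd L (l k) ha).1
  · refine le_of_tendsto_of_tendsto' t1 (((t3.const_mul (a ^ d)).const_add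
      (a ^ (d + 1) * μ.real (L : Set V))).add (t2.const_mul (a ^ (d - 1)))) fun k => ?_
    exact (measureReal_smul_add_centeredZonotope_bounds μ hd L (l k) ha).2

/-- The first mixed volume of a body and a zonoid. -/
theorem IsZonoidOf.mixedVolumePair_one {d : ℕ} [h : Fact (finrank ℝ V = d + 1)]
    (Ω : V [⋀^Fin (d + 1)]→ₗ[ℝ] ℝ) [Ω.measure.IsAddHaarMeasure]
    {ρ : Measure X} {F : X → V} {Z : ConvexBody V} (hZ : IsZonoidOf ρ F Z)
    {L : ConvexBody V} {C : ℝ} (hL : IsLipschitzGauge (shadow Ω.measure L) C) :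
    mixedVolumePair Ω 1 L Z = (∫ x, shadow Ω.measure L (F x) ∂ρ) / (d + 1) := by
  obtain ⟨l, hl1, hl2⟩ := hZ.exists_tendsto
  refine tendsto_nhds_unique (tendsto_mixedVolumePair_one Ω L hl1) ?_
  refine ((hl2 _ _ hL).div_const _).congr fun k => ?_
  obtain ⟨p, -, hpa⟩ := exists_measureReal_smul_add_zonotope _ Ω.measure h.out L (l k) rfl
  refine (mixedVolumePair_one_of_polynomial Ω (p := p) fun k => ?_).symm
  rw [centeredZonotope, ← add_assoc, measureReal_add_pointBody, hpa _ (Nat.cast_nonneg k),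
    measureReal_smul _ (Nat.cast_nonneg k), h.out]
  ring

end Zonoid

/-! ### Total variation of unimodal functions on the line. -/

section Unimodal

/-- The total variation of a unimodal Lipschitz function with bounded support is twice its
maximum. -/
theorem exists_lintegral_abs_deriv_eq {φ : ℝ → ℝ} {K : NNReal} (hφ : LipschitzWith K φ)
    (h0 : ∀ t, 0 ≤ φ t) (hq : ∀ x y z, x ≤ y → y ≤ z → min (φ x) (φ z) ≤ φ y) {R : ℝ}
    (hR : ∀ t, φ t ≠ 0 → |t| ≤ R) :
    ∃ m, (∀ t, φ t ≤ φ m) ∧ ∫⁻ t, ENNReal.ofReal |deriv φ t| = ENNReal.ofReal (2 * φ m) := by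
  -- Strictly beyond the support, so that φ vanishes at ±R' and near every point further out.
  set R' := |R| + 1 with hR'
  have hR0 : 0 < R' := by positivity
  have hz : ∀ t, R' ≤ |t| → φ t = 0 := fun t ht => by
    by_contra h
    have := hR t h
    have := le_abs_self R
    linarith
  obtain ⟨m, hm, hmax⟩ := isCompact_Icc.exists_isMaxOn (Set.nonempty_Icc.2 (by linarith))
    (hφ.continuous.continuousOn (s := Set.Icc (-R') R'))
  have hmax' : ∀ t, φ t ≤ φ m := fun t => by
    by_cases ht : t ∈ Set.Icc (-R') R'
    · exact hmax ht
    · rw [hz t]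
      · exact h0 m
      · by_contra! h
        exact ht ⟨(abs_lt.1 h).1.le, (abs_lt.1 h).2.le⟩
  have ac : ∀ a b, AbsolutelyContinuousOnInterval φ a b := fun a b =>
    (hφ.lipschitzOnWith (s := Set.uIcc a b)).absolutelyContinuousOnInterval
  -- Unimodality makes φ increase up to its maximum point m and decrease after it, so the
  -- fundamental theorem of calculus contributes φ m on each side.
  have hl : ∀ t, t < m → 0 ≤ deriv φ t := by
    intro t ht
    have hmono : MonotoneOn φ (Set.Iic m) := fun x hx y hy hxy => by
      simpa [hmax'] using hq x y m hxy hy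
    rw [← derivWithin_of_mem_nhds (Iic_mem_nhds ht)]
    exact hmono.derivWithin_nonneg
  have hr : ∀ t, m < t → deriv φ t ≤ 0 := by
    intro t ht
    have hmono : AntitoneOn φ (Set.Ici m) := fun x hx y hy hxy => by
      simpa [hmax'] using hq m x y hx hxy
    rw [← derivWithin_of_mem_nhds (Ici_mem_nhds ht)]
    exact hmono.derivWithin_nonpos
  have i1 : ∫ t in (-R')..m, |deriv φ t| = φ m := by
    have := (ac (-R') m).integral_deriv_eq_sub
    rw [hz (-R') (by rw [abs_neg]; exact le_abs_self _), sub_zero] at this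
    rw [← this]
    refine intervalIntegral.integral_congr_ae ?_
    filter_upwards [compl_mem_ae_iff.2 (measure_singleton m)] with t ht ht'
    rw [Set.uIoc_of_le hm.1] at ht'
    exact abs_of_nonneg (hl t (lt_of_le_of_ne ht'.2 ht))
  have i2 : ∫ t in m..R', |deriv φ t| = φ m := by
    have := (ac m R').integral_deriv_eq_sub
    rw [hz R' (le_abs_self _), zero_sub] at this
    rw [← neg_eq_iff_eq_neg.2 this, ← intervalIntegral.integral_neg]
    refine intervalIntegral.integral_congr_ae (Filter.Eventually.of_forall fun t ht' => ?_)
    rw [Set.uIoc_of_le hm.2] at ht'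
    exact abs_of_nonpos (hr t ht'.1)
  have hint : ∀ a b, IntervalIntegrable (fun t => |deriv φ t|) volume a b := fun a b =>
    (ac a b).intervalIntegrable_deriv.abs
  have i3 : ∫ t in (-R')..R', |deriv φ t| = 2 * φ m := by
    rw [← intervalIntegral.integral_add_adjacent_intervals (hint _ m) (hint m _), i1, i2]
    ring
  refine ⟨m, hmax', ?_⟩
  rw [← i3, intervalIntegral.integral_of_le (by linarith), ofReal_integral_eq_lintegral_ofReal
    ((hint _ _).1) (Filter.Eventually.of_forall fun t => abs_nonneg _),
    ← lintegral_indicator measurableSet_Ioc]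
  refine lintegral_congr_ae ?_
  filter_upwards [compl_mem_ae_iff.2 (measure_singleton (-R')),
    compl_mem_ae_iff.2 (measure_singleton R')] with t ht1 ht2
  by_cases ht : t ∈ Set.Ioc (-R') R'
  · rw [Set.indicator_of_mem ht]
  · rw [Set.indicator_of_notMem ht]
    have h1 : R' < |t| := by
      by_contra! h
      rw [abs_le] at h
      exact ht ⟨lt_of_le_of_ne h.1 (Ne.symm ht1), h.2⟩
    have h2 : φ =ᶠ[nhds t] fun _ => 0 := by
      filter_upwards [(isOpen_lt continuous_const continuous_abs).mem_nhds h1] with s hs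
      exact hz s (le_of_lt hs)
    rw [h2.deriv_eq]
    simp

end Unimodal

/-! ### The cone function of a body, and projection bodies as zonoids. -/

section Gauge

variable {V : Type*} [NormedAddCommGroup V] [NormedSpace ℝ V]

/-- The cone function `max (0, 1 - g)` where `g` is the gauge of `A`. -/
def coneFn (A : Set V) (x : V) : ℝ := max 0 (1 - gauge A x)

theorem coneFn_nonneg (A : Set V) (x : V) : 0 ≤ coneFn A x := le_max_left _ _

theorem exists_lipschitzWith_coneFn {A : Set V} (hA : Convex ℝ A) (h0 : A ∈ nhds 0) :
    ∃ K, LipschitzWith K (coneFn A) := by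
  obtain ⟨K, hK⟩ := hA.lipschitz_gauge h0
  refine ⟨0 + K, ?_⟩
  have := ((LipschitzWith.const (1 : ℝ)).sub hK).const_max 0
  exact this

theorem min_le_coneFn {A : Set V} (hA : Convex ℝ A) (h0 : A ∈ nhds 0) {x y : V} {a b : ℝ}
    (ha : 0 ≤ a) (hb : 0 ≤ b) (hab : a + b = 1) :
    min (coneFn A x) (coneFn A y) ≤ coneFn A (a • x + b • y) := by
  have h1 := gauge_add_le hA (absorbent_nhds_zero h0) (a • x) (b • y)
  rw [gauge_smul_of_nonneg ha, gauge_smul_of_nonneg hb, smul_eq_mul, smul_eq_mul] at h1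
  have h2 : a * gauge A x + b * gauge A y ≤ max (gauge A x) (gauge A y) :=
    calc _ ≤ a * max (gauge A x) (gauge A y) + b * max (gauge A x) (gauge A y) := by
          gcongr
          · exact le_max_left _ _
          · exact le_max_right _ _
      _ = _ := by rw [← add_mul, hab, one_mul]
  rw [coneFn, coneFn, coneFn, ← max_min_distrib_left]
  refine max_le_max_left 0 ?_
  rw [min_sub_sub_left]
  linarith

/-- Since the superlevel sets are dilates of A, their projections are dilates of the projection of
A; this makes the layer-cake integral below explicit. -/
theorem le_coneFn_iff {A : Set V} (hA : Convex ℝ A) (hAc : IsCompact A) (h0 : A ∈ nhds 0) {s : ℝ}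
    (hs : 0 < s) (hs1 : s ≤ 1) {x : V} : s ≤ coneFn A x ↔ x ∈ (1 - s) • A := by
  have h1 : s ≤ coneFn A x ↔ gauge A x ≤ 1 - s := by
    rw [coneFn, le_max_iff]
    constructor
    · rintro (h | h) <;> linarith
    · intro h; right; linarith
  rw [h1]
  constructor
  · intro h
    rcases hs1.eq_or_lt with rfl | hs1
    · rw [sub_self] at h ⊢
      have := (gauge_eq_zero (absorbent_nhds_zero h0) (NormedSpace.isVonNBounded_of_isBounded ℝ hAc.isBounded)).1
        (le_antisymm h (gauge_nonneg x))
      exact ⟨0, mem_of_mem_nhds h0, by simp [this]⟩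
    · have hpos : 0 < 1 - s := by linarith
      rw [Set.mem_smul_set_iff_inv_smul_mem₀ hpos.ne']
      rw [← hAc.isClosed.closure_eq, ← gauge_le_one_iff_mem_closure hA h0,
        gauge_smul_of_nonneg (by positivity), smul_eq_mul, inv_mul_le_iff₀ hpos]
      simpa using h
  · exact fun h => gauge_le_of_mem (by linarith) h

theorem coneFn_eq_zero {A : Set V} (hA : Convex ℝ A) (h0 : A ∈ nhds 0) {x : V} (hx : x ∉ A) :
    coneFn A x = 0 := by
  have := one_le_gauge_of_notMem (hA.starConvex (mem_of_mem_nhds h0))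
    ((absorbent_nhds_zero h0).absorbs) hx
  rw [coneFn, max_eq_left (by linarith)]

theorem coneFn_le_one (A : Set V) (x : V) : coneFn A x ≤ 1 :=
  max_le zero_le_one (by linarith [gauge_nonneg (s := A) x])

variable [FiniteDimensional ℝ V] [MeasurableSpace V] [BorelSpace V]

theorem integrable_fderiv_coneFn (μ : Measure V) [μ.IsAddHaarMeasure] {A : Set V}
    (hA : Convex ℝ A) (hAc : IsCompact A) (h0 : A ∈ nhds 0) :
    Integrable (fderiv ℝ (coneFn A)) μ := by
  obtain ⟨K, hK⟩ := exists_lipschitzWith_coneFn hA h0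
  refine Integrable.mono' (g := A.indicator fun _ => (K : ℝ)) ?_
    (measurable_fderiv ℝ _).aestronglyMeasurable (Filter.Eventually.of_forall fun x => ?_)
  · exact (integrable_indicator_iff hAc.measurableSet).2
      (integrableOn_const hAc.measure_lt_top.ne)
  · by_cases hx : x ∈ A
    · rw [Set.indicator_of_mem hx]
      exact norm_fderiv_le_of_lipschitz ℝ hK
    · rw [Set.indicator_of_notMem hx]
      have : coneFn A =ᶠ[nhds x] fun _ => 0 := by
        filter_upwards [hAc.isClosed.isOpen_compl.mem_nhds hx] with y hy
        exact coneFn_eq_zero hA h0 hy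
      rw [this.fderiv_eq]
      simp

variable {E : Type*} [NormedAddCommGroup E] [NormedSpace ℝ E] [FiniteDimensional ℝ E]
  [MeasurableSpace E] [BorelSpace E]

/-- On almost every line parallel to v the Lipschitz cone function is differentiable almost
everywhere. It is unimodal there, so ∫ |∂ᵥf| over the line is twice its maximum M(y). The set {M ≥
s} is the dilate by 1 - s of the projection of A, whence ∫ M = vol(projection) · ∫₀¹ (1 - s)ⁿ⁻¹ ds =
vol(projection) / n, where n is the dimension of V. -/
theorem lintegral_abs_fderiv_coneFn_of_split {μ : Measure V} [μ.IsAddHaarMeasure] {ν : Measure E}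
    [ν.IsAddHaarMeasure] {e : V ≃L[ℝ] ℝ × E}
    (he : MeasurePreserving e μ ((volume : Measure ℝ).prod ν)) (A : ConvexBody V)
    (h0 : (A : Set V) ∈ nhds 0) {v : V} (hev : e v = (1, 0)) :
    ∫⁻ x, ENNReal.ofReal |fderiv ℝ (coneFn (A : Set V)) x v| ∂μ =
      ENNReal.ofReal (2 / finrank ℝ V * shadow μ A v) := by
  set f := coneFn (A : Set V) with hf
  have hfin := finrank_of_equiv_prod e
  obtain ⟨K, hK⟩ := exists_lipschitzWith_coneFn A.convex h0
  have hmeas : Measurable fun x => ENNReal.ofReal |fderiv ℝ f x v| := by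
    have := measurable_fderiv_apply_const ℝ f v
    fun_prop
  have hmeas' : Measurable fun p : ℝ × E => ENNReal.ofReal |fderiv ℝ f (e.symm p) v| :=
    hmeas.comp e.symm.continuous.measurable
  have hline : ∀ (y : E) (s t : ℝ), e.symm (s, y) + (t - s) • v = e.symm (t, y) := fun y s t => by
    apply e.injective
    simp [hev]
  obtain ⟨R, hR⟩ := (A.isCompact.image (continuous_fst.comp e.continuous)).isBounded.subset_closedBall 0
  choose m hm1 hm2 using fun y : E => exists_lintegral_abs_deriv_eq (φ := fun t => f (e.symm (t, y)))
    (hK.comp ((e.symm : ℝ × E →L[ℝ] V).lipschitz.comp (LipschitzWith.prodMk_right y)))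
    (fun t => coneFn_nonneg _ _) (fun x z w hxz hzw => by
      rcases hxz.trans hzw |>.eq_or_lt with h | h
      · obtain rfl : z = x := by linarith
        exact min_le_left _ _
      · obtain ⟨a, b, ha, hb, hab, hz⟩ : ∃ a b : ℝ, 0 ≤ a ∧ 0 ≤ b ∧ a + b = 1 ∧
            a • (x, y) + b • (w, y) = (z, y) := by
          have := (Convex.mem_Icc (hxz.trans hzw)).1 ⟨hxz, hzw⟩
          obtain ⟨a, b, ha, hb, hab, hz⟩ := this
          refine ⟨a, b, ha, hb, hab, ?_⟩
          ext <;> simp [hz, ← add_smul, hab]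
        have := min_le_coneFn A.convex h0 (x := e.symm (x, y)) (y := e.symm (w, y)) ha hb hab
        rwa [← map_smul, ← map_smul, ← map_add, hz] at this) (R := R) (fun t ht => by
      have : e.symm (t, y) ∈ (A : Set V) := by
        by_contra h
        exact ht (coneFn_eq_zero A.convex h0 h)
      simpa using hR ⟨_, this, rfl⟩)
  set M : E → ℝ := fun y => f (e.symm (m y, y)) with hM
  have hdiff : ∀ᵐ p ∂((volume : Measure ℝ).prod ν), DifferentiableAt ℝ f (e.symm p) := by
    have h1 := hK.ae_differentiableAt (μ := μ)
    have h2 : ∀ᵐ x ∂μ, DifferentiableAt ℝ f (e.symm (e x)) := by simpa using h1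
    have hms : MeasurableSet {p | DifferentiableAt ℝ f (e.symm p)} :=
      e.symm.continuous.measurable (measurableSet_of_differentiableAt ℝ f)
    rw [← he.map_eq]
    exact (ae_map_iff he.measurable.aemeasurable hms).2 h2
  have hinner : ∀ᵐ y ∂ν, ∫⁻ t, ENNReal.ofReal |fderiv ℝ f (e.symm (t, y)) v| =
      ENNReal.ofReal (2 * M y) := by
    have h3 : ∀ᵐ y ∂ν, ∀ᵐ t : ℝ, DifferentiableAt ℝ f (e.symm (t, y)) := by
      have := (Measure.measurePreserving_swap (μ := ν)
        (ν := (volume : Measure ℝ))).quasiMeasurePreserving.ae hdiff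
      exact Measure.ae_ae_of_ae_prod this
    filter_upwards [h3] with y hy
    rw [← hm2 y]
    refine lintegral_congr_ae ?_
    filter_upwards [hy] with t ht
    have hd : HasDerivAt (fun s : ℝ => e.symm (s, y)) v t := by
      have h4 : HasDerivAt (fun s : ℝ => e.symm (t, y) + (s - t) • v) ((1 : ℝ) • v) t :=
        (((hasDerivAt_id t).sub_const t).smul_const v).const_add _
      simp only [hline, one_smul] at h4
      exact h4
    have h5 : HasDerivAt (fun s => f (e.symm (s, y))) (fderiv ℝ f (e.symm (t, y)) v) t :=
      HasFDerivAt.comp_hasDerivAt (f := fun s : ℝ => e.symm (s, y)) t ht.hasFDerivAt hd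
    rw [h5.deriv]
  have hfub : ∫⁻ x, ENNReal.ofReal |fderiv ℝ f x v| ∂μ = ∫⁻ y, ENNReal.ofReal (2 * M y) ∂ν := by
    have e1 : ∫⁻ x, ENNReal.ofReal |fderiv ℝ f x v| ∂μ =
        ∫⁻ p, ENNReal.ofReal |fderiv ℝ f (e.symm p) v| ∂((volume : Measure ℝ).prod ν) := by
      rw [← he.lintegral_comp hmeas']
      simp
    rw [e1, lintegral_prod_symm' _ hmeas']
    exact lintegral_congr_ae hinner
  have hMm : AEMeasurable M ν := by
    refine ⟨fun y => (∫⁻ t, ENNReal.ofReal |fderiv ℝ f (e.symm (t, y)) v|).toReal / 2,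
      (hmeas'.lintegral_prod_left').ennreal_toReal.div_const 2, ?_⟩
    filter_upwards [hinner] with y hy
    rw [hy, ENNReal.toReal_ofReal (mul_nonneg zero_le_two (coneFn_nonneg _ _))]
    ring
  have hlevel : ∀ s ∈ Set.Ioi (0 : ℝ), ν {y | s ≤ M y} = (Set.Ioc (0 : ℝ) 1).indicator (fun s =>
      ENNReal.ofReal ((1 - s) ^ finrank ℝ E) * ν (mapBody (projMap e) A : Set E)) s := by
    intro s hs
    by_cases hs1 : s ≤ 1
    · rw [Set.indicator_of_mem (show s ∈ Set.Ioc (0 : ℝ) 1 from ⟨hs, hs1⟩)]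
      have hset : {y | s ≤ M y} = (1 - s) • (mapBody (projMap e) A : Set E) := by
        rw [← ConvexBody.coe_smul, ← mapBody_smul]
        ext y
        constructor
        · intro hy
          exact ⟨_, (le_coneFn_iff A.convex A.isCompact h0 hs hs1).1 hy, by simp [projMap]⟩
        · rintro ⟨x, hx, rfl⟩
          refine ((le_coneFn_iff A.convex A.isCompact h0 hs hs1).2 hx).trans ?_
          have := hm1 (projMap e x) (e x).1
          simpa [projMap] using this
      rw [hset, Measure.addHaar_smul, abs_of_nonneg (pow_nonneg (by linarith) _)]
    · rw [Set.indicator_of_notMem (fun h : s ∈ Set.Ioc (0 : ℝ) 1 => hs1 h.2)]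
      convert measure_empty (μ := ν)
      ext y
      simp only [Set.mem_ofPred_eq, Set.mem_empty_iff_false, iff_false, not_le]
      exact (coneFn_le_one _ _).trans_lt (not_le.1 hs1)
  have hpow : ∫⁻ s in Set.Ioc (0 : ℝ) 1, ENNReal.ofReal ((1 - s) ^ finrank ℝ E) =
      ENNReal.ofReal (1 / (finrank ℝ E + 1)) := by
    rw [← ofReal_integral_eq_lintegral_ofReal
      ((Continuous.integrableOn_Icc (by fun_prop)).mono_set Set.Ioc_subset_Icc_self)
      ((ae_restrict_iff' measurableSet_Ioc).2 (Filter.Eventually.of_forall fun s hs =>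
        pow_nonneg (sub_nonneg.2 hs.2) _)), ← intervalIntegral.integral_of_le zero_le_one,
      intervalIntegral.integral_comp_sub_left (fun s => s ^ finrank ℝ E) 1]
    simp
  have hM2 : ∀ y, ENNReal.ofReal (2 * M y) = ENNReal.ofReal 2 * ENNReal.ofReal (M y) := fun y =>
    ENNReal.ofReal_mul zero_le_two
  rw [hfub, lintegral_congr hM2, lintegral_const_mul' _ _ ENNReal.ofReal_ne_top,
    lintegral_eq_lintegral_meas_le ν (Filter.Eventually.of_forall fun y => coneFn_nonneg _ _) hMm,
    setLIntegral_congr_fun measurableSet_Ioi hlevel, lintegral_indicator measurableSet_Ioc,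
    Measure.restrict_restrict measurableSet_Ioc, Set.inter_eq_left.2 (fun x hx => hx.1),
    lintegral_mul_const _ (by fun_prop), hpow, shadow_eq he hev, hfin,
    ← ofReal_measureReal (measure_convexBody_lt_top ν _).ne, ← ENNReal.ofReal_mul (by positivity),
    ← ENNReal.ofReal_mul (by positivity)]
  push_cast
  congr 1
  ring

theorem lintegral_abs_fderiv_coneFn (μ : Measure V) [μ.IsAddHaarMeasure] (A : ConvexBody V)
    (h0 : (A : Set V) ∈ nhds 0) (v : V) :
    ∫⁻ x, ENNReal.ofReal |fderiv ℝ (coneFn (A : Set V)) x v| ∂μ =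
      ENNReal.ofReal (2 / finrank ℝ V * shadow μ A v) := by
  rcases eq_or_ne v 0 with rfl | hv
  · simp [shadow_zero]
  obtain ⟨u, e, ν, hν, hev, he⟩ := exists_split_measurePreserving μ hv
  exact lintegral_abs_fderiv_coneFn_of_split he A h0 hev

theorem shadow_add_pointBody (μ : Measure V) [μ.IsAddHaarMeasure] (A : ConvexBody V) (x v : V) :
    shadow μ (A + pointBody x) v = shadow μ A v := by
  rw [shadow, shadow, add_right_comm, measureReal_add_pointBody, measureReal_add_pointBody]

/-- The shadow function of a convex body with nonempty interior is the support function of a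
zonoid. -/
theorem exists_shadow_eq_integral (μ : Measure V) [μ.IsAddHaarMeasure] (A : ConvexBody V)
    (hA : (interior (A : Set V)).Nonempty) :
    ∃ F : V → StrongDual ℝ V, Integrable F μ ∧
      ∀ v, shadow μ A v = 1 / 2 * ∫ x, |F x v| ∂μ := by
  obtain ⟨x₀, hx₀⟩ := hA
  -- The gauge requires 0 in the interior, and the shadow is translation invariant.
  set A' := A + pointBody (-x₀) with hA'
  have h0 : (A' : Set V) ∈ nhds 0 := by
    have h1 : (A' : Set V) = (fun y => y + x₀) ⁻¹' A := by
      change (A : Set V) + {-x₀} = _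
      rw [Set.add_singleton, Set.image_add_right, neg_neg]
    rw [h1]
    refine (continuous_add_const x₀).continuousAt.preimage_mem_nhds ?_
    simpa using mem_interior_iff_mem_nhds.1 hx₀
  -- The factor n cancels the n in 2/n, leaving the normalization ½ ∫ |F x v|.
  refine ⟨fun x => (finrank ℝ V : ℝ) • fderiv ℝ (coneFn (A' : Set V)) x,
    (integrable_fderiv_coneFn μ A'.convex A'.isCompact h0).smul (finrank ℝ V : ℝ), fun v => ?_⟩
  have h1 := lintegral_abs_fderiv_coneFn μ A' h0 v
  rw [shadow_add_pointBody] at h1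
  have hi := (integrable_fderiv_coneFn μ A'.convex A'.isCompact h0).apply_continuousLinearMap v
  rw [← ofReal_integral_eq_lintegral_ofReal hi.abs
    (Filter.Eventually.of_forall fun x => abs_nonneg _), ENNReal.ofReal_eq_ofReal_iff
    (integral_nonneg fun x => abs_nonneg _) (mul_nonneg (by positivity) (shadow_nonneg μ A v))] at h1
  have h2 : ∀ x, |((finrank ℝ V : ℝ) • fderiv ℝ (coneFn (A' : Set V)) x) v| =
      finrank ℝ V * |fderiv ℝ (coneFn (A' : Set V)) x v| := fun x => by
    simp [abs_mul]
  simp only [h2]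
  rw [integral_const_mul, h1]
  rcases Nat.eq_zero_or_pos (finrank ℝ V) with hf | hf
  · have : Subsingleton V := finrank_zero_iff.1 hf
    rw [Subsingleton.elim v 0, shadow_zero]
    simp
  · have : (finrank ℝ V : ℝ) ≠ 0 := by positivity
    field_simp

end Gauge

/-! ### Minkowski's first inequality for a body and a zonoid, with equality case. -/

section Minkowski

variable {V : Type*} [NormedAddCommGroup V] [NormedSpace ℝ V] [FiniteDimensional ℝ V]
  [MeasurableSpace V] [BorelSpace V] {X : Type*} [MeasurableSpace X]

/-- The integral representation gives the Lipschitz constant ½ ∫ ‖F‖. -/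
theorem exists_isLipschitzGauge_shadow (μ : Measure V) [μ.IsAddHaarMeasure] (A : ConvexBody V)
    (hA : (interior (A : Set V)).Nonempty) : ∃ C, IsLipschitzGauge (shadow μ A) C := by
  obtain ⟨F, hF, hS⟩ := exists_shadow_eq_integral μ A hA
  have hi : ∀ v, Integrable (fun x => |F x v|) μ := fun v =>
    (hF.apply_continuousLinearMap v).abs
  refine ⟨1 / 2 * ∫ x, ‖F x‖ ∂μ, by positivity, shadow_smul μ A, fun v w => ?_⟩
  rw [hS, hS, ← mul_sub, ← integral_sub (hi v) (hi w), abs_mul, abs_of_pos (by norm_num), mul_assoc,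
    ← integral_mul_const]
  refine mul_le_mul_of_nonneg_left (abs_integral_le_integral_abs.trans (integral_mono_of_nonneg
    (Filter.Eventually.of_forall fun x => abs_nonneg _) (hF.norm.mul_const _)
    (Filter.Eventually.of_forall fun x => ?_))) (by norm_num)
  refine (abs_abs_sub_abs_le _ _).trans ?_
  rw [← map_sub]
  exact (F x).le_opNorm _

theorem IsZonoidOf.smul {ρ : Measure X} {F : X → V} {Z : ConvexBody V} (hZ : IsZonoidOf ρ F Z)
    {t : ℝ} (ht : 0 ≤ t) : IsZonoidOf ρ (fun x => t • F x) (t • Z) := by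
  refine ⟨hZ.1.smul t, fun u => ?_⟩
  rw [supportFn_smul ht, hZ.2]
  simp only [map_smul, smul_eq_mul, abs_mul, abs_of_nonneg ht]
  rw [integral_const_mul]
  ring

variable (μ : Measure V) [μ.IsAddHaarMeasure] {d : ℕ} {ρ : Measure X} {F : X → V}
  {A Z : ConvexBody V}

theorem measureReal_le_measureReal_mean (h : μ.real (A : Set V) = μ.real (Z : Set V)) :
    μ.real (A : Set V) ≤
      μ.real (((1 - (1 / 2 : ℝ)) • A + (1 / 2 : ℝ) • Z : ConvexBody V) : Set V) := by
  rcases (measureReal_nonneg (μ := μ) (s := (A : Set V))).eq_or_lt with h0 | h0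
  · rw [← h0]; exact measureReal_nonneg
  have := measure_rpow_mul_le μ (t := 1 / 2) (by norm_num) (by norm_num) A.isCompact Z.isCompact
    ((1 - (1 / 2 : ℝ)) • A + (1 / 2 : ℝ) • Z : ConvexBody V).isCompact A.nonempty Z.nonempty
    subset_rfl
  rwa [← h, ← Real.rpow_add h0, sub_add_cancel, Real.rpow_one] at this

/-- A quantitative form of Minkowski's first inequality, for a body and a zonoid of the same
volume. -/
theorem IsZonoidOf.log_mean_le (hZ : IsZonoidOf ρ F Z) (hd : finrank ℝ V = d + 1) (hd1 : 1 ≤ d)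
    (hA : (interior (A : Set V)).Nonempty) (h : μ.real (A : Set V) = μ.real (Z : Set V)) :
    2 * μ.real (A : Set V) * Real.log (μ.real (((1 - (1 / 2 : ℝ)) • A + (1 / 2 : ℝ) • Z :
      ConvexBody V) : Set V) / μ.real (A : Set V)) ≤
      ∫ x, shadow μ A (F x) ∂ρ - (d + 1) * μ.real (A : Set V) := by
  obtain ⟨C, hC⟩ := exists_isLipschitzGauge_shadow μ A hA
  have hm := measureReal_pos_of_interior μ hA
  have hq := measureReal_le_measureReal_mean μ h
  set m := μ.real (A : Set V) with hmdef
  set N : ConvexBody V := (1 - (1 / 2 : ℝ)) • A + (1 / 2 : ℝ) • Z with hN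
  set q := μ.real (N : Set V) with hqdef
  set c := ∫ x, shadow μ A (F x) ∂ρ with hc
  set K := μ.real ((A + Z : ConvexBody V) : Set V) with hK
  have hq0 : 0 < q := hm.trans_le hq
  -- An upper bound for vol((1 - s)A + sZ): the bound for vol(aA + Z) at a = (1 - s)/s, multiplied
  -- by s^(d+1). Since d ≥ 1, its error term is of second order in s and does not contribute to the
  -- derivative at 0.
  set G : ℝ → ℝ := fun s => (1 - s) ^ (d + 1) * m + s * (1 - s) ^ d * c +
    s ^ 2 * (1 - s) ^ (d - 1) * K with hG
  have hGd : HasDerivAt G (c - (d + 1) * m) 0 := by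
    have h1 : HasDerivAt (fun s : ℝ => 1 - s) (-1) 0 := by
      simpa using (hasDerivAt_id (0 : ℝ)).const_sub 1
    have h2 := ((h1.pow (d + 1)).mul_const m).add
      (((hasDerivAt_id (0 : ℝ)).mul (h1.pow d)).mul_const c) |>.add
      (((((hasDerivAt_id (0 : ℝ)).pow 2).mul (h1.pow (d - 1)))).mul_const K)
    refine h2.congr_deriv ?_
    simp
    ring
  have hG0 : G 0 = m := by simp [hG]
  -- By convexity of A, (1 - 2s)A + 2sN lies in (1 - s)A + sZ, where N is the mean of A and Z.
  -- Brunn–Minkowski then bounds the volume below by m (q/m)^(2s) ≥ m (1 + 2s log(q/m)); compare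
  -- with G and let s tend to 0.
  have hmain : ∀ s ∈ Set.Ioo (0 : ℝ) (1 / 2), 2 * m * Real.log (q / m) ≤ s⁻¹ • (G (0 + s) - G 0) := by
    rintro s ⟨hs, hs2⟩
    have hlow : m ^ (1 - 2 * s) * q ^ (2 * s) ≤
        μ.real (((1 - s) • A + s • Z : ConvexBody V) : Set V) := by
      refine measure_rpow_mul_le μ (t := 2 * s) (by linarith) (by linarith) A.isCompact N.isCompact
        (ConvexBody.isCompact _) A.nonempty N.nonempty ?_
      rintro _ ⟨_, ⟨x, hx, rfl⟩, _, ⟨_, ⟨_, ⟨y, hy, rfl⟩, _, ⟨z, hz, rfl⟩, rfl⟩, rfl⟩, rfl⟩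
      have hs1 : 0 < 1 - s := by linarith
      have hw : ((1 - 2 * s) / (1 - s)) • x + (s / (1 - s)) • y ∈ A :=
        A.convex hx hy (div_nonneg (by linarith) hs1.le) (by positivity) (by field_simp; ring)
      refine ⟨_, Set.smul_mem_smul_set hw, _, Set.smul_mem_smul_set hz, ?_⟩
      simp only [smul_add, smul_smul]
      rw [mul_div_cancel₀ _ hs1.ne', mul_div_cancel₀ _ hs1.ne', add_assoc]
      congr 3 <;> ring_nf
    have hup : μ.real (((1 - s) • A + s • Z : ConvexBody V) : Set V) ≤ G s := by
      have ha : 1 ≤ (1 - s) / s := by rw [le_div_iff₀ hs]; linarith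
      have h1 := (hZ.measureReal_smul_add_bounds μ hd hC ha).2
      have h2 : (1 - s) • A + s • Z = s • (((1 - s) / s) • A + Z) := by
        rw [smul_add, smul_smul, mul_div_cancel₀ _ hs.ne']
      rw [h2, measureReal_smul μ hs.le, hd]
      refine (mul_le_mul_of_nonneg_left h1 (by positivity)).trans_eq ?_
      obtain ⟨k, rfl⟩ : ∃ k, d = k + 1 := ⟨d - 1, by omega⟩
      simp only [hG, Nat.add_sub_cancel, div_pow]
      field_simp
      ring
    have hexp : m * (1 + 2 * s * Real.log (q / m)) ≤ m ^ (1 - 2 * s) * q ^ (2 * s) := by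
      have e1 : m ^ (1 - 2 * s) * q ^ (2 * s) = m * (q / m) ^ (2 * s) := by
        rw [Real.rpow_sub hm, Real.rpow_one, Real.div_rpow hq0.le hm.le]
        ring
      rw [e1, Real.rpow_def_of_pos (by positivity)]
      refine mul_le_mul_of_nonneg_left ?_ hm.le
      have := Real.add_one_le_exp (Real.log (q / m) * (2 * s))
      linarith
    rw [zero_add, hG0, smul_eq_mul, inv_mul_eq_div, le_div_iff₀ hs]
    linarith
  refine ge_of_tendsto hGd.tendsto_slope_zero_right ?_
  filter_upwards [Ioo_mem_nhdsGT (show (0 : ℝ) < 1 / 2 by norm_num)] with s hs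
  exact hmain s hs

theorem IsZonoidOf.le_integral_shadow_of_eq (hZ : IsZonoidOf ρ F Z) (hd : finrank ℝ V = d + 1)
    (hd1 : 1 ≤ d) (hA : (interior (A : Set V)).Nonempty)
    (h : μ.real (A : Set V) = μ.real (Z : Set V)) :
    (d + 1) * μ.real (A : Set V) ≤ ∫ x, shadow μ A (F x) ∂ρ := by
  have h1 := hZ.log_mean_le μ hd hd1 hA h
  have hm := measureReal_pos_of_interior μ hA
  have h2 := Real.log_nonneg ((one_le_div hm).2 (measureReal_le_measureReal_mean μ h))
  nlinarith

theorem IsZonoidOf.exists_eq_vadd_of_eq (hZ : IsZonoidOf ρ F Z) (hd : finrank ℝ V = d + 1)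
    (hd1 : 1 ≤ d) (hA : (interior (A : Set V)).Nonempty)
    (h : μ.real (A : Set V) = μ.real (Z : Set V))
    (heq : ∫ x, shadow μ A (F x) ∂ρ ≤ (d + 1) * μ.real (A : Set V)) :
    ∃ x : V, (A : Set V) = x +ᵥ (Z : Set V) := by
  have h1 := hZ.log_mean_le μ hd hd1 hA h
  have hm := measureReal_pos_of_interior μ hA
  have h2 := measureReal_le_measureReal_mean μ h
  refine exists_eq_vadd_of_measure_mean_le μ A.isCompact A.convex hA Z.isCompact Z.convex
    (interior_nonempty_of_measureReal_ne_zero μ (h ▸ hm.ne')) h ?_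
  by_contra! hlt
  have h3 := Real.log_pos ((one_lt_div hm).2 hlt)
  have h4 : 0 < 2 * μ.real (A : Set V) * Real.log (μ.real (((1 - (1 / 2 : ℝ)) • (A : Set V) +
    (1 / 2 : ℝ) • (Z : Set V)) : Set V) / μ.real (A : Set V)) := by positivity
  have h5 : (((1 - (1 / 2 : ℝ)) • A + (1 / 2 : ℝ) • Z : ConvexBody V) : Set V) =
    (1 - (1 / 2 : ℝ)) • (A : Set V) + (1 / 2 : ℝ) • (Z : Set V) := rfl
  rw [h5] at h1
  linarith

theorem exists_scale (hd : finrank ℝ V = d + 1) (hA : (interior (A : Set V)).Nonempty)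
    (hZ : 0 < μ.real (Z : Set V)) : ∃ t : ℝ, 0 < t ∧
      t ^ (d + 1) * μ.real (Z : Set V) = μ.real (A : Set V) ∧
      μ.real (A : Set V) = μ.real ((t • Z : ConvexBody V) : Set V) := by
  have hm := measureReal_pos_of_interior μ hA
  have ht : ((μ.real (A : Set V) / μ.real (Z : Set V)) ^ (((d + 1 : ℕ) : ℝ)⁻¹)) ^ (d + 1) =
      μ.real (A : Set V) / μ.real (Z : Set V) :=
    Real.rpow_inv_natCast_pow (by positivity) (by omega)
  have h1 : ((μ.real (A : Set V) / μ.real (Z : Set V)) ^ (((d + 1 : ℕ) : ℝ)⁻¹)) ^ (d + 1) *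
      μ.real (Z : Set V) = μ.real (A : Set V) := by
    rw [ht]; field_simp
  refine ⟨_, by positivity, h1, ?_⟩
  rw [measureReal_smul μ (by positivity), hd, h1]

/-- Minkowski's first inequality for a convex body and a zonoid, normalized. -/
theorem IsZonoidOf.measureReal_mul_pow_le_one (hZ : IsZonoidOf ρ F Z) (hd : finrank ℝ V = d + 1)
    (hd1 : 1 ≤ d) (hA : (interior (A : Set V)).Nonempty)
    (hc : ∫ x, shadow μ A (F x) ∂ρ = d + 1) :
    μ.real (Z : Set V) * μ.real (A : Set V) ^ d ≤ 1 := by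
  have hm := measureReal_pos_of_interior μ hA
  rcases (measureReal_nonneg (μ := μ) (s := (Z : Set V))).eq_or_lt with h0 | h0
  · rw [← h0]; simp
  obtain ⟨t, ht, ht1, ht2⟩ := exists_scale μ hd hA h0
  -- For t Z, which has the volume of A, the inequality reads (d + 1) vol A ≤ t (d + 1). So vol A ≤
  -- t, and t is known from t^(d+1) vol Z = vol A.
  have h1 := (hZ.smul ht.le).le_integral_shadow_of_eq μ hd hd1 hA ht2
  simp only [shadow_smul, abs_of_pos ht] at h1
  rw [integral_const_mul, hc, mul_comm] at h1
  have h2 : μ.real (A : Set V) ≤ t := le_of_mul_le_mul_right h1 (by positivity)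
  have h3 : μ.real (A : Set V) ^ (d + 1) ≤ t ^ (d + 1) := pow_le_pow_left₀ hm.le h2 _
  have h4 : μ.real (A : Set V) ^ (d + 1) * μ.real (Z : Set V) ≤ μ.real (A : Set V) :=
    (mul_le_mul_of_nonneg_right h3 h0.le).trans ht1.le
  rw [pow_succ] at h4
  have : (μ.real (Z : Set V) * μ.real (A : Set V) ^ d) * μ.real (A : Set V) ≤
      1 * μ.real (A : Set V) := by linarith
  exact le_of_mul_le_mul_right this hm

/-- The equality case of Minkowski's first inequality for a convex body and a zonoid. -/
theorem IsZonoidOf.exists_eq_vadd_smul (hZ : IsZonoidOf ρ F Z) (hd : finrank ℝ V = d + 1)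
    (hd1 : 1 ≤ d) (hA : (interior (A : Set V)).Nonempty)
    (hc : ∫ x, shadow μ A (F x) ∂ρ = d + 1)
    (heq : 1 ≤ μ.real (Z : Set V) * μ.real (A : Set V) ^ d) :
    ∃ t : ℝ, 0 < t ∧ ∃ x : V, (A : Set V) = x +ᵥ t • (Z : Set V) := by
  have hm := measureReal_pos_of_interior μ hA
  have h0 : 0 < μ.real (Z : Set V) := by
    rcases (measureReal_nonneg (μ := μ) (s := (Z : Set V))).eq_or_lt with h0 | h0
    · rw [← h0, zero_mul] at heq; linarith
    · exact h0
  obtain ⟨t, ht, ht1, ht2⟩ := exists_scale μ hd hA h0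
  refine ⟨t, ht, (hZ.smul ht.le).exists_eq_vadd_of_eq μ hd hd1 hA ht2 ?_⟩
  simp only [shadow_smul, abs_of_pos ht]
  rw [integral_const_mul, hc, mul_comm]
  refine mul_le_mul_of_nonneg_left ?_ (by positivity)
  have h4 : t ^ (d + 1) * μ.real (Z : Set V) ≤ μ.real (A : Set V) ^ (d + 1) * μ.real (Z : Set V) := by
    rw [ht1, pow_succ]
    nlinarith
  exact le_of_pow_le_pow_left₀ (by omega) hm.le (le_of_mul_le_mul_right h4 h0)

end Minkowski

theorem isCompact_parallelepiped {ι E : Type*} [Fintype ι] [AddCommGroup E] [Module ℝ E]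
    [TopologicalSpace E] [IsTopologicalAddGroup E] [ContinuousSMul ℝ E] (v : ι → E) :
    IsCompact (parallelepiped v) :=
  isCompact_Icc.image (by fun_prop)

/-! ### Measures induced by volume forms, and the bidual. -/

section VolumeForms

variable {V : Type*} [NormedAddCommGroup V] [NormedSpace ℝ V] [FiniteDimensional ℝ V]
  [MeasurableSpace V] [BorelSpace V] {n : ℕ} [hn : Fact (finrank ℝ V = n)]

theorem isAddHaarMeasure_measure {Ω : V [⋀^Fin n]→ₗ[ℝ] ℝ} (hΩ : Ω ≠ 0) :
    Ω.measure.IsAddHaarMeasure := by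
  have h0 : Ω (finBasisOfFinrankEq ℝ V hn.out) ≠ 0 :=
    (AlternatingMap.map_basis_ne_zero_iff _ Ω).2 hΩ
  have h1 : Ω.measure = ((‖Ω (finBasisOfFinrankEq ℝ V hn.out)‖₊ : NNReal) : ℝ≥0∞) •
      (finBasisOfFinrankEq ℝ V hn.out).addHaar := by
    rw [AlternatingMap.measure]; rfl
  rw [h1]
  exact Measure.IsAddHaarMeasure.smul _ (by simpa using h0) (by simp)

theorem eq_measure_of_parallelepiped (Ω : V [⋀^Fin n]→ₗ[ℝ] ℝ) (ν : Measure V)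
    [ν.IsAddHaarMeasure]
    (h : ∀ v : Fin n → V, ν (parallelepiped v) = ENNReal.ofReal |Ω v|) : ν = Ω.measure := by
  set b := finBasisOfFinrankEq ℝ V hn.out
  rw [Measure.addHaarMeasure_unique ν b.parallelepiped,
    Measure.addHaarMeasure_unique Ω.measure b.parallelepiped, Basis.coe_parallelepiped, h,
    AlternatingMap.measure_parallelepiped]

theorem measurePreserving_of_compLinearMap {W : Type*} [NormedAddCommGroup W] [NormedSpace ℝ W]
    [FiniteDimensional ℝ W] [MeasurableSpace W] [BorelSpace W] [Fact (finrank ℝ W = n)]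
    {Ω : V [⋀^Fin n]→ₗ[ℝ] ℝ} (hΩ : Ω ≠ 0) {Θ : W [⋀^Fin n]→ₗ[ℝ] ℝ} (e : V ≃L[ℝ] W)
    (h : ∀ v : Fin n → V, Θ (fun i => e (v i)) = Ω v) :
    MeasurePreserving e Ω.measure Θ.measure := by
  have := isAddHaarMeasure_measure hΩ
  refine ⟨e.continuous.measurable, ?_⟩
  have h1 : (Ω.measure.map e).IsAddHaarMeasure := e.isAddHaarMeasure_map Ω.measure
  refine eq_measure_of_parallelepiped Θ _ fun w => ?_
  have h2 : e ⁻¹' parallelepiped w = parallelepiped fun i => e.symm (w i) := by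
    rw [← e.image_symm_eq_preimage]
    exact image_parallelepiped (e.symm : W →ₗ[ℝ] V) w
  rw [Measure.map_apply_of_aemeasurable e.continuous.measurable.aemeasurable
    (isCompact_parallelepiped w).measurableSet, h2, AlternatingMap.measure_parallelepiped, ← h]
  simp

theorem dualForm_ne_zero {Ω : V [⋀^Fin n]→ₗ[ℝ] ℝ} (hΩ : Ω ≠ 0) : dualForm Ω ≠ 0 := by
  intro h0
  set b := finBasisOfFinrankEq ℝ V hn.out
  have := dualForm_mul Ω hΩ (fun i => (b.coord i).toContinuousLinearMap) b
  have h1 : (Matrix.of fun i j => (b.coord i).toContinuousLinearMap (b j)) =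
      (1 : Matrix (Fin n) (Fin n) ℝ) := by
    ext i j
    simp [Matrix.one_apply, Finsupp.single_apply, eq_comm]
  rw [h1, h0] at this
  simp at this

/-- The canonical isomorphism `V ≅ V**`. -/
def bidual (V : Type*) [NormedAddCommGroup V] [NormedSpace ℝ V] [FiniteDimensional ℝ V] :
    V ≃L[ℝ] StrongDual ℝ (StrongDual ℝ V) :=
  (LinearEquiv.ofInjectiveOfFinrankEq (NormedSpace.inclusionInDoubleDual ℝ V).toLinearMap
    (NormedSpace.inclusionInDoubleDualLi ℝ (E := V)).injective
    (by
      have := finrank_strongDual (V := V) (h := ⟨rfl⟩)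
      exact (finrank_strongDual (V := StrongDual ℝ V) (h := this)).out.symm)).toContinuousLinearEquiv

theorem bidual_apply (v : V) (u : StrongDual ℝ V) : bidual V v u = u v := rfl

theorem coe_bidual : ⇑(bidual V) = NormedSpace.inclusionInDoubleDual ℝ V := rfl

theorem apply_eq_apply_bidual_symm (η : StrongDual ℝ (StrongDual ℝ V)) (u : StrongDual ℝ V) :
    η u = u ((bidual V).symm η) := by
  conv_lhs => rw [← (bidual V).apply_symm_apply η]
  rfl

/-- Applying `dualForm_mul` to Ω and to its dual form gives transposed determinants; a nonzero value
of the dual form is then cancelled. -/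
theorem dualForm_dualForm_bidual {Ω : V [⋀^Fin n]→ₗ[ℝ] ℝ} (hΩ : Ω ≠ 0) (v : Fin n → V) :
    dualForm (dualForm Ω) (fun i => bidual V (v i)) = Ω v := by
  obtain ⟨ξ, hξ⟩ : ∃ ξ, dualForm Ω ξ ≠ 0 := by
    by_contra! h
    exact dualForm_ne_zero hΩ (AlternatingMap.ext h)
  have h1 := dualForm_mul Ω hΩ ξ v
  have h2 := dualForm_mul (dualForm Ω) (dualForm_ne_zero hΩ) (fun i => bidual V (v i)) ξ
  refine mul_right_cancel₀ hξ ?_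
  rw [h2, mul_comm, h1, ← Matrix.det_transpose]
  rfl

theorem measurePreserving_bidual {Ω : V [⋀^Fin n]→ₗ[ℝ] ℝ} (hΩ : Ω ≠ 0) :
    MeasurePreserving (bidual V) Ω.measure (dualForm (dualForm Ω)).measure :=
  measurePreserving_of_compLinearMap hΩ _ (dualForm_dualForm_bidual hΩ)

end VolumeForms

/-! ### The quotient definition of projection volume against the swept volume. -/

section ShadowVolume

variable {V : Type*} [NormedAddCommGroup V] [NormedSpace ℝ V] [FiniteDimensional ℝ V]

theorem exists_quotient_split {v : V} (hv : v ≠ 0)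
    [IsClosed (Submodule.span ℝ {v} : Set V)] :
    ∃ e : V ≃L[ℝ] ℝ × (V ⧸ Submodule.span ℝ {v}), e v = (1, 0) ∧
      ∀ x, (e x).2 = Submodule.Quotient.mk x := by
  obtain ⟨u, hu⟩ : ∃ u : StrongDual ℝ V, u v = 1 := by
    obtain ⟨f, hf⟩ := SeparatingDual.exists_eq_one (R := ℝ) hv
    exact ⟨f, hf⟩
  have hbij : Function.Bijective
      ((u : V →ₗ[ℝ] ℝ).prod (Submodule.mkQ (Submodule.span ℝ {v}))) := by
    constructor
    · rw [injective_iff_map_eq_zero]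
      intro x hx
      have h1 : u x = 0 := congrArg Prod.fst hx
      have h2 : Submodule.Quotient.mk (p := Submodule.span ℝ {v}) x = 0 := congrArg Prod.snd hx
      rw [Submodule.Quotient.mk_eq_zero, Submodule.mem_span_singleton] at h2
      obtain ⟨c, rfl⟩ := h2
      rw [map_smul, hu, smul_eq_mul, mul_one] at h1
      rw [h1, zero_smul]
    · rintro ⟨t, q⟩
      obtain ⟨x, rfl⟩ := Submodule.Quotient.mk_surjective _ q
      refine ⟨x + (t - u x) • v, Prod.ext ?_ ?_⟩
      · simp [hu]
      · have : Submodule.Quotient.mk (p := Submodule.span ℝ {v}) v = 0 :=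
          (Submodule.Quotient.mk_eq_zero _).2 (Submodule.mem_span_singleton_self v)
        simp [this]
  refine ⟨(LinearEquiv.ofBijective _ hbij).toContinuousLinearEquiv, Prod.ext hu ?_, fun x => rfl⟩
  exact (Submodule.Quotient.mk_eq_zero _).2 (Submodule.mem_span_singleton_self v)

theorem image_parallelepiped_vecCons {Q : Type*} [AddCommGroup Q] [Module ℝ Q] {d : ℕ}
    (e : V →ₗ[ℝ] ℝ × Q) {v : V} (hv : e v = (1, 0)) {x : Fin d → V} {q : Fin d → Q}
    (hx : ∀ i, e (x i) = (0, q i)) :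
    e '' parallelepiped (Matrix.vecCons v x) = Set.Icc (0 : ℝ) 1 ×ˢ parallelepiped q := by
  rw [image_parallelepiped]
  ext ⟨s, y⟩
  simp only [mem_parallelepiped_iff, Set.mem_prod, Fin.sum_univ_succ, Function.comp_apply,
    Matrix.cons_val_zero, Matrix.cons_val_succ, hv, hx]
  constructor
  · rintro ⟨t, ht, h⟩
    have h1 := congrArg Prod.fst h
    have h2 := congrArg Prod.snd h
    simp only [Prod.fst_add, Prod.snd_add, Prod.fst_sum, Prod.snd_sum, Prod.smul_fst,
      Prod.smul_snd, smul_eq_mul, mul_one, mul_zero, Finset.sum_const_zero, add_zero, smul_zero,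
      zero_add] at h1 h2
    exact ⟨h1 ▸ ⟨ht.1 0, ht.2 0⟩, fun i => t i.succ, ⟨fun i => ht.1 _, fun i => ht.2 _⟩, h2⟩
  · rintro ⟨hs, t, ht, rfl⟩
    refine ⟨Fin.cons s t, ⟨fun i => ?_, fun i => ?_⟩, ?_⟩
    · refine Fin.cases ?_ (fun j => ?_) i
      · exact hs.1
      · exact ht.1 j
    · refine Fin.cases ?_ (fun j => ?_) i
      · exact hs.2
      · exact ht.2 j
    · refine Prod.ext ?_ ?_
      · simp [Prod.fst_sum]
      · simp [Prod.snd_sum]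

variable [MeasurableSpace V] [BorelSpace V] {d : ℕ} [hd : Fact (finrank ℝ V = d + 1)]

/-- Replaces the volume on a quotient depending on v by a difference of two volumes in V, which is
also meaningful at v = 0. -/
theorem shadowVolume_eq_shadow {Ω : V [⋀^Fin (d + 1)]→ₗ[ℝ] ℝ} (hΩ : Ω ≠ 0) (K : ConvexBody V)
    {v : V} (hv : v ≠ 0) : shadowVolume Ω K v hv = shadow Ω.measure K v := by
  have := isAddHaarMeasure_measure hΩ
  have hcl : IsClosed (Submodule.span ℝ {v} : Set V) := Submodule.closed_of_finiteDimensional _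
  let : MeasurableSpace (V ⧸ Submodule.span ℝ {v}) := borel _
  have : BorelSpace (V ⧸ Submodule.span ℝ {v}) := ⟨rfl⟩
  have : Fact (finrank ℝ (V ⧸ Submodule.span ℝ {v}) = d) := ⟨by
    have h1 := Submodule.finrank_quotient_add_finrank (Submodule.span ℝ {v})
    rw [finrank_span_singleton hv, hd.out] at h1
    omega⟩
  obtain ⟨e, hev, he⟩ := exists_quotient_split hv
  obtain ⟨ν, hν, hpres⟩ := exists_measurePreserving_prod Ω.measure e
  -- It suffices to test parallelepipeds. The product of [0, 1] with the one spanned by q pulls back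
  -- to the parallelepiped spanned by v and lifts of q, whose measure is |Ω(v, …)|.
  have hνe : ν = (contraction Ω v).measure := by
    refine eq_measure_of_parallelepiped _ _ fun q => ?_
    have hx : ∀ i, e (e.symm (0, q i)) = (0, q i) := fun i => e.apply_symm_apply _
    have h1 : e ⁻¹' (Set.Icc (0 : ℝ) 1 ×ˢ parallelepiped q) =
        parallelepiped (Matrix.vecCons v fun i => e.symm (0, q i)) := by
      rw [← image_parallelepiped_vecCons (e : V →ₗ[ℝ] _) hev hx]
      exact Set.preimage_image_eq _ e.injective
    have h2 := hpres.measure_preimage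
      (measurableSet_Icc.prod (isCompact_parallelepiped q).measurableSet).nullMeasurableSet
      (s := Set.Icc (0 : ℝ) 1 ×ˢ parallelepiped q)
    rw [h1, AlternatingMap.measure_parallelepiped, Measure.prod_prod, Real.volume_Icc, sub_zero,
      ENNReal.ofReal_one, one_mul] at h2
    rw [← h2, ← contraction_mk]
    congr 3
    ext i
    rw [← he, hx]
  rw [shadow_eq hpres hev K, hνe]
  change (contraction Ω v).measure.real _ = (contraction Ω v).measure.real _
  congr 1
  ext q
  simp only [Set.mem_image]
  constructor
  · rintro ⟨x, hx, rfl⟩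
    exact ⟨x, hx, he x⟩
  · rintro ⟨x, hx, rfl⟩
    exact ⟨x, hx, (he x).symm⟩

end ShadowVolume

/-! ### Projection bodies, their support functions, and the symmetry of V₁. -/

section ProjectionBody

variable {V : Type*} [NormedAddCommGroup V] [NormedSpace ℝ V] [FiniteDimensional ℝ V]
  [MeasurableSpace V] [BorelSpace V] {d : ℕ} [hd : Fact (finrank ℝ V = d + 1)]
  {Ω : V [⋀^Fin (d + 1)]→ₗ[ℝ] ℝ}

theorem mem_projectionBody (hΩ : Ω ≠ 0) {K : ConvexBody V} {ξ : StrongDual ℝ V} :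
    ξ ∈ projectionBody Ω K ↔ ∀ v, ξ v ≤ shadow Ω.measure K v := by
  constructor
  · intro h v
    rcases eq_or_ne v 0 with rfl | hv
    · rw [map_zero, shadow_zero]
    · rw [← shadowVolume_eq_shadow hΩ K hv]
      exact h v hv
  · intro h v hv
    rw [shadowVolume_eq_shadow hΩ K hv]
    exact h v

/-- The half-space intersection really has the shadow as its support function: the shadow is
sublinear by its integral representation, so Hahn–Banach extends t v ↦ t · shadow(v) to a functional
below it. -/
theorem supportFn_projectionBody (hΩ : Ω ≠ 0) {A : ConvexBody V}
    (hA : (interior (A : Set V)).Nonempty) (v : V) :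
    supportFn (projectionBody Ω A) (bidual V v) = shadow Ω.measure A v := by
  have := isAddHaarMeasure_measure hΩ
  obtain ⟨F, hF, hS⟩ := exists_shadow_eq_integral Ω.measure A hA
  have hi : ∀ w, Integrable (fun x => |F x w|) Ω.measure := fun w =>
    (hF.apply_continuousLinearMap w).abs
  refine le_antisymm (supportFn_le fun ξ hξ => (mem_projectionBody hΩ).1 hξ v) ?_
  rcases eq_or_ne v 0 with rfl | hv
  · rw [shadow_zero]
    have h0 : (0 : StrongDual ℝ V) ∈ projectionBody Ω A :=
      (mem_projectionBody hΩ).2 fun w => shadow_nonneg _ A w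
    exact le_supportFn _ (bidual V 0) h0
  obtain ⟨g, hg, hgS⟩ := exists_extension_of_le_sublinear
    (LinearPMap.mkSpanSingleton v (shadow Ω.measure A v) hv) (shadow Ω.measure A)
    (fun c hc x => by rw [shadow_smul, abs_of_pos hc])
    (fun x y => by
      rw [hS, hS, hS, ← mul_add, ← integral_add (hi x) (hi y)]
      refine mul_le_mul_of_nonneg_left (integral_mono (hi _) ((hi x).add (hi y)) fun z => ?_)
        (by norm_num)
      simp only [map_add]
      exact abs_add_le _ _)
    (fun ⟨x, hx⟩ => by
      obtain ⟨t, rfl⟩ := Submodule.mem_span_singleton.1 hx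
      rw [LinearPMap.mkSpanSingleton'_apply, shadow_smul]
      exact mul_le_mul_of_nonneg_right (le_abs_self t) (shadow_nonneg _ A v))
  have h1 : g v = shadow Ω.measure A v := by
    have := hg ⟨v, Submodule.mem_span_singleton_self v⟩
    rw [this]
    exact LinearPMap.mkSpanSingleton_apply ℝ ℝ hv (shadow Ω.measure A v)
  rw [← h1]
  have hmem : LinearMap.toContinuousLinearMap g ∈ projectionBody Ω A :=
    (mem_projectionBody hΩ).2 hgS
  exact le_supportFn _ (bidual V v) hmem

theorem exists_isZonoidOf_projectionBody (hΩ : Ω ≠ 0) {A : ConvexBody V}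
    (hA : (interior (A : Set V)).Nonempty) :
    ∃ F : V → StrongDual ℝ V, IsZonoidOf Ω.measure F (projectionBody Ω A) ∧
      ∀ v, shadow Ω.measure A v = 1 / 2 * ∫ x, |F x v| ∂Ω.measure := by
  have := isAddHaarMeasure_measure hΩ
  obtain ⟨F, hF, hS⟩ := exists_shadow_eq_integral Ω.measure A hA
  refine ⟨F, ⟨hF, fun η => ?_⟩, hS⟩
  obtain ⟨v, rfl⟩ := (bidual V).surjective η
  rw [supportFn_projectionBody hΩ hA, hS]
  rfl

/-- The projection body of a convex body in `V*`, as a convex body in `V`. -/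
def dualProjectionBody (Θ : StrongDual ℝ V [⋀^Fin (d + 1)]→ₗ[ℝ] ℝ)
    (L : ConvexBody (StrongDual ℝ V)) : ConvexBody V :=
  mapBody ((bidual V).symm : StrongDual ℝ (StrongDual ℝ V) →L[ℝ] V) (projectionBody Θ L)

theorem image_dualProjectionBody (Θ : StrongDual ℝ V [⋀^Fin (d + 1)]→ₗ[ℝ] ℝ)
    (L : ConvexBody (StrongDual ℝ V)) :
    bidual V '' (dualProjectionBody Θ L : Set V) = projectionBody Θ L := by
  change bidual V '' ((bidual V).symm '' (projectionBody Θ L : Set _)) = _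
  exact (bidual V).image_symm_image _

theorem mem_dualProjectionBody {Θ : StrongDual ℝ V [⋀^Fin (d + 1)]→ₗ[ℝ] ℝ} (hΘ : Θ ≠ 0)
    {L : ConvexBody (StrongDual ℝ V)} {z : V} :
    z ∈ dualProjectionBody Θ L ↔ ∀ u : StrongDual ℝ V, u z ≤ shadow Θ.measure L u := by
  have h1 : z ∈ dualProjectionBody Θ L ↔ bidual V z ∈ projectionBody Θ L := by
    constructor
    · rintro ⟨η, hη, rfl⟩
      simpa using hη
    · intro h
      exact ⟨_, h, (bidual V).symm_apply_apply z⟩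
  rw [h1, mem_projectionBody hΘ]
  rfl

theorem measure_projectionBody_dualForm (hΩ : Ω ≠ 0) (L : ConvexBody (StrongDual ℝ V)) :
    (dualForm (dualForm Ω)).measure (projectionBody (dualForm Ω) L : Set _) =
      Ω.measure (dualProjectionBody (dualForm Ω) L : Set V) := by
  rw [← image_dualProjectionBody, ← (measurePreserving_bidual hΩ).measure_preimage
    ((ConvexBody.isCompact _).image (bidual V).continuous).measurableSet.nullMeasurableSet,
    Set.preimage_image_eq _ (bidual V).injective]

theorem exists_isZonoidOf_dualProjectionBody {Θ : StrongDual ℝ V [⋀^Fin (d + 1)]→ₗ[ℝ] ℝ}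
    (hΘ : Θ ≠ 0) {L : ConvexBody (StrongDual ℝ V)}
    (hL : (interior (L : Set (StrongDual ℝ V))).Nonempty) :
    ∃ G : StrongDual ℝ V → V, IsZonoidOf Θ.measure G (dualProjectionBody Θ L) ∧
      ∀ u : StrongDual ℝ V, shadow Θ.measure L u = 1 / 2 * ∫ y, |u (G y)| ∂Θ.measure := by
  have := isAddHaarMeasure_measure hΘ
  obtain ⟨G, hG, hS⟩ := exists_isZonoidOf_projectionBody hΘ hL
  have hS' : ∀ u : StrongDual ℝ V,
      shadow Θ.measure L u = 1 / 2 * ∫ y, |u ((bidual V).symm (G y))| ∂Θ.measure := fun u => by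
    rw [hS]
    simp only [apply_eq_apply_bidual_symm]
  refine ⟨fun y => (bidual V).symm (G y),
    ⟨(bidual V).symm.toContinuousLinearMap.integrable_comp hG.1, fun u => ?_⟩, hS'⟩
  rw [← hS']
  refine le_antisymm (supportFn_le fun z hz => (mem_dualProjectionBody hΘ).1 hz u) ?_
  rw [← supportFn_projectionBody hΘ hL]
  refine supportFn_le fun η hη => ?_
  rw [bidual_apply, apply_eq_apply_bidual_symm]
  exact le_supportFn _ _ ⟨η, hη, rfl⟩

/-- Both sides equal ½ ∬ |F(x)(G(y))|, and Fubini applies because |F(x)(G(y))| ≤ ‖F(x)‖ ‖G(y)‖. -/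
theorem integral_shadow_comm {X Y : Type*} [MeasurableSpace X] [MeasurableSpace Y]
    {ρ : Measure X} {σ : Measure Y} [SFinite ρ] [SFinite σ] {F : X → StrongDual ℝ V} {G : Y → V}
    (hF : Integrable F ρ) (hG : Integrable G σ) {S : V → ℝ} {T : StrongDual ℝ V → ℝ}
    (hS : ∀ v, S v = 1 / 2 * ∫ x, |F x v| ∂ρ) (hT : ∀ u, T u = 1 / 2 * ∫ y, |u (G y)| ∂σ) :
    ∫ x, T (F x) ∂ρ = ∫ y, S (G y) ∂σ := by
  simp only [hS, hT]
  rw [integral_const_mul, integral_const_mul]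
  congr 1
  refine integral_integral_swap ?_
  refine (hF.op_fst_snd (op := fun (u : StrongDual ℝ V) v => u v) ?_ ⟨1, fun u v => ?_⟩ hG).abs
  · exact isBoundedBilinearMap_apply.continuous
  · rw [one_mul]
    exact u.le_opNorm v

/-- Both mixed volumes are integrals of a shadow along the generating field of the other projection
body, so this is the Fubini symmetry divided by n. It carries the constraint on L over to A and ΠL,
where Minkowski's inequality applies. -/
theorem mixedVolumePair_projectionBody_comm (hΩ : Ω ≠ 0) {A : ConvexBody V}
    {L : ConvexBody (StrongDual ℝ V)} (hA : (interior (A : Set V)).Nonempty)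
    (hL : (interior (L : Set (StrongDual ℝ V))).Nonempty) :
    mixedVolumePair (dualForm Ω) 1 L (projectionBody Ω A) =
      mixedVolumePair Ω 1 A (dualProjectionBody (dualForm Ω) L) := by
  have := isAddHaarMeasure_measure hΩ
  have := isAddHaarMeasure_measure (dualForm_ne_zero hΩ)
  obtain ⟨F, hF, hS⟩ := exists_isZonoidOf_projectionBody hΩ hA
  obtain ⟨G, hG, hT⟩ := exists_isZonoidOf_dualProjectionBody (dualForm_ne_zero hΩ) hL
  obtain ⟨C, hC⟩ := exists_isLipschitzGauge_shadow Ω.measure A hA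
  obtain ⟨D, hD⟩ := exists_isLipschitzGauge_shadow (dualForm Ω).measure L hL
  rw [hF.mixedVolumePair_one _ hD, hG.mixedVolumePair_one _ hC,
    integral_shadow_comm hF.1 hG.1 hS hT]

theorem IsZonoidOf.measureReal_mul_pow_le_one_of_mixedVolumePair {X : Type*} [MeasurableSpace X]
    {ρ : Measure X} {F : X → V} {A Z : ConvexBody V} (hZ : IsZonoidOf ρ F Z) (hΩ : Ω ≠ 0)
    (hd1 : 1 ≤ d) (hA : (interior (A : Set V)).Nonempty) (h : mixedVolumePair Ω 1 A Z = 1) :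
    Ω.measure.real (Z : Set V) * Ω.measure.real (A : Set V) ^ d ≤ 1 ∧
      (1 ≤ Ω.measure.real (Z : Set V) * Ω.measure.real (A : Set V) ^ d →
        IsHomothetic (A : Set V) (Z : Set V)) := by
  have := isAddHaarMeasure_measure hΩ
  obtain ⟨C, hC⟩ := exists_isLipschitzGauge_shadow Ω.measure A hA
  have h1 := hZ.mixedVolumePair_one Ω hC
  rw [h, eq_comm, div_eq_one_iff_eq (by positivity)] at h1
  exact ⟨hZ.measureReal_mul_pow_le_one _ hd.out hd1 hA h1,
    hZ.exists_eq_vadd_smul _ hd.out hd1 hA h1⟩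

/-- By convexity kP + P = (k + 1)P, and the coefficient of k^d in (k + 1)^(d+1) - k^(d+1) is d + 1.
-/
theorem mixedVolumePair_one_self (hΩ : Ω ≠ 0) (P : ConvexBody V) :
    mixedVolumePair Ω 1 P P = Ω.measure.real (P : Set V) := by
  have := isAddHaarMeasure_measure hΩ
  have h := mixedVolumePair_one_of_polynomial Ω (L := P) (C := P)
    (c := (d + 1) * Ω.measure.real (P : Set V))
    (p := fun j => (d + 1).choose j * Ω.measure.real (P : Set V)) (fun k => by
      have h1 : ((k : ℝ) • P + P : ConvexBody V) = ((k + 1 : ℝ) • P : ConvexBody V) := by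
        refine eq_of_supportFn_eq fun u => ?_
        rw [supportFn_add, supportFn_smul (by positivity), supportFn_smul (by positivity)]
        ring
      rw [h1, measureReal_smul _ (by positivity), measureReal_smul _ (by positivity), hd.out,
        add_pow, Finset.sum_range_succ, Finset.sum_range_succ]
      simp only [one_pow, mul_one, Nat.choose_self, Nat.cast_one, Nat.choose_succ_self_right]
      have h2 : ∑ j ∈ Finset.range d, ((d + 1).choose j : ℝ) * Ω.measure.real (P : Set V) * k ^ j =
          (∑ j ∈ Finset.range d, (k : ℝ) ^ j * (d + 1).choose j) * Ω.measure.real (P : Set V) := by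
        rw [Finset.sum_mul]
        exact Finset.sum_congr rfl fun _ _ => by ring
      rw [h2]
      push_cast
      ring)
  rw [h]
  field_simp

end ProjectionBody

/-! ### Bodies with empty interior have null projection bodies. -/

section Flat

variable {V : Type*} [NormedAddCommGroup V] [NormedSpace ℝ V] [FiniteDimensional ℝ V]
  [MeasurableSpace V] [BorelSpace V]

theorem measure_eq_zero_of_subset_hyperplane (μ : Measure V) [μ.IsAddHaarMeasure]
    {u : V →ₗ[ℝ] ℝ} (hu : u ≠ 0) {c : ℝ} {s : Set V} (hs : ∀ x ∈ s, u x = c) : μ s = 0 := by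
  rcases s.eq_empty_or_nonempty with rfl | ⟨x₀, hx₀⟩
  · simp
  refine measure_mono_null (t := (AffineSubspace.mk' x₀ (LinearMap.ker u) : Set V)) ?_
    (Measure.addHaar_affineSubspace μ _ fun h => hu ?_)
  · intro x hx
    rw [SetLike.mem_coe, AffineSubspace.mem_mk', vsub_eq_sub, LinearMap.mem_ker, map_sub, hs x hx,
      hs x₀ hx₀, sub_self]
  · have h1 := congrArg AffineSubspace.direction h
    rw [AffineSubspace.direction_mk', AffineSubspace.direction_top] at h1
    exact LinearMap.ker_eq_top.1 h1

/-- A convex body with empty interior has a vanishing shadow. -/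
theorem exists_shadow_eq_zero (μ : Measure V) [μ.IsAddHaarMeasure] (hd : 2 ≤ finrank ℝ V)
    {K : ConvexBody V} (hK : ¬ (interior (K : Set V)).Nonempty) :
    ∃ v ≠ 0, shadow μ K v = 0 := by
  rw [K.convex.interior_nonempty_iff_affineSpan_eq_top] at hK
  obtain ⟨x₀, hx₀⟩ := K.nonempty
  have hx₀' : x₀ ∈ affineSpan ℝ (K : Set V) := subset_affineSpan ℝ _ hx₀
  have hlt : (affineSpan ℝ (K : Set V)).direction < ⊤ := by
    refine lt_top_iff_ne_top.2 fun h => hK ?_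
    rwa [AffineSubspace.direction_eq_top_iff_of_nonempty ⟨x₀, hx₀'⟩] at h
  obtain ⟨u, hu, hle⟩ := Submodule.exists_le_ker_of_lt_top _ hlt
  have hKu : ∀ x ∈ K, u x = u x₀ := fun x hx => by
    have := hle (AffineSubspace.vsub_mem_direction (subset_affineSpan ℝ _ hx) hx₀')
    rwa [LinearMap.mem_ker, vsub_eq_sub, map_sub, sub_eq_zero] at this
  -- A direction inside the hyperplane containing K; it exists because the dimension is at least 2.
  obtain ⟨v, hv, hv0⟩ : ∃ v ∈ LinearMap.ker u, v ≠ 0 := by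
    refine (Submodule.ne_bot_iff _).1 fun h => ?_
    have h1 := u.finrank_range_add_finrank_ker
    have h2 := (LinearMap.range u).finrank_le
    rw [h, finrank_bot] at h1
    rw [finrank_self] at h2
    omega
  refine ⟨v, hv0, ?_⟩
  have h1 : μ ((K + segmentBody v : ConvexBody V) : Set V) = 0 := by
    refine measure_eq_zero_of_subset_hyperplane μ hu (c := u x₀) ?_
    rintro _ ⟨x, hx, y, hy, rfl⟩
    obtain ⟨t, -, rfl⟩ := mem_segmentBody.1 hy
    rw [LinearMap.mem_ker] at hv
    simp [hKu x hx, hv]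
  have h2 : μ (K : Set V) = 0 := measure_eq_zero_of_subset_hyperplane μ hu hKu
  rw [shadow, Measure.real, Measure.real, h1, h2, sub_self]

/-- If L had empty interior, its shadow would vanish at some u ≠ 0 and at -u, confining the
projection body to the hyperplane u = 0. -/
theorem interior_nonempty_of_measure_dualProjectionBody {d : ℕ} [hd : Fact (finrank ℝ V = d + 1)]
    (hd1 : 1 ≤ d) (μ : Measure V) [μ.IsAddHaarMeasure]
    {Θ : StrongDual ℝ V [⋀^Fin (d + 1)]→ₗ[ℝ] ℝ} (hΘ : Θ ≠ 0) {L : ConvexBody (StrongDual ℝ V)}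
    (h : μ (dualProjectionBody Θ L : Set V) ≠ 0) :
    (interior (L : Set (StrongDual ℝ V))).Nonempty := by
  have := isAddHaarMeasure_measure hΘ
  by_contra hL
  obtain ⟨u, hu, hu0⟩ := exists_shadow_eq_zero Θ.measure
    (by rw [(finrank_strongDual (V := V) (h := hd)).out]; omega) hL
  refine h (measure_eq_zero_of_subset_hyperplane μ (u := (u : V →ₗ[ℝ] ℝ)) (c := 0)
    (fun h0 => hu (ContinuousLinearMap.coe_injective h0)) fun z hz => ?_)
  rw [SetLike.mem_coe, mem_dualProjectionBody hΘ] at hz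
  have h1 := hz u
  have h2 := hz (-u)
  have h3 : shadow Θ.measure L (-u) = 0 := by
    rw [← neg_one_smul ℝ u, shadow_smul, hu0, mul_zero]
  rw [hu0] at h1
  rw [h3] at h2
  exact le_antisymm h1 (neg_nonpos.1 h2)

end Flat

/-! ### Blaschke selection. -/

section Selection

variable {V : Type*} [NormedAddCommGroup V] [NormedSpace ℝ V] [FiniteDimensional ℝ V]

theorem supportTendsto_of_tendsto {ι : Type*} {l : Filter ι} {K : ι → ConvexBody V}
    {L : ConvexBody V} (h : Filter.Tendsto K l (nhds L)) : SupportTendsto l K L := by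
  have aux : ∀ (K L : ConvexBody V) (ε : ℝ), dist K L < ε → ∀ u,
      supportFn K u ≤ supportFn L u + ε * ‖u‖ := by
    intro K L ε hKL u
    refine supportFn_le fun x hx => ?_
    obtain ⟨y, hy, hxy⟩ := Metric.exists_dist_lt_of_hausdorffDist_lt hx hKL
      ConvexBody.hausdorffEDist_ne_top
    have h1 := u.le_opNorm (x - y)
    rw [map_sub, Real.norm_eq_abs, ← dist_eq_norm] at h1
    have h2 := le_supportFn L u hy
    have h3 := le_abs_self (u x - u y)
    have h4 := mul_le_mul_of_nonneg_left hxy.le (norm_nonneg u)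
    linarith
  intro ε hε
  filter_upwards [Metric.tendsto_nhds.1 h ε hε] with i hi u
  have h1 := aux _ _ ε hi u
  have h2 := aux _ _ ε (by rwa [dist_comm]) u
  exact abs_le.2 ⟨by linarith, by linarith⟩

/-- Blaschke's selection theorem. -/
theorem exists_supportTendsto_subseq {K : ℕ → ConvexBody V} {R : ℝ}
    (hK : ∀ k, (K k : Set V) ⊆ Metric.closedBall 0 R) :
    ∃ (L : ConvexBody V) (φ : ℕ → ℕ), StrictMono φ ∧
      SupportTendsto Filter.atTop (fun k => K (φ k)) L := by
  have : ProperSpace V := FiniteDimensional.proper_real V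
  let N : ConvexBody V → TopologicalSpace.NonemptyCompacts V := fun K =>
    ⟨⟨K, K.isCompact⟩, K.nonempty⟩
  -- The nonempty compact subsets of a ball form a compact space for the Hausdorff metric; it
  -- remains to see that the limit is convex.
  have hcpt : IsCompact {M : TopologicalSpace.NonemptyCompacts V |
      (M : Set V) ⊆ Metric.closedBall 0 R} :=
    TopologicalSpace.NonemptyCompacts.isClosedEmbedding_toCompacts.isCompact_preimage
      (TopologicalSpace.Compacts.isCompact_subsets_of_isCompact
        (isCompact_closedBall (0 : V) R))
  obtain ⟨M, -, φ, hφ, hlim⟩ := hcpt.tendsto_subseq (x := fun k => N (K k)) hK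
  have hfin : ∀ K : ConvexBody V, Metric.hausdorffEDist (K : Set V) (M : Set V) ≠ ⊤ := fun K =>
    Metric.hausdorffEDist_ne_top_of_nonempty_of_bounded K.nonempty M.nonempty K.isBounded
      M.isCompact.isBounded
  -- Two points of M are moved to nearby points of some K (φ k), combined there, and the result is
  -- moved back near M, which is closed.
  have hconv : Convex ℝ (M : Set V) := by
    intro x hx y hy a b ha hb hab
    refine M.isCompact.isClosed.closure_eq ▸ Metric.mem_closure_iff.2 fun ε hε => ?_
    obtain ⟨k, hk⟩ := (Metric.tendsto_nhds.1 hlim (ε / 2) (by positivity)).exists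
    obtain ⟨x', hx', hxx⟩ := Metric.exists_dist_lt_of_hausdorffDist_lt' hx hk (hfin _)
    obtain ⟨y', hy', hyy⟩ := Metric.exists_dist_lt_of_hausdorffDist_lt' hy hk (hfin _)
    obtain ⟨z, hz, hzz⟩ := Metric.exists_dist_lt_of_hausdorffDist_lt
      ((K (φ k)).convex hx' hy' ha hb hab) hk (hfin _)
    refine ⟨z, hz, ?_⟩
    have h1 : dist (a • x + b • y) (a • x' + b • y') ≤ ε / 2 := by
      rw [dist_eq_norm, show a • x + b • y - (a • x' + b • y') = a • (x - x') + b • (y - y') by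
        module]
      rw [dist_comm, dist_eq_norm] at hxx hyy
      refine (norm_add_le _ _).trans ?_
      rw [norm_smul, norm_smul, Real.norm_of_nonneg ha, Real.norm_of_nonneg hb]
      calc a * ‖x - x'‖ + b * ‖y - y'‖ ≤ a * (ε / 2) + b * (ε / 2) := by gcongr
        _ = ε / 2 := by rw [← add_mul, hab, one_mul]
    linarith [dist_triangle (a • x + b • y) (a • x' + b • y') z]
  refine ⟨⟨M, hconv, M.isCompact, M.nonempty⟩, φ, hφ, supportTendsto_of_tendsto ?_⟩
  exact Metric.tendsto_nhds.2 fun ε hε => Metric.tendsto_nhds.1 hlim ε hε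

end Selection

/-! ### A priori bounds for shadows and diameters. -/

section Bounds

variable {V : Type*} [NormedAddCommGroup V] [NormedSpace ℝ V] [FiniteDimensional ℝ V]
  [MeasurableSpace V] [BorelSpace V] (μ : Measure V) [μ.IsAddHaarMeasure]

theorem shadow_pos {A : ConvexBody V} (hA : (interior (A : Set V)).Nonempty) {v : V} (hv : v ≠ 0) :
    0 < shadow μ A v := by
  obtain ⟨u, e, ν, hν, hev, he⟩ := exists_split_measurePreserving μ hv
  rw [shadow_eq he hev]
  refine measureReal_pos_of_interior ν ?_
  have ho : IsOpenMap (projMap e) := isOpenMap_snd.comp e.toHomeomorph.isOpenMap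
  exact (hA.image _).mono (ho.image_interior_subset _)

theorem exists_mul_norm_le_shadow {A : ConvexBody V} (hA : (interior (A : Set V)).Nonempty) :
    ∃ c > 0, ∀ v, c * ‖v‖ ≤ shadow μ A v := by
  have : ProperSpace V := FiniteDimensional.proper_real V
  obtain ⟨C, hC⟩ := exists_isLipschitzGauge_shadow μ A hA
  rcases (Metric.sphere (0 : V) 1).eq_empty_or_nonempty with hs | hs
  · refine ⟨1, one_pos, fun v => ?_⟩
    rcases eq_or_ne v 0 with rfl | hv
    · simp [shadow_zero]
    · have : (‖v‖⁻¹ • v) ∈ Metric.sphere (0 : V) 1 := by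
        simp [norm_smul, norm_ne_zero_iff.2 hv]
      rw [hs] at this
      exact absurd this (Set.notMem_empty _)
  obtain ⟨v₀, hv₀, hmin⟩ := (isCompact_sphere (0 : V) 1).exists_isMinOn hs hC.continuous.continuousOn
  have hv₀0 : v₀ ≠ 0 := by
    rintro rfl
    simp at hv₀
  refine ⟨shadow μ A v₀, shadow_pos μ hA hv₀0, fun v => ?_⟩
  rcases eq_or_ne v 0 with rfl | hv
  · simp [shadow_zero]
  have hn : 0 < ‖v‖ := norm_pos_iff.2 hv
  have h1 : shadow μ A v₀ ≤ shadow μ A (‖v‖⁻¹ • v) := hmin (by simp [norm_smul, hn.ne'])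
  rw [shadow_smul, abs_of_pos (by positivity), inv_mul_eq_div, le_div_iff₀ hn] at h1
  exact h1

theorem shadow_le_of_subset_closedBall {L : ConvexBody V} {R : ℝ}
    (hL : (L : Set V) ⊆ Metric.closedBall 0 R) (v : V) :
    shadow μ L v ≤ μ.real (Metric.closedBall (0 : V) (R + 1)) * ‖v‖ := by
  have : ProperSpace V := FiniteDimensional.proper_real V
  rcases eq_or_ne v 0 with rfl | hv
  · simp [shadow_zero]
  have hn : 0 < ‖v‖ := norm_pos_iff.2 hv
  have h1 : shadow μ L (‖v‖⁻¹ • v) ≤ μ.real (Metric.closedBall (0 : V) (R + 1)) := by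
    refine (sub_le_self _ measureReal_nonneg).trans
      (measureReal_mono ?_ measure_closedBall_lt_top.ne)
    rintro _ ⟨x, hx, y, hy, rfl⟩
    obtain ⟨t, ht, rfl⟩ := mem_segmentBody.1 hy
    have h2 := mem_closedBall_zero_iff.1 (hL hx)
    rw [mem_closedBall_zero_iff]
    refine (norm_add_le _ _).trans (add_le_add h2 ?_)
    rw [norm_smul, norm_smul, norm_inv, norm_norm, inv_mul_cancel₀ hn.ne', mul_one,
      Real.norm_of_nonneg ht.1]
    exact ht.2
  rwa [shadow_smul, abs_of_pos (by positivity), inv_mul_eq_div, div_le_iff₀ hn] at h1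

/-- L + [0, y - x] is contained in 2L - x: the points x + t(y - x) belong to L, and L + L = 2L. -/
theorem shadow_sub_le {L : ConvexBody V} {x y : V} (hx : x ∈ L) (hy : y ∈ L) :
    shadow μ L (y - x) ≤ 2 ^ finrank ℝ V * μ.real (L : Set V) := by
  rw [← measureReal_smul μ (by norm_num : (0 : ℝ) ≤ 2) L,
    ← measureReal_add_pointBody μ ((2 : ℝ) • L) (-x)]
  refine (sub_le_self _ measureReal_nonneg).trans
    (measureReal_mono ?_ (measure_convexBody_lt_top μ _).ne)
  rintro _ ⟨z, hz, w, hw, rfl⟩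
  obtain ⟨t, ht, rfl⟩ := mem_segmentBody.1 hw
  have h1 : (1 / 2 : ℝ) • z + (1 / 2 : ℝ) • ((1 - t) • x + t • y) ∈ (L : Set V) :=
    L.convex hz (L.convex hx hy (by linarith [ht.2]) ht.1 (by ring)) (by norm_num) (by norm_num)
      (by norm_num)
  refine ⟨_, Set.smul_mem_smul_set h1, -x, rfl, ?_⟩
  simp only
  module

/-- Take v in the unit ball with w v ≥ ‖w‖. The map z ↦ z + (w z / C) v moves points of P by at most
1 and multiplies volumes by 1 + w v / C, while the image stays in the ball of radius R + 1. So a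
lower bound on the volume of P bounds ‖w‖. -/
theorem norm_le_of_subset_slab {P : ConvexBody V} {R C : ℝ}
    (hP : (P : Set V) ⊆ Metric.closedBall 0 R) (hC : 0 < C) (w : StrongDual ℝ V)
    (hw : ∀ z ∈ P, |w z| ≤ C) :
    (1 + ‖w‖ / C) * μ.real (P : Set V) ≤ μ.real (Metric.closedBall (0 : V) (R + 1)) := by
  have : ProperSpace V := FiniteDimensional.proper_real V
  obtain ⟨v, hv, hwv⟩ := exists_eq_supportFn (closedBallBody (0 : V) zero_le_one) w
  have h1 := le_supportFn_closedBallBody (0 : V) zero_le_one w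
  rw [map_zero, zero_add, one_mul, ← hwv] at h1
  have hv1 : ‖v‖ ≤ 1 := mem_closedBall_zero_iff.1 hv
  have hdet : (LinearMap.transvection (w : V →ₗ[ℝ] ℝ) (C⁻¹ • v)).det = 1 + w v / C := by
    rw [LinearMap.transvection.det, map_smul, smul_eq_mul, inv_mul_eq_div]
    rfl
  have hle : ‖w‖ / C ≤ w v / C := by gcongr
  have hpos : 0 ≤ ‖w‖ / C := by positivity
  have h2 := Measure.addHaar_image_linearMap μ
    (LinearMap.transvection (w : V →ₗ[ℝ] ℝ) (C⁻¹ • v)) (P : Set V)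
  have h3 : μ.real (LinearMap.transvection (w : V →ₗ[ℝ] ℝ) (C⁻¹ • v) '' (P : Set V)) =
      (1 + w v / C) * μ.real (P : Set V) := by
    rw [measureReal_def, h2, hdet, ENNReal.toReal_mul, ENNReal.toReal_ofReal (abs_nonneg _),
      abs_of_nonneg (by linarith)]
    rfl
  refine (mul_le_mul_of_nonneg_right (by linarith) measureReal_nonneg).trans
    (h3.symm.le.trans (measureReal_mono ?_ measure_closedBall_lt_top.ne))
  rintro _ ⟨z, hz, rfl⟩
  rw [mem_closedBall_zero_iff]
  change ‖z + w z • C⁻¹ • v‖ ≤ R + 1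
  refine (norm_add_le _ _).trans (add_le_add (mem_closedBall_zero_iff.1 (hP hz)) ?_)
  rw [norm_smul, norm_smul, norm_inv, Real.norm_of_nonneg hC.le, Real.norm_eq_abs]
  calc |w z| * (C⁻¹ * ‖v‖) ≤ C * (C⁻¹ * 1) := by
        gcongr
        exact hw z hz
    _ = 1 := by field_simp

theorem SupportTendsto.tendsto_shadow {ι : Type*} {l : Filter ι} {K : ι → ConvexBody V}
    {L : ConvexBody V} (h : SupportTendsto l K L) (v : V) :
    Filter.Tendsto (fun i => shadow μ (K i) v) l (nhds (shadow μ L v)) :=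
  ((h.add_const (segmentBody v)).tendsto_measureReal μ).sub (h.tendsto_measureReal μ)

end Bounds

/-! ### Existence of a maximizing body by compactness. -/

section Maximizer

variable {V : Type*} [NormedAddCommGroup V] [NormedSpace ℝ V] [FiniteDimensional ℝ V]
  [MeasurableSpace V] [BorelSpace V] {d : ℕ} [hd : Fact (finrank ℝ V = d + 1)]
  {Ω : V [⋀^Fin (d + 1)]→ₗ[ℝ] ℝ} {A : ConvexBody V}

theorem interior_projectionBody_nonempty (hΩ : Ω ≠ 0) (hA : (interior (A : Set V)).Nonempty) :
    (interior (projectionBody Ω A : Set (StrongDual ℝ V))).Nonempty := by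
  have := isAddHaarMeasure_measure hΩ
  obtain ⟨c, hc, hcS⟩ := exists_mul_norm_le_shadow Ω.measure hA
  refine ⟨0, mem_interior_iff_mem_nhds.2 (Filter.mem_of_superset (Metric.closedBall_mem_nhds 0 hc) ?_)⟩
  intro ξ hξ
  refine (mem_projectionBody hΩ).2 fun v => (le_abs_self _).trans ((ξ.le_opNorm v).trans ?_)
  exact (mul_le_mul_of_nonneg_right (mem_closedBall_zero_iff.1 hξ) (norm_nonneg v)).trans (hcS v)

/-- For z in ΠL, |F(x)(z)| is at most the shadow of L at F(x). Hence c ‖z‖ ≤ shadow of A at z = ½ ∫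
|F(x)(z)| ≤ ½ (d + 1) V₁(L, ΠA) = (d + 1)/2. -/
theorem exists_dualProjectionBody_subset_closedBall (hΩ : Ω ≠ 0)
    (hA : (interior (A : Set V)).Nonempty) :
    ∃ R, ∀ L : ConvexBody (StrongDual ℝ V), (interior (L : Set (StrongDual ℝ V))).Nonempty →
      mixedVolumePair (dualForm Ω) 1 L (projectionBody Ω A) = 1 →
        (dualProjectionBody (dualForm Ω) L : Set V) ⊆ Metric.closedBall 0 R := by
  have := isAddHaarMeasure_measure hΩ
  have := isAddHaarMeasure_measure (dualForm_ne_zero hΩ)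
  obtain ⟨F, hF, hS⟩ := exists_isZonoidOf_projectionBody hΩ hA
  obtain ⟨c, hc, hcS⟩ := exists_mul_norm_le_shadow Ω.measure hA
  refine ⟨(d + 1) / 2 / c, fun L hL h z hz => ?_⟩
  obtain ⟨D, hD⟩ := exists_isLipschitzGauge_shadow (dualForm Ω).measure L hL
  rw [hF.mixedVolumePair_one _ hD, div_eq_one_iff_eq (by positivity)] at h
  have hz' := (mem_dualProjectionBody (dualForm_ne_zero hΩ)).1 hz
  rw [mem_closedBall_zero_iff, le_div_iff₀ hc, mul_comm]
  refine (hcS z).trans ?_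
  rw [hS, ← h, one_div, inv_mul_eq_div]
  refine div_le_div_of_nonneg_right (integral_mono (hF.1.apply_continuousLinearMap z).abs
    (hD.integrable hF.1) fun x => abs_le'.2 ⟨hz' _, ?_⟩) (by norm_num)
  have h1 := hz' (-F x)
  rw [← neg_one_smul ℝ (F x), shadow_smul, abs_neg, abs_one, one_mul, neg_one_smul] at h1
  exact h1

/-- Minkowski's inequality for L and the zonoid ΠA gives vol(ΠA) vol(L)^d ≤ 1. Taking the maximum
with 1 lets vol(L) be compared with vol(L)^d. -/
theorem exists_measureReal_le_of_mixedVolumePair (hΩ : Ω ≠ 0) (hd1 : 1 ≤ d)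
    (hA : (interior (A : Set V)).Nonempty) :
    ∃ C, ∀ L : ConvexBody (StrongDual ℝ V), (interior (L : Set (StrongDual ℝ V))).Nonempty →
      mixedVolumePair (dualForm Ω) 1 L (projectionBody Ω A) = 1 →
        (dualForm Ω).measure.real (L : Set (StrongDual ℝ V)) ≤ C := by
  have := isAddHaarMeasure_measure (dualForm_ne_zero hΩ)
  obtain ⟨F, hF, -⟩ := exists_isZonoidOf_projectionBody hΩ hA
  have hq := measureReal_pos_of_interior (dualForm Ω).measure
    (interior_projectionBody_nonempty hΩ hA)
  refine ⟨max 1 (1 / (dualForm Ω).measure.real (projectionBody Ω A : Set (StrongDual ℝ V))),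
    fun L hL h => ?_⟩
  have h1 := (hF.measureReal_mul_pow_le_one_of_mixedVolumePair (dualForm_ne_zero hΩ) hd1 hL h).1
  rcases le_total ((dualForm Ω).measure.real (L : Set (StrongDual ℝ V))) 1 with h2 | h2
  · exact h2.trans (le_max_left _ _)
  · refine (le_self_pow₀ h2 (by omega : d ≠ 0)).trans (le_trans ?_ (le_max_right _ _))
    rwa [le_div_iff₀ hq, mul_comm]

/-- For x, y in L, the functional ±(y - x) is bounded on ΠL by the shadow of L at ±(y - x), hence by
2ⁿ vol(L). So ΠL lies in a slab, and since its volume is at least c, the slab estimate bounds ‖y -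
x‖. -/
theorem exists_norm_sub_le_of_mixedVolumePair (hΩ : Ω ≠ 0) (hd1 : 1 ≤ d)
    (hA : (interior (A : Set V)).Nonempty) {c : ℝ} (hc : 0 < c) :
    ∃ R, ∀ L : ConvexBody (StrongDual ℝ V), (interior (L : Set (StrongDual ℝ V))).Nonempty →
      mixedVolumePair (dualForm Ω) 1 L (projectionBody Ω A) = 1 →
        c ≤ Ω.measure.real (dualProjectionBody (dualForm Ω) L : Set V) →
          ∀ x ∈ L, ∀ y ∈ L, ‖y - x‖ ≤ R := by
  have := isAddHaarMeasure_measure hΩ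
  have := isAddHaarMeasure_measure (dualForm_ne_zero hΩ)
  obtain ⟨R, hR⟩ := exists_dualProjectionBody_subset_closedBall hΩ hA
  obtain ⟨C, hC⟩ := exists_measureReal_le_of_mixedVolumePair hΩ hd1 hA
  set D : ℝ := 2 ^ finrank ℝ (StrongDual ℝ V) * max C 1 with hDdef
  have hD : 0 < D := by positivity
  refine ⟨D * (Ω.measure.real (Metric.closedBall (0 : V) (R + 1)) / c), fun L hL h hcL x hx y hy => ?_⟩
  have h1 : ∀ x ∈ L, ∀ y ∈ L, ∀ z ∈ dualProjectionBody (dualForm Ω) L, (y - x) z ≤ D :=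
    fun x hx y hy z hz => by
      refine ((mem_dualProjectionBody (dualForm_ne_zero hΩ)).1 hz _).trans
        ((shadow_sub_le _ hx hy).trans ?_)
      exact mul_le_mul_of_nonneg_left ((hC L hL h).trans (le_max_left _ _)) (by positivity)
  have h2 := norm_le_of_subset_slab Ω.measure (hR L hL h) hD (y - x) fun z hz =>
    abs_le'.2 ⟨h1 x hx y hy z hz, by
      have h3 := h1 y hy x hx z hz
      rw [← neg_sub y x] at h3
      exact h3⟩
  have h4 : ‖y - x‖ / D ≤ Ω.measure.real (Metric.closedBall (0 : V) (R + 1)) / c := by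
    rw [le_div_iff₀ hc]
    refine le_trans ?_ h2
    have : 0 ≤ ‖y - x‖ / D := by positivity
    nlinarith
  rwa [div_le_iff₀ hD, mul_comm] at h4

/-- Continuity in the first entry: the shadows converge pointwise and are uniformly bounded by a
multiple of the norm, so dominated convergence applies to the zonoid formula. -/
theorem IsZonoidOf.mixedVolumePair_one_of_tendsto {X : Type*} [MeasurableSpace X] {ρ : Measure X}
    {F : X → V} {Z : ConvexBody V} (hZ : IsZonoidOf ρ F Z) (hΩ : Ω ≠ 0) {K : ℕ → ConvexBody V}
    {L : ConvexBody V} {R : ℝ} (hK : ∀ k, (interior (K k : Set V)).Nonempty)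
    (hKR : ∀ k, (K k : Set V) ⊆ Metric.closedBall 0 R) (hL : (interior (L : Set V)).Nonempty)
    (hKL : SupportTendsto Filter.atTop K L) :
    Filter.Tendsto (fun k => mixedVolumePair Ω 1 (K k) Z) Filter.atTop
      (nhds (mixedVolumePair Ω 1 L Z)) := by
  have := isAddHaarMeasure_measure hΩ
  choose C hC using fun k => exists_isLipschitzGauge_shadow Ω.measure (K k) (hK k)
  obtain ⟨D, hD⟩ := exists_isLipschitzGauge_shadow Ω.measure L hL
  simp only [fun k => hZ.mixedVolumePair_one Ω (hC k), hZ.mixedVolumePair_one Ω hD]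
  refine Filter.Tendsto.div_const (tendsto_integral_of_dominated_convergence
    (fun x => Ω.measure.real (Metric.closedBall (0 : V) (R + 1)) * ‖F x‖)
    (fun k => ((hC k).integrable hZ.1).aestronglyMeasurable) (hZ.1.norm.const_mul _)
    (fun k => Filter.Eventually.of_forall fun x => ?_)
    (Filter.Eventually.of_forall fun x => hKL.tendsto_shadow _ _)) _
  rw [Real.norm_of_nonneg (shadow_nonneg _ _ _)]
  exact shadow_le_of_subset_closedBall _ (hKR k) _

/-- The reverse Fatou lemma for sets: Q contains the upper limit of the uniformly bounded P k. With
it, upper semicontinuity of ΠL in L suffices for the maximizer. -/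
theorem le_measureReal_of_frequently_subset (μ : Measure V) [μ.IsAddHaarMeasure] {P : ℕ → ConvexBody V}
    {Q : ConvexBody V} {R M : ℝ} (hPR : ∀ k, (P k : Set V) ⊆ Metric.closedBall 0 R)
    (hPQ : ∀ z, (∃ᶠ k in Filter.atTop, z ∈ P k) → z ∈ Q)
    (hM : ∀ c < M, ∀ᶠ k in Filter.atTop, c < μ.real (P k : Set V)) : M ≤ μ.real (Q : Set V) := by
  have : ProperSpace V := FiniteDimensional.proper_real V
  set S : ℕ → Set V := fun n => ⋃ k, ⋃ (_ : n ≤ k), (P k : Set V) with hSdef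
  have hSR : ∀ n, S n ⊆ Metric.closedBall 0 R := fun n =>
    Set.iUnion_subset fun k => Set.iUnion_subset fun _ => hPR k
  have hmeas : ∀ n, MeasurableSet (S n) := fun n =>
    MeasurableSet.iUnion fun k => MeasurableSet.iUnion fun _ => (P k).isClosed.measurableSet
  have hfin : ∀ n, μ (S n) ≠ ⊤ := fun n =>
    ((measure_mono (hSR n)).trans_lt measure_closedBall_lt_top).ne
  have hlim := tendsto_measure_iInter_atTop (μ := μ) (s := S)
    (fun n => (hmeas n).nullMeasurableSet)
    (fun m n hmn => Set.iUnion_mono fun k => Set.iUnion_subset fun hk =>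
      Set.subset_iUnion_of_subset (hmn.trans hk) le_rfl) ⟨0, hfin 0⟩
  have hsub : (⋂ n, S n) ⊆ (Q : Set V) := fun z hz => by
    refine hPQ z (Filter.frequently_atTop.2 fun n => ?_)
    have h1 := Set.mem_iInter.1 hz n
    simp only [hSdef, Set.mem_iUnion] at h1
    obtain ⟨k, hk, hzk⟩ := h1
    exact ⟨k, hk, hzk⟩
  refine le_of_forall_lt_imp_le_of_dense fun c hc => ?_
  have h1 : ENNReal.ofReal c ≤ μ (⋂ n, S n) := by
    refine ge_of_tendsto' hlim fun n => ?_
    obtain ⟨k, hk, hnk⟩ := ((hM c hc).and (Filter.eventually_ge_atTop n)).exists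
    refine le_trans ?_ (measure_mono (Set.subset_iUnion_of_subset k
      (Set.subset_iUnion_of_subset hnk le_rfl)))
    exact (ENNReal.ofReal_le_iff_le_toReal (measure_convexBody_lt_top μ _).ne).2 hk.le
  exact (ENNReal.ofReal_le_iff_le_toReal (measure_convexBody_lt_top μ _).ne).1
    (h1.trans (measure_mono hsub))

theorem mem_dualProjectionBody_of_frequently {Θ : StrongDual ℝ V [⋀^Fin (d + 1)]→ₗ[ℝ] ℝ}
    (hΘ : Θ ≠ 0) {K : ℕ → ConvexBody (StrongDual ℝ V)} {L : ConvexBody (StrongDual ℝ V)}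
    (hKL : SupportTendsto Filter.atTop K L) {z : V}
    (hz : ∃ᶠ k in Filter.atTop, z ∈ dualProjectionBody Θ (K k)) : z ∈ dualProjectionBody Θ L := by
  have := isAddHaarMeasure_measure hΘ
  refine (mem_dualProjectionBody hΘ).2 fun u => ?_
  by_contra! hlt
  refine hz (((hKL.tendsto_shadow Θ.measure u).eventually_lt_const hlt).mono fun k hk h => ?_)
  exact hk.not_ge ((mem_dualProjectionBody hΘ).1 h u)

theorem dualProjectionBody_add_pointBody {Θ : StrongDual ℝ V [⋀^Fin (d + 1)]→ₗ[ℝ] ℝ} (hΘ : Θ ≠ 0)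
    (L : ConvexBody (StrongDual ℝ V)) (u : StrongDual ℝ V) :
    dualProjectionBody Θ (L + pointBody u) = dualProjectionBody Θ L := by
  have := isAddHaarMeasure_measure hΘ
  refine SetLike.ext fun z => ?_
  simp only [mem_dualProjectionBody hΘ, shadow_add_pointBody]

theorem coe_add_pointBody (L : ConvexBody V) (x : V) :
    ((L + pointBody x : ConvexBody V) : Set V) = x +ᵥ (L : Set V) := by
  change (L : Set V) + {x} = _
  rw [Set.add_singleton, ← Set.image_vadd]
  simp [add_comm]

theorem interior_vadd_nonempty {s : Set V} (hs : (interior s).Nonempty) (x : V) :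
    (interior (x +ᵥ s)).Nonempty := by
  rw [interior_vadd]
  exact hs.vadd_set

theorem IsZonoidOf.mixedVolumePair_one_add_pointBody {X : Type*} [MeasurableSpace X]
    {ρ : Measure X} {F : X → V} {Z : ConvexBody V} (hZ : IsZonoidOf ρ F Z) (hΩ : Ω ≠ 0)
    (hA : (interior (A : Set V)).Nonempty) (x : V) :
    mixedVolumePair Ω 1 (A + pointBody x) Z = mixedVolumePair Ω 1 A Z := by
  have := isAddHaarMeasure_measure hΩ
  obtain ⟨C, hC⟩ := exists_isLipschitzGauge_shadow Ω.measure A hA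
  obtain ⟨D, hD⟩ := exists_isLipschitzGauge_shadow Ω.measure (A + pointBody x)
    (by rw [coe_add_pointBody]; exact interior_vadd_nonempty hA x)
  rw [hZ.mixedVolumePair_one Ω hC, hZ.mixedVolumePair_one Ω hD]
  simp only [shadow_add_pointBody]

/-- The supremum of `vol(Π L)` over the bodies `L` with `V₁(L, Π A) = 1` is attained. -/
theorem exists_maximizer (hΩ : Ω ≠ 0) (hd1 : 1 ≤ d) (hA : (interior (A : Set V)).Nonempty) {M : ℝ}
    (hM : 0 < M) (h : ∀ c < M, ∃ L : ConvexBody (StrongDual ℝ V),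
      mixedVolumePair (dualForm Ω) 1 L (projectionBody Ω A) = 1 ∧
        c < Ω.measure.real (dualProjectionBody (dualForm Ω) L : Set V)) :
    ∃ L : ConvexBody (StrongDual ℝ V), (interior (L : Set (StrongDual ℝ V))).Nonempty ∧
      mixedVolumePair (dualForm Ω) 1 L (projectionBody Ω A) = 1 ∧
        M ≤ Ω.measure.real (dualProjectionBody (dualForm Ω) L : Set V) := by
  have := isAddHaarMeasure_measure hΩ
  have := isAddHaarMeasure_measure (dualForm_ne_zero hΩ)
  have hint : ∀ L : ConvexBody (StrongDual ℝ V),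
      0 < Ω.measure.real (dualProjectionBody (dualForm Ω) L : Set V) →
        (interior (L : Set (StrongDual ℝ V))).Nonempty := fun L hL =>
    interior_nonempty_of_measure_dualProjectionBody hd1 Ω.measure (dualForm_ne_zero hΩ)
      fun h0 => by simp [Measure.real, h0] at hL
  obtain ⟨F, hF, -⟩ := exists_isZonoidOf_projectionBody hΩ hA
  -- Starting the maximizing sequence above M / 2 gives the uniform lower volume bound that the
  -- diameter estimate requires.
  obtain ⟨c, hcmono, hcM, hclim⟩ := exists_seq_strictMono_tendsto' (show M / 2 < M by linarith)
  choose K hK hcK using fun k => h (c k) (hcM k).2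
  have hKi : ∀ k, (interior (K k : Set (StrongDual ℝ V))).Nonempty := fun k =>
    hint _ ((half_pos hM).trans ((hcM k).1.trans (hcK k)))
  obtain ⟨R, hR⟩ := exists_norm_sub_le_of_mixedVolumePair hΩ hd1 hA (half_pos hM)
  obtain ⟨R', hR'⟩ := exists_dualProjectionBody_subset_closedBall hΩ hA
  choose x hx using fun k => (K k).nonempty
  -- Translating each body to contain 0 changes neither its projection body nor the constraint, and
  -- turns the diameter bound into a common ball.
  set N : ℕ → ConvexBody (StrongDual ℝ V) := fun k => K k + pointBody (-x k) with hN
  have hNi : ∀ k, (interior (N k : Set (StrongDual ℝ V))).Nonempty := fun k => by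
    rw [hN, coe_add_pointBody]
    exact interior_vadd_nonempty (hKi k) _
  have hNR : ∀ k, (N k : Set (StrongDual ℝ V)) ⊆ Metric.closedBall 0 R := by
    rintro k _ ⟨y, hy, w, hw, rfl⟩
    obtain rfl : w = -x k := hw
    rw [mem_closedBall_zero_iff]
    change ‖y + -x k‖ ≤ R
    rw [← sub_eq_add_neg]
    exact hR (K k) (hKi k) (hK k) ((hcM k).1.trans (hcK k)).le _ (hx k) _ hy
  have hN1 : ∀ k, mixedVolumePair (dualForm Ω) 1 (N k) (projectionBody Ω A) = 1 := fun k => by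
    rw [hN, hF.mixedVolumePair_one_add_pointBody (dualForm_ne_zero hΩ) (hKi k), hK]
  obtain ⟨L, φ, hφ, hlim⟩ := exists_supportTendsto_subseq hNR
  have hvol : M ≤ Ω.measure.real (dualProjectionBody (dualForm Ω) L : Set V) := by
    refine le_measureReal_of_frequently_subset Ω.measure
      (P := fun k => dualProjectionBody (dualForm Ω) (N (φ k))) (fun k => hR' _ (hNi _) (hN1 _))
      (fun z hz => mem_dualProjectionBody_of_frequently (dualForm_ne_zero hΩ) hlim hz) fun a ha => ?_
    filter_upwards [(hclim.comp hφ.tendsto_atTop).eventually_const_lt ha] with k hk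
    rw [hN, dualProjectionBody_add_pointBody (dualForm_ne_zero hΩ)]
    exact hk.trans (hcK _)
  have hL := hint L (hM.trans_le hvol)
  refine ⟨L, hL, ?_, hvol⟩
  have h1 := hF.mixedVolumePair_one_of_tendsto (dualForm_ne_zero hΩ) (fun k => hNi (φ k))
    (fun k => hNR (φ k)) hL hlim
  simp only [hN1] at h1
  exact (tendsto_nhds_unique h1 tendsto_const_nhds)

end Maximizer

theorem unitBallVolume_pos (n : ℕ) : 0 < unitBallVolume n :=
  ENNReal.toReal_pos (Metric.measure_ball_pos _ _ one_pos).ne' measure_ball_lt_top.ne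

/-! ### The sharp bound on vol(ΠL), and bodies attaining it. -/

section AffineInvariant

variable {V : Type*} [NormedAddCommGroup V] [NormedSpace ℝ V] [FiniteDimensional ℝ V]
  [MeasurableSpace V] [BorelSpace V] {d : ℕ} [hd : Fact (finrank ℝ V = d + 1)]
  {Ω : V [⋀^Fin (d + 1)]→ₗ[ℝ] ℝ} {A : ConvexBody V}

theorem symplecticVolume_prod_projectionBody (hΩ : Ω ≠ 0) (B L : ConvexBody (StrongDual ℝ V)) :
    symplecticVolume (dualForm Ω) ((B : Set (StrongDual ℝ V)) ×ˢ
        (projectionBody (dualForm Ω) L : Set (StrongDual ℝ (StrongDual ℝ V)))) =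
      ENNReal.ofReal ((dualForm Ω).measure.real (B : Set (StrongDual ℝ V)) *
        Ω.measure.real (dualProjectionBody (dualForm Ω) L : Set V)) := by
  have := isAddHaarMeasure_measure hΩ
  have := isAddHaarMeasure_measure (dualForm_ne_zero hΩ)
  have := isAddHaarMeasure_measure (dualForm_ne_zero (dualForm_ne_zero hΩ))
  rw [symplecticVolume, Measure.prod_prod, measure_projectionBody_dualForm hΩ,
    ENNReal.ofReal_mul measureReal_nonneg, measureReal_def, measureReal_def,
    ENNReal.ofReal_toReal (measure_convexBody_lt_top _ _).ne,
    ENNReal.ofReal_toReal (measure_convexBody_lt_top _ _).ne]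

/-- If ΠL is null there is nothing to prove. Otherwise L has interior points, the constraint becomes
V₁(A, ΠL) = 1, and Minkowski's inequality for A and the zonoid ΠL applies. -/
theorem measureReal_dualProjectionBody_le (hΩ : Ω ≠ 0) (hd1 : 1 ≤ d)
    (hA : (interior (A : Set V)).Nonempty) {L : ConvexBody (StrongDual ℝ V)}
    (h : mixedVolumePair (dualForm Ω) 1 L (projectionBody Ω A) = 1) :
    Ω.measure.real (dualProjectionBody (dualForm Ω) L : Set V) ≤
      (Ω.measure.real (A : Set V) ^ d)⁻¹ := by
  have := isAddHaarMeasure_measure hΩ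
  have hm := measureReal_pos_of_interior Ω.measure hA
  by_cases h0 : Ω.measure (dualProjectionBody (dualForm Ω) L : Set V) = 0
  · rw [measureReal_def, h0, ENNReal.toReal_zero]
    positivity
  have hL := interior_nonempty_of_measure_dualProjectionBody hd1 Ω.measure (dualForm_ne_zero hΩ) h0
  obtain ⟨G, hG, -⟩ := exists_isZonoidOf_dualProjectionBody (dualForm_ne_zero hΩ) hL
  rw [mixedVolumePair_projectionBody_comm hΩ hA hL] at h
  rw [← one_div, le_div_iff₀ (by positivity)]
  exact (hG.measureReal_mul_pow_le_one_of_mixedVolumePair hΩ hd1 hA h).1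

theorem isHomothetic_dualProjectionBody (hΩ : Ω ≠ 0) (hd1 : 1 ≤ d)
    (hA : (interior (A : Set V)).Nonempty) {L : ConvexBody (StrongDual ℝ V)}
    (hL : (interior (L : Set (StrongDual ℝ V))).Nonempty)
    (h : mixedVolumePair (dualForm Ω) 1 L (projectionBody Ω A) = 1)
    (hvol : (Ω.measure.real (A : Set V) ^ d)⁻¹ ≤
      Ω.measure.real (dualProjectionBody (dualForm Ω) L : Set V)) :
    IsHomothetic (A : Set V) (dualProjectionBody (dualForm Ω) L : Set V) := by
  have := isAddHaarMeasure_measure hΩ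
  have hm := measureReal_pos_of_interior Ω.measure hA
  obtain ⟨G, hG, -⟩ := exists_isZonoidOf_dualProjectionBody (dualForm_ne_zero hΩ) hL
  rw [mixedVolumePair_projectionBody_comm hΩ hA hL] at h
  rw [← one_div, div_le_iff₀ (by positivity)] at hvol
  exact (hG.measureReal_mul_pow_le_one_of_mixedVolumePair hΩ hd1 hA h).2 hvol

theorem isProjectionBody_iff {P : ConvexBody V} :
    IsProjectionBody Ω P ↔ ∃ L, P = dualProjectionBody (dualForm Ω) L := by
  refine exists_congr fun L => ?_
  rw [← image_dualProjectionBody, ← coe_bidual, Set.image_eq_image (bidual V).injective,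
    SetLike.coe_set_eq]

theorem interior_smul_nonempty {s : ℝ} (hs : 0 < s) (hA : (interior (A : Set V)).Nonempty) :
    (interior ((s • A : ConvexBody V) : Set V)).Nonempty := by
  rw [ConvexBody.coe_smul, interior_smul₀ hs.ne']
  exact hA.smul_set

theorem IsZonoidOf.mixedVolumePair_one_smul {X : Type*} [MeasurableSpace X]
    {ρ : Measure X} {F : X → V} {Z : ConvexBody V} (hZ : IsZonoidOf ρ F Z) (hΩ : Ω ≠ 0)
    (hA : (interior (A : Set V)).Nonempty) {s : ℝ} (hs : 0 < s) :
    mixedVolumePair Ω 1 (s • A) Z = s ^ d * mixedVolumePair Ω 1 A Z := by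
  have := isAddHaarMeasure_measure hΩ
  obtain ⟨C, hC⟩ := exists_isLipschitzGauge_shadow Ω.measure A hA
  obtain ⟨D, hD⟩ := exists_isLipschitzGauge_shadow Ω.measure (s • A) (interior_smul_nonempty hs hA)
  rw [hZ.mixedVolumePair_one Ω hC, hZ.mixedVolumePair_one Ω hD]
  simp only [shadow_smul_body _ hs.le, hd.out, Nat.add_sub_cancel]
  rw [integral_const_mul, mul_div_assoc]

theorem dualProjectionBody_smul {Θ : StrongDual ℝ V [⋀^Fin (d + 1)]→ₗ[ℝ] ℝ} (hΘ : Θ ≠ 0)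
    (L : ConvexBody (StrongDual ℝ V)) {s : ℝ} (hs : 0 < s) :
    dualProjectionBody Θ (s • L) = s ^ d • dualProjectionBody Θ L := by
  have := isAddHaarMeasure_measure hΘ
  have hsd : 0 < s ^ d := by positivity
  refine SetLike.ext fun z => ?_
  rw [mem_dualProjectionBody hΘ]
  change _ ↔ z ∈ s ^ d • (dualProjectionBody Θ L : Set V)
  rw [Set.mem_smul_set_iff_inv_smul_mem₀ hsd.ne', SetLike.mem_coe, mem_dualProjectionBody hΘ]
  refine forall_congr' fun u => ?_
  rw [shadow_smul_body _ hs.le, (finrank_strongDual (V := V) (h := hd)).out, Nat.add_sub_cancel,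
    map_smul, smul_eq_mul, inv_mul_le_iff₀ hsd]

theorem exists_measureReal_dualProjectionBody_eq (hΩ : Ω ≠ 0) (hd1 : 1 ≤ d)
    (hA : (interior (A : Set V)).Nonempty) {K : ConvexBody (StrongDual ℝ V)}
    (h : IsHomothetic (A : Set V) (dualProjectionBody (dualForm Ω) K : Set V)) :
    ∃ L : ConvexBody (StrongDual ℝ V),
      mixedVolumePair (dualForm Ω) 1 L (projectionBody Ω A) = 1 ∧
      Ω.measure.real (dualProjectionBody (dualForm Ω) L : Set V) =
        (Ω.measure.real (A : Set V) ^ d)⁻¹ := by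
  have := isAddHaarMeasure_measure hΩ
  have hΘ := dualForm_ne_zero hΩ
  have hm := measureReal_pos_of_interior Ω.measure hA
  obtain ⟨t, ht, x, hAP⟩ := h
  set P := dualProjectionBody (dualForm Ω) K with hP
  obtain rfl : A = t • P + pointBody x := ConvexBody.ext (by rw [coe_add_pointBody, hAP]; rfl)
  rw [measureReal_add_pointBody, measureReal_smul _ ht.le, hd.out] at hm ⊢
  have hq : 0 < Ω.measure.real (P : Set V) := pos_of_mul_pos_right hm (by positivity)
  have hPi := interior_nonempty_of_measureReal_ne_zero Ω.measure hq.ne'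
  have hK : (interior (K : Set (StrongDual ℝ V))).Nonempty :=
    interior_nonempty_of_measure_dualProjectionBody hd1 Ω.measure hΘ fun h0 => by
      rw [measureReal_def, hP, h0] at hq
      simp at hq
  obtain ⟨F, hF, -⟩ := exists_isZonoidOf_projectionBody hΩ hA
  obtain ⟨G, hG, -⟩ := exists_isZonoidOf_dualProjectionBody hΘ hK
  rw [← hP] at hG
  have h1 := mixedVolumePair_projectionBody_comm hΩ hA hK
  rw [← hP, hG.mixedVolumePair_one_add_pointBody hΩ (interior_smul_nonempty ht hPi),
    hG.mixedVolumePair_one_smul hΩ hPi ht, mixedVolumePair_one_self hΩ] at h1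
  set q := Ω.measure.real (P : Set V) with hqdef
  -- For A = tP + x with P = ΠK one has V₁(sK, ΠA) = s^d V₁(A, P) = s^d t^d q, so this s normalizes
  -- the constraint.
  set s : ℝ := ((t ^ d * q)⁻¹) ^ ((d : ℝ)⁻¹) with hsdef
  have hs : 0 < s := by positivity
  have hsd : s ^ d = (t ^ d * q)⁻¹ := Real.rpow_inv_natCast_pow (by positivity) (by omega)
  refine ⟨s • K, ?_, ?_⟩
  · rw [hF.mixedVolumePair_one_smul hΘ hK hs, h1, hsd, inv_mul_cancel₀ (by positivity)]
  · rw [dualProjectionBody_smul hΘ K hs, measureReal_smul _ (by positivity), hd.out, hsd, ← hP,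
      ← hqdef]
    have e : q * (t ^ (d + 1) * q) ^ d = (t ^ d * q) ^ (d + 1) := by ring
    refine eq_inv_of_mul_eq_one_left ?_
    rw [mul_assoc, e, inv_pow, inv_mul_cancel₀ (by positivity)]

end AffineInvariant

end ZonoidIneq

end

/-! ### The inequality and its equality case. -/

theorem mainTheorem5 {V : Type*} [NormedAddCommGroup V] [NormedSpace ℝ V] [FiniteDimensional ℝ V]
    [MeasurableSpace V] [BorelSpace V] (d : ℕ) (hd : 2 ≤ d + 1) [Fact (Module.finrank ℝ V = d + 1)]
    (Ω : V [⋀^Fin (d + 1)]→ₗ[ℝ] ℝ) (hΩ : Ω ≠ 0)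
    (A : ConvexBody V) (hA : (interior (A : Set V)).Nonempty) :
    ZonoidIneq.affineInvariant (ZonoidIneq.dualForm Ω) (ZonoidIneq.projectionBody Ω A) ≤
        ENNReal.ofReal
          (ZonoidIneq.unitBallVolume (d + 1) ^ d / ZonoidIneq.unitBallVolume d ^ (d + 1) *
            (ZonoidIneq.dualForm Ω).measure.real (ZonoidIneq.projectionBody Ω A : Set _) *
            Ω.measure.real (A : Set V) ^ (1 - (d + 1 : ℤ))) ∧
      (ZonoidIneq.affineInvariant (ZonoidIneq.dualForm Ω) (ZonoidIneq.projectionBody Ω A) =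
          ENNReal.ofReal
            (ZonoidIneq.unitBallVolume (d + 1) ^ d / ZonoidIneq.unitBallVolume d ^ (d + 1) *
              (ZonoidIneq.dualForm Ω).measure.real (ZonoidIneq.projectionBody Ω A : Set _) *
              Ω.measure.real (A : Set V) ^ (1 - (d + 1 : ℤ))) ↔
        ∃ P : ConvexBody V, ZonoidIneq.IsProjectionBody Ω P ∧
          ZonoidIneq.IsHomothetic (A : Set V) (P : Set V)) := by
  have hd1 : 1 ≤ d := by omega
  have := ZonoidIneq.isAddHaarMeasure_measure hΩ
  have := ZonoidIneq.isAddHaarMeasure_measure (ZonoidIneq.dualForm_ne_zero hΩ)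
  have hm := ZonoidIneq.measureReal_pos_of_interior Ω.measure hA
  have hq := ZonoidIneq.measureReal_pos_of_interior (ZonoidIneq.dualForm Ω).measure
    (ZonoidIneq.interior_projectionBody_nonempty hΩ hA)
  have hκ : 0 < ZonoidIneq.unitBallVolume (d + 1) ^ d / ZonoidIneq.unitBallVolume d ^ (d + 1) :=
    div_pos (pow_pos (ZonoidIneq.unitBallVolume_pos _) _)
      (pow_pos (ZonoidIneq.unitBallVolume_pos _) _)
  rw [show (1 - (d + 1 : ℤ)) = -(d : ℤ) by ring, zpow_neg, zpow_natCast]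
  set κ := ZonoidIneq.unitBallVolume (d + 1) ^ d / ZonoidIneq.unitBallVolume d ^ (d + 1)
  set q := (ZonoidIneq.dualForm Ω).measure.real (ZonoidIneq.projectionBody Ω A : Set _)
  have hM : 0 < (Ω.measure.real (A : Set V) ^ d)⁻¹ := by positivity
  -- The factor vol(ΠA) is fixed and ΠL is transported from V** to V, so only vol(ΠL) varies in the
  -- supremum.
  have hsup : ZonoidIneq.affineInvariant (ZonoidIneq.dualForm Ω) (ZonoidIneq.projectionBody Ω A) =
      ENNReal.ofReal κ * ⨆ (L : ConvexBody (StrongDual ℝ V))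
        (_ : ZonoidIneq.mixedVolumePair (ZonoidIneq.dualForm Ω) 1 L
          (ZonoidIneq.projectionBody Ω A) = 1),
        ENNReal.ofReal (q * Ω.measure.real
          (ZonoidIneq.dualProjectionBody (ZonoidIneq.dualForm Ω) L : Set V)) := by
    simp only [ZonoidIneq.affineInvariant, ZonoidIneq.symplecticVolume_prod_projectionBody hΩ]
    rfl
  rw [hsup, mul_assoc, ENNReal.ofReal_mul hκ.le,
    ENNReal.mul_right_inj (ENNReal.ofReal_pos.2 hκ).ne' ENNReal.ofReal_ne_top]
  have hle : ⨆ (L : ConvexBody (StrongDual ℝ V))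
      (_ : ZonoidIneq.mixedVolumePair (ZonoidIneq.dualForm Ω) 1 L
        (ZonoidIneq.projectionBody Ω A) = 1),
      ENNReal.ofReal (q * Ω.measure.real
        (ZonoidIneq.dualProjectionBody (ZonoidIneq.dualForm Ω) L : Set V)) ≤
        ENNReal.ofReal (q * (Ω.measure.real (A : Set V) ^ d)⁻¹) :=
    iSup₂_le fun L hL => ENNReal.ofReal_le_ofReal (mul_le_mul_of_nonneg_left
      (ZonoidIneq.measureReal_dualProjectionBody_le hΩ hd1 hA hL) hq.le)
  refine ⟨mul_le_mul_right hle _, fun h => ?_, ?_⟩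
  -- Equality of the supremum with the bound means that every smaller value is exceeded by an
  -- admissible L; compactness then yields an L attaining the bound.
  · obtain ⟨L, hLi, hL, hvol⟩ := ZonoidIneq.exists_maximizer hΩ hd1 hA hM fun c hc => by
      have h1 : ENNReal.ofReal (q * c) <
          ENNReal.ofReal (q * (Ω.measure.real (A : Set V) ^ d)⁻¹) :=
        (ENNReal.ofReal_lt_ofReal_iff (by positivity)).2 (mul_lt_mul_of_pos_left hc hq)
      rw [← h] at h1
      simp only [lt_iSup_iff] at h1
      obtain ⟨L, hL, h2⟩ := h1
      exact ⟨L, hL, lt_of_mul_lt_mul_left (ENNReal.ofReal_lt_ofReal_iff'.1 h2).1 hq.le⟩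
    exact ⟨_, ZonoidIneq.isProjectionBody_iff.2 ⟨L, rfl⟩,
      ZonoidIneq.isHomothetic_dualProjectionBody hΩ hd1 hA hLi hL hvol⟩
  · rintro ⟨P, hP, hAP⟩
    obtain ⟨K, rfl⟩ := ZonoidIneq.isProjectionBody_iff.1 hP
    obtain ⟨L, hL, hvol⟩ := ZonoidIneq.exists_measureReal_dualProjectionBody_eq hΩ hd1 hA hAP
    refine le_antisymm hle (le_iSup₂_of_le L hL ?_)
    rw [hvol]
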